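/- **Setting.** Let $n\ge 1$ and let $\mathbb G$ be a toroidal grid diagram of index $n$: horizontal circles $\alpha_1,\dots,\alpha_n$ and vertical circles $\beta_1,\dots,\beta_n$ on the torus, cutting it into $n^2$ squares, with one $X$ and one $O$ marking in each row and in each column. Let $H_j$, $V_j$ be the horizontal and the vertical annulus (row, column) through the marking $O_j$. A generator is a set of $n$ points, one on each $\alpha$- and each $\beta$-circle; $x^{\sigma}$, $\sigma\in S_n$, has the points $\alpha_{\sigma(i)}\cap\beta_i$. A positive domain $D\in\mathscr D^+(x,y)$ is a combination of squares with nonnegative integer coefficients such that $\partial(\partial D\cap\alpha)=y-x$; $D*E\in\mathscr D^+(x,z)$ is the sum of $D\in\mathscr D^+(x,y)$ and $E\in\mathscr D^+(y,z)$ as 2-chains; $c_x$ is the zero domain from $x$ to $x$. $\mu(D)=n_x(D)+n_y(D)$ is the Maslov index, where $n_x(D)$ is the sum over the points of $x$ of the average coefficient of $D$ in the four adjacent squares. A rectangle from $x$ to $y$ is an embedded rectangle with bottom left and top right corners in $x$, the other two corners in $y$, the remaining $n-2$ points of $x$ and $y$ being equal and not in the rectangle. **Generators.** $\mathit{CDP}_*$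 is freely generated by the triples $(D,\vec N,\vec\lambda)$, where $D$ is a positive domain, $\vec N\in\mathbb N^n$, and $\lambda_j$ is an ordered partition of $N_j$ into $l(\lambda_j)$ positive parts. The degree is $\mu(D)+\sum_j l(\lambda_j)$. Below, $\vec\lambda'$ is $\vec\lambda$ with $\lambda_j$ replaced by $\lambda_j'$, and $\vec N$ changes accordingly. **Differential mod 2.** Over $\mathbb Z/2$, $\partial(D,\vec N,\vec\lambda)$ is the sum of: (I) $(E,\vec N,\vec\lambda)$ for each decomposition $D=R*E$ and each $D=E*R$ with $R$ a rectangle; (II) $(E,\vec N+\vec e_j,\vec\lambda')$ for each $j$, each $D=E*H_j$ and $D=E*V_j$, and each position at which a part $1$ is inserted into $\lambda_j$; (III) $(D,\vec N,\vec\lambda')$ for each $j$ and each pair of consecutive parts of $\lambda_j$, which are replaced by their sum; (IV) for each $j$ with $\lambda_j$ nonempty, one term for deleting the first part of $\lambda_j$ and one for deleting the last part. **Sign assignment.** A sign assignment is a $\mathbb Z/2$-valued $1$-cochain $s$ such that: $\delta s(D,0,0)=1$ for every $D$ of index $2$ that is not an annulus; $\delta s(V,0,0)=1$ for every vertical and $\delta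 s(H,0,0)=0$ for every horizontal annulus; $\delta s(R,N\vec e_j,(N))=0$ for every rectangle $R$; $\delta s(c_x,N\vec e_j+M\vec e_k,((N),(M)))=0$ for $j\ne k$; and $\delta s(c_x,(N+M)\vec e_j,(N,M))=0$ (for all $x$, $j$, $k$ and $N,M>0$). Write $s(R)=s(R,0,0)$ and $s_j=s(c_{x^{\mathrm{Id}}},\vec e_j,(1))$. **Differential over $\mathbb Z$.** Given $s$, let $\partial(D,\vec N,\vec\lambda)$ over $\mathbb Z$ be the sum of the same terms with the following signs. Put $\varepsilon_j=(-1)^{\mu(D)+l(\lambda_1)+\dots+l(\lambda_{j-1})}$. (I) $(-1)^{s(R)}$ for $D=R*E$ and $(-1)^{\mu(D)+s(R)}$ for $D=E*R$. (II) When the new part $1$ becomes the $k$-th part: $\varepsilon_j(-1)^{k}$ for $H_j$ and $\varepsilon_j(-1)^{k+1}$ for $V_j$. (III) $\varepsilon_j(-1)^k$ when the $k$-th and $(k+1)$-st parts are added. (IV) $\varepsilon_j(-1)^{a s_j}$ for deleting the first part $a$, and $\varepsilon_j(-1)^{l(\lambda_j)+b s_j}$ for deleting the last part $b$. **Proposition.**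 Let $s$ be a sign assignment. Then $\partial$ lowers the degree by one and $\partial^2=0$, so $\mathit{CDP}_*=\mathit{CDP}_*(\mathbb G;\mathbb Z)$ is a chain complex of abelian groups. It has an exhaustive increasing filtration $F_0\subseteq F_1\subseteq F_2\subseteq\cdots$ by subcomplexes whose associated graded complex $\bigoplus_{p\ge0}F_p/F_{p-1}$ (with $F_{-1}=0$) has homology isomorphic, as a graded group, to $\mathbb Z^{2^n}\otimes\mathbb Z[U]$, where $\mathbb Z^{2^n}$ denotes the graded group with $\mathbb Z^{\binom nk}$ in degree $k$, and $\mathbb Z[U]$ the one with $\mathbb Z$ in every nonnegative even degree and $0$ in every odd degree. Moreover, for every $k\ge0$, $$\operatorname{rank} H_k(\mathit{CDP}_*)\le\sum_{l=0}^{\lfloor k/2\rfloor}\binom{n}{k-2l}.$$ -/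

import Mathlib

open CategoryTheory
open scoped DirectSum TensorProduct

noncomputable section

/-! ## Filtered chain complexes of modules -/

/-- An increasing, exhaustive filtration `F₀ ⊆ F₁ ⊆ F₂ ⊆ ⋯` of a chain complex by subcomplexes. -/
structure ChainFiltration {R : Type} [CommRing R] (K : ChainComplex (ModuleCat.{0} R) ℕ) where
  /-- the degree `k` part of the `p`-th subcomplex -/
  sub : ℕ → (k : ℕ) → Submodule R (K.X k)
  mono : ∀ k, Monotone (fun p => sub p k)
  map_d : ∀ p k l, ∀ x ∈ sub p k, (K.d k l).hom x ∈ sub p l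
  exhaustive : ∀ k, ⨆ p, sub p k = ⊤

namespace ChainFiltration

variable {R : Type} [CommRing R] {K : ChainComplex (ModuleCat.{0} R) ℕ} (F : ChainFiltration K)

/-- The preceding filtration step: `F_{p-1}` if `p > 0`, and `0` if `p = 0`. -/
def prev : ℕ → (k : ℕ) → Submodule R (K.X k)
  | 0, _ => ⊥
  | p + 1, k => F.sub p k

lemma prev_map_d (p k l : ℕ) (x : K.X k) (hx : x ∈ F.prev p k) :
    (K.d k l).hom x ∈ F.prev p l := by
  cases p with
  | zero =>
    have h0 : x = 0 := hx
    subst h0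
    simp
  | succ p => exact F.map_d p k l x hx

/-- The degree `k` part `F_p / F_{p-1}` of the `p`-th graded piece. -/
abbrev Piece (p k : ℕ) : Type :=
  ↥(F.sub p k) ⧸ (F.prev p k).submoduleOf (F.sub p k)

lemma prev_le_comap (p k l : ℕ) :
    (F.prev p k).submoduleOf (F.sub p k) ≤
      ((F.prev p l).submoduleOf (F.sub p l)).comap ((K.d k l).hom.restrict (F.map_d p k l)) :=
  fun x hx => F.prev_map_d p k l x hx

/-- The differential which `K` induces on `F_p / F_{p-1}`. -/
def pieceD (p k l : ℕ) : F.Piece p k →ₗ[R] F.Piece p l :=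
  Submodule.mapQ _ _ ((K.d k l).hom.restrict (F.map_d p k l)) (F.prev_le_comap p k l)

lemma pieceD_mk (p k l : ℕ) (x : F.sub p k) :
    F.pieceD p k l (Submodule.Quotient.mk x) =
      Submodule.Quotient.mk ⟨(K.d k l).hom (x : K.X k), F.map_d p k l x x.2⟩ := rfl

lemma pieceD_comp (p k l m : ℕ) (x : F.Piece p k) :
    F.pieceD p l m (F.pieceD p k l x) = 0 := by
  obtain ⟨x, rfl⟩ := Submodule.Quotient.mk_surjective _ x
  have h : (K.d l m).hom ((K.d k l).hom (x : K.X k)) = 0 :=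
    LinearMap.congr_fun (congrArg ModuleCat.Hom.hom (K.d_comp_d k l m)) (x : K.X k)
  rw [pieceD_mk, pieceD_mk]
  exact congrArg Submodule.Quotient.mk (Subtype.ext h)

lemma pieceD_shape (p k l : ℕ) (h : ¬ (ComplexShape.down ℕ).Rel k l) (x : F.Piece p k) :
    F.pieceD p k l x = 0 := by
  obtain ⟨x, rfl⟩ := Submodule.Quotient.mk_surjective _ x
  have h1 : (K.d k l).hom (x : K.X k) = 0 :=
    LinearMap.congr_fun (congrArg ModuleCat.Hom.hom (K.shape k l h)) (x : K.X k)
  rw [pieceD_mk]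
  exact congrArg Submodule.Quotient.mk (Subtype.ext h1)

/-- The associated graded complex `⨁ₚ F_p / F_{p-1}`. -/
def assocGraded : ChainComplex (ModuleCat.{0} R) ℕ where
  X k := ModuleCat.of R (⨁ p, F.Piece p k)
  d k l := ModuleCat.ofHom (DirectSum.lmap (fun p => F.pieceD p k l))
  shape k l h := by
    ext : 1
    refine LinearMap.ext fun x => ?_
    refine DFinsupp.ext fun p => ?_
    exact F.pieceD_shape p k l h _
  d_comp_d' k l m _ _ := by
    ext : 1
    refine LinearMap.ext fun x => ?_
    refine DFinsupp.ext fun p => ?_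
    exact F.pieceD_comp p k l m _

end ChainFiltration

/-! ## Generators, positive domains, rectangles, annuli

Everything on the torus is indexed cyclically by `Fin n`.  The vertical circle `β_i` is the left
edge of column `i` and the horizontal circle `α_j` is the bottom edge of row `j`; the square in
column `i` and row `j` is `(i, j)`.  A permutation `x` is the generator with the points
`α_{x i} ∩ β_i`. -/

variable {n : ℕ} [NeZero n]

/-- The multiplicity at the lattice point `α_j ∩ β_i` of `∂ (∂ D ∩ α)`, for the 2-chain `D` on the
torus with multiplicity `D i j` in the square `(i, j)`: the edge of `α_j` which runs from `β_i` to
`β_{i+1}` occurs in `∂ D` with multiplicity `D i j - D i (j - 1)`. -/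
def alphaBoundary (D : Fin n → Fin n → ℤ) (i j : Fin n) : ℤ :=
  (D (i - 1) j - D (i - 1) (j - 1)) - (D i j - D i (j - 1))

/-- The generator `x`, as the sum of its `n` points. -/
def genChain (x : Equiv.Perm (Fin n)) (i j : Fin n) : ℤ := if x i = j then 1 else 0

/-- A positive domain `D ∈ 𝒟⁺(x, y)`, together with its initial generator `x = src` and its final
generator `y = tgt`. -/
@[ext]
structure PosDomain (n : ℕ) [NeZero n] where
  src : Equiv.Perm (Fin n)
  tgt : Equiv.Perm (Fin n)
  /-- the multiplicity in the square in a given column and row -/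
  coeff : Fin n → Fin n → ℕ
  boundary : ∀ i j, alphaBoundary (fun c r => (coeff c r : ℤ)) i j = genChain tgt i j - genChain src i j

/-- The sum of the multiplicities of `D` in the four squares around the point `α_j ∩ β_i`. -/
def cornerSum (D : Fin n → Fin n → ℕ) (i j : Fin n) : ℕ :=
  D (i - 1) (j - 1) + D (i - 1) j + D i (j - 1) + D i j

namespace PosDomain

/-- The Maslov index `n_x(D) + n_y(D)`, where `n_x(D)` is the sum over the points of `x` of the
average multiplicity of `D` in the four squares around the point. (Each square has Euler measure
`0`; the division by `4` is exact for a domain.) -/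
def maslov (D : PosDomain n) : ℕ :=
  (∑ i, cornerSum D.coeff i (D.src i) + ∑ i, cornerSum D.coeff i (D.tgt i)) / 4

/-- The constant domain `c_x`. -/
def const (x : Equiv.Perm (Fin n)) : PosDomain n where
  src := x
  tgt := x
  coeff := fun _ _ => 0
  boundary := by simp [alphaBoundary]

/-- For `D = R * E` (addition of 2-chains, `R` from `x` to `z`, `E` from `z` to `y`), the domain
`E`. -/
def removeFront (D R : PosDomain n) (hs : R.src = D.src) (hle : R.coeff ≤ D.coeff) :
    PosDomain n where
  src := R.tgt
  tgt := D.tgt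
  coeff := fun c r => D.coeff c r - R.coeff c r
  boundary := by
    intro i j
    have hD := D.boundary i j
    have hR := R.boundary i j
    have hc : ∀ c r, ((D.coeff c r - R.coeff c r : ℕ) : ℤ) = D.coeff c r - R.coeff c r :=
      fun c r => Nat.cast_sub (hle c r)
    rw [hs] at hR
    simp only [alphaBoundary, hc] at hD hR ⊢
    linarith

/-- For `D = E * R` (`E` from `x` to `z`, `R` from `z` to `y`), the domain `E`. -/
def removeBack (D R : PosDomain n) (ht : R.tgt = D.tgt) (hle : R.coeff ≤ D.coeff) :
    PosDomain n where
  src := D.src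
  tgt := R.src
  coeff := fun c r => D.coeff c r - R.coeff c r
  boundary := by
    intro i j
    have hD := D.boundary i j
    have hR := R.boundary i j
    have hc : ∀ c r, ((D.coeff c r - R.coeff c r : ℕ) : ℤ) = D.coeff c r - R.coeff c r :=
      fun c r => Nat.cast_sub (hle c r)
    rw [ht] at hR
    simp only [alphaBoundary, hc] at hD hR ⊢
    linarith

/-- The vertical annulus in column `c`, as a domain from `x` to itself. -/
def colAnnulus (x : Equiv.Perm (Fin n)) (c : Fin n) : PosDomain n where
  src := x
  tgt := x
  coeff := fun c' _ => if c' = c then 1 else 0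
  boundary := by simp [alphaBoundary]

/-- The horizontal annulus in row `r`, as a domain from `x` to itself. -/
def rowAnnulus (x : Equiv.Perm (Fin n)) (r : Fin n) : PosDomain n where
  src := x
  tgt := x
  coeff := fun _ r' => if r' = r then 1 else 0
  boundary := by simp [alphaBoundary]

end PosDomain

/-- `c` lies in the cyclic interval `{i, i + 1, …, j - 1}`. -/
def InCyc (i j c : Fin n) : Prop := c - i < j - i

instance (i j c : Fin n) : Decidable (InCyc i j c) :=
  inferInstanceAs (Decidable (c - i < j - i))

lemma fin_sub_one_lt (a b : Fin n) :
    (if a - 1 < b then (1 : ℤ) else 0) - (if a < b then 1 else 0) =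
      (if a = b then 1 else 0) - (if a = 0 then 1 else 0) := by
  by_cases ha : a = 0
  · subst ha
    have hlast : ¬ ((0 : Fin n) - 1 < b) := by
      have hb := b.isLt
      have hn := NeZero.pos n
      rw [Fin.lt_def, Fin.val_sub]
      rcases Nat.lt_or_ge 1 n with h | h
      · rw [Fin.val_one', Nat.mod_eq_of_lt h, Fin.val_zero, Nat.add_zero,
          Nat.mod_eq_of_lt (by omega)]
        omega
      · have : n = 1 := by omega
        omega
    rw [if_neg hlast]
    by_cases hb : b = 0
    · subst hb
      simp
    · have hb1 : (0 : Fin n) < b := Fin.pos_iff_ne_zero.mpr hb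
      rw [if_pos hb1, if_neg (Ne.symm hb)]
      simp
  · have hv : (a - 1 : Fin n).val = a.val - 1 := by
      have h0 : a.val ≠ 0 := fun h => ha (Fin.ext (by simpa using h))
      have hlt := a.isLt
      rw [Fin.val_sub, Fin.val_one', Nat.mod_eq_of_lt (show 1 < n by omega)]
      rw [show n - 1 + a.val = n + (a.val - 1) by omega, Nat.add_mod_left,
        Nat.mod_eq_of_lt (by omega)]
    have h0 : a.val ≠ 0 := fun h => ha (Fin.ext (by simpa using h))
    simp only [Fin.lt_def, hv, Fin.ext_iff, Fin.val_zero]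
    split_ifs <;> omega

lemma inCyc_sub_one (i j c : Fin n) :
    (if InCyc i j (c - 1) then (1 : ℤ) else 0) - (if InCyc i j c then 1 else 0) =
      (if c = j then 1 else 0) - (if c = i then 1 else 0) := by
  have h := fin_sub_one_lt (c - i) (j - i)
  have h3 : c - i - 1 = c - 1 - i := sub_right_comm c i 1
  rw [h3] at h
  simp only [sub_left_inj, sub_eq_zero] at h
  exact h

/-- The 2-chain of the rectangle on the torus whose bottom left corner is the point of `x` on `β_i`
and whose top right corner is the point of `x` on `β_j`. -/
def rectCoeff (x : Equiv.Perm (Fin n)) (i j : Fin n) : Fin n → Fin n → ℕ := fun c r =>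
  if InCyc i j c ∧ InCyc (x i) (x j) r then 1 else 0

/-- The rectangle with bottom left corner the point of `x` on `β_i` and top right corner the point
of `x` on `β_j` is a rectangle from `x` to a generator: `i ≠ j`, and no other point of `x` lies in
it. -/
def IsEmptyRect (x : Equiv.Perm (Fin n)) (i j : Fin n) : Prop :=
  i ≠ j ∧ ∀ k, k ≠ i → ¬ (InCyc i j k ∧ InCyc (x i) (x j) (x k))

namespace PosDomain

/-- The rectangle with bottom left corner the point of `x` on `β_i` and top right corner the point
of `x` on `β_j`, as a domain from `x`; the final generator has the other two corners instead. -/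
def rect (x : Equiv.Perm (Fin n)) (i j : Fin n) : PosDomain n where
  src := x
  tgt := x * Equiv.swap i j
  coeff := rectCoeff x i j
  boundary := by
    intro c r
    have hmul : ∀ c r, (rectCoeff x i j c r : ℤ) =
        (if InCyc i j c then 1 else 0) * (if InCyc (x i) (x j) r then 1 else 0) := by
      intro c r
      by_cases h1 : InCyc i j c <;> by_cases h2 : InCyc (x i) (x j) r <;>
        simp [rectCoeff, h1, h2]
    have hc := inCyc_sub_one i j c
    have hr := inCyc_sub_one (x i) (x j) r
    have key : alphaBoundary (fun c r => (rectCoeff x i j c r : ℤ)) c r =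
        ((if c = j then 1 else 0) - (if c = i then 1 else 0)) *
          -((if r = x j then 1 else 0) - (if r = x i then 1 else 0)) := by
      rw [← hc, ← hr]
      simp only [alphaBoundary, hmul]
      ring
    rw [key]
    simp only [genChain, Equiv.Perm.mul_apply]
    by_cases hj : c = j
    · subst hj
      by_cases hi : c = i
      · subst hi
        simp
      · simp [hi, eq_comm]
    · by_cases hi : c = i
      · subst hi
        simp [hj, eq_comm]
      · simp [hi, hj, Equiv.swap_apply_of_ne_of_ne hi hj]

/-- `D` is a rectangle. -/
def IsRect (D : PosDomain n) : Prop :=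
  ∃ x i j, IsEmptyRect x i j ∧ D = rect x i j

end PosDomain

/-- A toroidal grid diagram of index `n`: in every column and every row one `X` and one `O`; the
markings are labelled by `Fin n`, and `O_j` lies in column `oCol j` and row `oRow j`. -/
structure GridDiagram (n : ℕ) where
  oCol : Equiv.Perm (Fin n)
  oRow : Equiv.Perm (Fin n)
  xCol : Equiv.Perm (Fin n)
  xRow : Equiv.Perm (Fin n)

/-! ## The complex of positive domains with partitions -/

/-- An ordered partition `(λ_1, …, λ_m)` of `N = ∑ λ_i` into positive parts. -/
abbrev OrdPartition : Type := List ℕ+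

namespace OrdPartition

/-- The unit enlargement which inserts a part `1` in front of the part number `p` (from `0`). -/
def unitEnlarge (l : OrdPartition) (p : ℕ) : OrdPartition := l.insertIdx p 1

/-- The elementary coarsening which adds up the parts number `p` and `p + 1` (from `0`). -/
def coarsen : OrdPartition → ℕ → OrdPartition
  | a :: b :: l, 0 => (a + b) :: l
  | a :: l, p + 1 => a :: coarsen l p
  | l, 0 => l
  | [], _ + 1 => []

end OrdPartition

/-- A free generator `(D, N, λ)` of the complex: a positive domain and an `n`-tuple of ordered
partitions. The tuple `N` is not recorded, as `N_j` is the sum of the parts of `λ_j`. -/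
@[ext]
structure CDPGen (n : ℕ) [NeZero n] where
  dom : PosDomain n
  part : Fin n → OrdPartition

namespace CDPGen

/-- The grading: Maslov index plus total length of the partitions. -/
def degree (g : CDPGen n) : ℕ := g.dom.maslov + ∑ j, (g.part j).length

/-- `(D, 0, 0)` -/
def ofDom (D : PosDomain n) : CDPGen n := ⟨D, fun _ => []⟩

/-- `(D, N e_j, (N))` -/
def single (D : PosDomain n) (j : Fin n) (N : ℕ+) : CDPGen n :=
  ⟨D, Function.update (fun _ => []) j [N]⟩

/-- Replace the partition `λ_j`. -/
def setPart (g : CDPGen n) (j : Fin n) (l : OrdPartition) : CDPGen n :=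
  ⟨g.dom, Function.update g.part j l⟩

/-- Replace the domain. -/
def setDom (g : CDPGen n) (D : PosDomain n) : CDPGen n := ⟨D, g.part⟩

end CDPGen

section Differential

variable (A : Type) [CommRing A]

/-- The sign `(-1)^t`, for `t ∈ ℤ/2`. -/
def sgn (t : ZMod 2) : A := (-1) ^ t.val

/-- Type I terms. The first sum is over the `R * E = D`, the second over the `E * R = D`, with `R` a
rectangle; `sR R` is the sign of the rectangle `R`. -/
def bdryI (sR : PosDomain n → ZMod 2) (g : CDPGen n) : CDPGen n →₀ A :=
  open Classical in
  (∑ i, ∑ j,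
    if h : IsEmptyRect g.dom.src i j ∧ (PosDomain.rect g.dom.src i j).coeff ≤ g.dom.coeff then
      Finsupp.single (g.setDom (g.dom.removeFront (PosDomain.rect g.dom.src i j) rfl h.2))
        (sgn A (sR (PosDomain.rect g.dom.src i j)))
    else 0) +
  ∑ i, ∑ j,
    if h : IsEmptyRect (g.dom.tgt * Equiv.swap i j) i j ∧
        (PosDomain.rect (g.dom.tgt * Equiv.swap i j) i j).coeff ≤ g.dom.coeff then
      Finsupp.single
        (g.setDom (g.dom.removeBack (PosDomain.rect (g.dom.tgt * Equiv.swap i j) i j)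
          (by simp [PosDomain.rect, mul_assoc]) h.2))
        ((-1) ^ g.dom.maslov * sgn A (sR (PosDomain.rect (g.dom.tgt * Equiv.swap i j) i j)))
    else 0

/-- The sign `(-1)^(l(λ_1) + ⋯ + l(λ_{j-1}))`. -/
def preSign (g : CDPGen n) (j : Fin n) : A :=
  (-1) ^ (∑ i ∈ Finset.univ.filter (· < j), (g.part i).length)

/-- Type II terms: take out the horizontal (first sum) or vertical (second sum) annulus through
`O_j`, and perform a unit enlargement of `λ_j`; the sign of the latter is `(-1)^p` (the new part
has number `p + 1` if one counts from `1`). -/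
def bdryII (G : GridDiagram n) (g : CDPGen n) : CDPGen n →₀ A :=
  open Classical in
  (∑ j,
    if h : (PosDomain.rowAnnulus g.dom.tgt (G.oRow j)).coeff ≤ g.dom.coeff then
      ∑ p ∈ Finset.range ((g.part j).length + 1),
        Finsupp.single
          ((g.setDom (g.dom.removeBack (PosDomain.rowAnnulus g.dom.tgt (G.oRow j)) rfl h)).setPart
            j ((g.part j).unitEnlarge p))
          ((-1) ^ g.dom.maslov * preSign A g j * (-1) ^ (1 + p))
    else 0) +
  ∑ j,
    if h : (PosDomain.colAnnulus g.dom.tgt (G.oCol j)).coeff ≤ g.dom.coeff then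
      ∑ p ∈ Finset.range ((g.part j).length + 1),
        Finsupp.single
          ((g.setDom (g.dom.removeBack (PosDomain.colAnnulus g.dom.tgt (G.oCol j)) rfl h)).setPart
            j ((g.part j).unitEnlarge p))
          ((-1) ^ g.dom.maslov * preSign A g j * (-1) ^ p)
    else 0

/-- Type III terms: elementary coarsenings of some `λ_j`, with sign `(-1)^(p+1)` (the first of the
two parts has number `p + 1` if one counts from `1`). -/
def bdryIII (g : CDPGen n) : CDPGen n →₀ A :=
  ∑ j, ∑ p ∈ Finset.range ((g.part j).length - 1),
    Finsupp.single (g.setPart j ((g.part j).coarsen p))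
      ((-1) ^ g.dom.maslov * preSign A g j * (-1) ^ (p + 1))

/-- Type IV terms: the initial reductions (first sum) and the final reductions (second sum) of the
nonempty `λ_j`; `sB j` is the sign `s_j`. -/
def bdryIV (sB : Fin n → ZMod 2) (g : CDPGen n) : CDPGen n →₀ A :=
  (∑ j,
    if h : g.part j ≠ [] then
      Finsupp.single (g.setPart j (g.part j).tail)
        ((-1) ^ g.dom.maslov * preSign A g j * sgn A ((((g.part j).head h : ℕ+) : ℕ) * sB j))
    else 0) +
  ∑ j,
    if h : g.part j ≠ [] then
      Finsupp.single (g.setPart j (g.part j).dropLast)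
        ((-1) ^ g.dom.maslov * (preSign A g j * (-1) ^ (g.part j).length) *
          sgn A ((((g.part j).getLast h : ℕ+) : ℕ) * sB j))
    else 0

/-- The differential with coefficients in `A`, for given signs `sR` of the rectangles and `sB j` of
the bubbles. -/
def bdry (G : GridDiagram n) (sR : PosDomain n → ZMod 2) (sB : Fin n → ZMod 2) :
    (CDPGen n →₀ A) →ₗ[A] (CDPGen n →₀ A) :=
  Finsupp.linearCombination A
    (fun g => bdryI A sR g + bdryII A G g + bdryIII A g + bdryIV A sB g)

end Differential

/-! ## Sign assignments -/

/-- The coboundary `δ s` of a cochain `s` with values in `ℤ/2`, evaluated at a generator `g`; it is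
formed with the differential over `ℤ/2`, in which all terms of the types I to IV have the
coefficient `1 = -1`. -/
def coboundary (G : GridDiagram n) (s : CDPGen n → ZMod 2) (g : CDPGen n) : ZMod 2 :=
  Finsupp.linearCombination (ZMod 2) s (bdry (ZMod 2) G 0 0 (Finsupp.single g 1))

/-- `s` is a sign assignment for the complex of positive domains with partitions. The cochain `s` is
a `1`-cochain: it matters only on the generators of degree `1`. -/
structure IsSignAssignment (G : GridDiagram n) (s : CDPGen n → ZMod 2) : Prop where
  square : ∀ D : PosDomain n, D.maslov = 2 →
    (∀ x c, D ≠ PosDomain.colAnnulus x c) → (∀ x r, D ≠ PosDomain.rowAnnulus x r) →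
    coboundary G s (CDPGen.ofDom D) = 1
  vertical : ∀ x c, coboundary G s (CDPGen.ofDom (PosDomain.colAnnulus x c)) = 1
  horizontal : ∀ x r, coboundary G s (CDPGen.ofDom (PosDomain.rowAnnulus x r)) = 0
  rect : ∀ (R : PosDomain n) (j : Fin n) (N : ℕ+), R.IsRect →
    coboundary G s (CDPGen.single R j N) = 0
  const_two : ∀ (x : Equiv.Perm (Fin n)) (j k : Fin n) (N M : ℕ+), j ≠ k →
    coboundary G s ((CDPGen.single (PosDomain.const x) j N).setPart k [M]) = 0
  const_split : ∀ (x : Equiv.Perm (Fin n)) (j : Fin n) (N M : ℕ+),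
    coboundary G s ((CDPGen.ofDom (PosDomain.const x)).setPart j [N, M]) = 0

/-! ## The complex over the integers -/

/-- The value `s_j = s(c_{x^Id}, e_j, (1))`. -/
def bubbleSign (s : CDPGen n → ZMod 2) (j : Fin n) : ZMod 2 :=
  s (CDPGen.single (PosDomain.const 1) j 1)

/-- The differential over `ℤ` given by the sign assignment `s`. -/
def cdpD (G : GridDiagram n) (s : CDPGen n → ZMod 2) : (CDPGen n →₀ ℤ) →ₗ[ℤ] (CDPGen n →₀ ℤ) :=
  bdry ℤ G (fun R => s (CDPGen.ofDom R)) (bubbleSign s)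

/-- The chain group in degree `k`, freely generated by the generators of degree `k`. -/
abbrev cdpChains (n : ℕ) [NeZero n] (k : ℕ) : Submodule ℤ (CDPGen n →₀ ℤ) :=
  Finsupp.supported ℤ ℤ {g : CDPGen n | g.degree = k}

/-- `∂` lowers the degree by one and `∂² = 0`. -/
structure IsCDPDifferential (G : GridDiagram n) (s : CDPGen n → ZMod 2) : Prop where
  degree_zero : ∀ x ∈ cdpChains n 0, cdpD G s x = 0
  degree_succ : ∀ k, ∀ x ∈ cdpChains n (k + 1), cdpD G s x ∈ cdpChains n k
  sq_zero : cdpD G s ∘ₗ cdpD G s = 0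

/-- The chain complex `CDP_*(𝔾; ℤ)`. -/
def cdpComplex (G : GridDiagram n) (s : CDPGen n → ZMod 2) (h : IsCDPDifferential G s) :
    ChainComplex (ModuleCat.{0} ℤ) ℕ :=
  ChainComplex.of (fun k => ModuleCat.of ℤ (cdpChains n k))
    (fun k => ModuleCat.ofHom ((cdpD G s).restrict (h.degree_succ k)))
    (fun k => by
      ext : 1
      refine LinearMap.ext fun x => Subtype.ext ?_
      exact LinearMap.congr_fun h.sq_zero (x : CDPGen n →₀ ℤ))

/-- The degree `k` part of `ℤ^{2^n} ⊗ ℤ[U]`: the tensor product of the graded abelian groups which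
have `ℤ^(n choose i)` in degree `i`, and `ℤ` in every even degree and `0` in every odd one. -/
abbrev CubeTensorPoly (n k : ℕ) : Type :=
  ⨁ p : Finset.HasAntidiagonal.antidiagonal k,
    (Fin (n.choose p.1.1) → ℤ) ⊗[ℤ] (Fin (if Even p.1.2 then 1 else 0) → ℤ)

end

/-! **The square of the differential.** Let `F` and `B` split a rectangle off the front and off the
back of a domain, let `m` be the sign of the Maslov index, let `E j` collect the terms that involve
`λ_j`, and let `p j` be the sign of the total length of the earlier partitions. Then `∂ = F + B m +
∑ E j p j m` (`bdry_eq`), and `∂² = 0` follows from relations between these operators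
(`sq_eq_zero_of_relations`). `F` and `B` commute because they act at opposite ends. `F²` and `B²`
are the same operator: a composition of two rectangles with different corners has exactly two
decompositions (`twoDecomp`, reduced to grids of size 3 and 4, which are checked exhaustively), the
sign assignment gives these opposite signs, and only the annuli survive, weighted by the bubble
signs (`frontOp_sq`, `backOp_sq`). Each `E j` is a reduction of `λ_j` plus an insertion of a part
`1` composed with the removal of an annulus. Reductions and insertions square to zero and
anticommute, and the removal of annuli commutes with everything on domains. The degree statement
rests on the additivity of the Maslov index (`IsComp.num_eq`), a discrete summation by parts.

**The homology.** Both homological claims come from one acyclic matching of the generators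
(`exists_matching`). If some `N_j ≥ 2`, a fixed such `λ_j` is toggled between `(1, b, …)` and `(1 +
b, …)`. If all `N_j ≤ 1`, the domain is toggled: a pivot column `c` is read off from data which do
not change, and the rectangle between `β_c` and `β_{c+1}` is removed from the front or added there.
Removal is possible by `rect_le_of_piv`. A lexicographic measure is lowered by every term of the
differential other than the matched one, so that it yields levels in `ℕ` and a filtration.

The unmatched generators are the multiples of the top row annulus at the identity permutation, with
every `λ_j` empty or `(1)`. The multiple `m` together with `i` nonempty partitions has degree `2 m +
i`, which accounts for `ℤ[U]` and for the binomial coefficients. The matched pairs contract the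
graded pieces onto the critical generators (`homology_assocGraded`), and the same matching bounds
the rank of the homology by elimination (`rank_homology`). -/

set_option linter.unusedSectionVars false

noncomputable section

/-! ## Homology of short complexes of modules -/

section ShortComplexes

variable {R : Type} [CommRing R]

/-- The homology is computed by a map on the middle term which vanishes on boundaries, is onto on
cycles, and detects boundaries. -/
lemma homology_equiv_of_detecting (S : ShortComplex (ModuleCat.{0} R)) {M : Type} [AddCommGroup M]
    [Module R M] (φ : S.X₂ →ₗ[R] M) (hf : ∀ w, φ (S.f.hom w) = 0)
    (hsurj : ∀ m, ∃ x, S.g.hom x = 0 ∧ φ x = m)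
    (hex : ∀ x, S.g.hom x = 0 → φ x = 0 → ∃ w, S.f.hom w = x) :
    Nonempty (S.homology ≃ₗ[R] M) := by
  have hle : LinearMap.range S.moduleCatToCycles ≤
      LinearMap.ker (φ.comp (LinearMap.ker S.g.hom).subtype) := by
    rintro _ ⟨w, rfl⟩
    exact hf w
  refine ⟨S.moduleCatHomologyIso.toLinearEquiv.trans (LinearEquiv.ofBijective
    (Submodule.liftQ _ (φ.comp (LinearMap.ker S.g.hom).subtype) hle) ⟨?_, ?_⟩)⟩
  · rw [← LinearMap.ker_eq_bot, Submodule.ker_liftQ_eq_bot]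
    rintro ⟨x, hx⟩ hφ
    obtain ⟨w, rfl⟩ := hex x hx hφ
    exact ⟨w, rfl⟩
  · intro m
    obtain ⟨x, hx, rfl⟩ := hsurj m
    exact ⟨Submodule.Quotient.mk ⟨x, hx⟩, rfl⟩

/-- If every cycle is homologous to one in `T`, then the rank of the homology is at most that
of `T`. -/
lemma rank_homology_le (S : ShortComplex (ModuleCat.{0} R)) (T : Submodule R S.X₂)
    (hT : ∀ x ∈ T, S.g.hom x = 0) (h : ∀ x, S.g.hom x = 0 → ∃ w, x - S.f.hom w ∈ T) :
    Module.rank R S.homology ≤ Module.rank R T := by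
  rw [S.moduleCatHomologyIso.toLinearEquiv.rank_eq]
  let ψ : T →ₗ[R] (LinearMap.ker S.g.hom ⧸ LinearMap.range S.moduleCatToCycles) :=
    (Submodule.mkQ _).comp (Submodule.inclusion hT)
  refine LinearMap.rank_le_of_surjective ψ ?_
  intro y
  obtain ⟨⟨x, hx⟩, rfl⟩ := Submodule.Quotient.mk_surjective _ y
  obtain ⟨w, hw⟩ := h x hx
  refine ⟨⟨_, hw⟩, ?_⟩
  refine (Submodule.Quotient.eq _).mpr ⟨-w, ?_⟩
  apply Subtype.ext
  change S.f.hom (-w) = x - S.f.hom w - x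
  rw [map_neg]
  abel

variable (K : ChainComplex (ModuleCat.{0} R) ℕ) (k : ℕ)

lemma d_eq_zero_of_sc_g (x : K.X k) (hx : (K.sc k).g.hom x = 0) (l : ℕ) :
    (K.d k l).hom x = 0 := by
  by_cases h : (ComplexShape.down ℕ).Rel k l
  · obtain rfl := (ComplexShape.down ℕ).next_eq' h
    exact hx
  · rw [K.shape k l h]
    rfl

lemma chainComplex_homology_equiv {M : Type} [AddCommGroup M] [Module R M] (φ : K.X k →ₗ[R] M)
    (hf : ∀ w, φ ((K.d (k + 1) k).hom w) = 0)
    (hsurj : ∀ m, ∃ x, (∀ l, (K.d k l).hom x = 0) ∧ φ x = m)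
    (hex : ∀ x, (∀ l, (K.d k l).hom x = 0) → φ x = 0 → ∃ w, (K.d (k + 1) k).hom w = x) :
    Nonempty (K.homology k ≃ₗ[R] M) := by
  -- `prev k` equals `k + 1` only propositionally. With its value as a variable, `rfl` can
  -- substitute the term that occurs in `K.sc k`.
  have key : ∀ j, (ComplexShape.down ℕ).prev k = j → (∀ w, φ ((K.d j k).hom w) = 0) →
      (∀ x, (∀ l, (K.d k l).hom x = 0) → φ x = 0 → ∃ w, (K.d j k).hom w = x) →
      Nonempty (K.homology k ≃ₗ[R] M) := by
    rintro _ rfl h1 h2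
    refine homology_equiv_of_detecting (K.sc k) φ h1 (fun m => ?_)
      (fun x hx => h2 x (d_eq_zero_of_sc_g K k x hx))
    obtain ⟨x, hx, hm⟩ := hsurj m
    exact ⟨x, hx _, hm⟩
  exact key (k + 1) (ChainComplex.prev ℕ k) hf hex

lemma chainComplex_rank_homology_le (T : Submodule R (K.X k))
    (hT : ∀ x ∈ T, ∀ l, (K.d k l).hom x = 0)
    (h : ∀ x, (∀ l, (K.d k l).hom x = 0) → ∃ w, x - (K.d (k + 1) k).hom w ∈ T) :
    Module.rank R (K.homology k) ≤ Module.rank R T := by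
  have key : ∀ j, (ComplexShape.down ℕ).prev k = j →
      (∀ x, (∀ l, (K.d k l).hom x = 0) → ∃ w, x - (K.d j k).hom w ∈ T) →
      Module.rank R (K.homology k) ≤ Module.rank R T := by
    rintro _ rfl h1
    exact rank_homology_le (K.sc k) T (fun x hx => hT x hx _)
      (fun x hx => h1 x (d_eq_zero_of_sc_g K k x hx))
  exact key (k + 1) (ChainComplex.prev ℕ k) h

end ShortComplexes

/-! ## Discrete Morse theory for based chain complexes -/

variable {R : Type} [CommRing R] {C : Type}

/-- The span of the basis elements of level less than `p`. -/
abbrev belowLevel (R : Type) [CommRing R] {C : Type} (level : C → ℕ) (p : ℕ) : Submodule R (C →₀ R) :=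
  Finsupp.supported R R {g | level g < p}

/-- The span of the basis elements of degree `k`. -/
abbrev inDegree (R : Type) [CommRing R] {C : Type} (deg : C → ℕ) (k : ℕ) : Submodule R (C →₀ R) :=
  Finsupp.supported R R {g | deg g = k}

/-- A matching of the basis elements such that the differential strictly decreases the level, except
that an upper element `u` hits its mate, which has the same level, with coefficient `± 1`. -/
structure MorseMatching (deg : C → ℕ) (d : (C →₀ R) →ₗ[R] (C →₀ R)) where
  level : C → ℕ
  upper : Set C
  lower : Set C
  mate : C → C
  sign : C → R
  sign_sq : ∀ u, sign u * sign u = 1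
  disj : ∀ g ∈ upper, g ∉ lower
  mate_upper : ∀ u ∈ upper, mate u ∈ lower
  mate_lower : ∀ l ∈ lower, mate l ∈ upper
  mate_mate : ∀ g ∈ upper ∪ lower, mate (mate g) = g
  level_mate : ∀ g ∈ upper ∪ lower, level (mate g) = level g
  deg_mate : ∀ u ∈ upper, deg (mate u) + 1 = deg u
  d_upper : ∀ u ∈ upper,
    d (Finsupp.single u 1) - Finsupp.single (mate u) (sign u) ∈ belowLevel R level (level u)
  d_other : ∀ g, g ∉ upper → d (Finsupp.single g 1) ∈ belowLevel R level (level g)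

namespace MorseMatching

variable {deg : C → ℕ} {d : (C →₀ R) →ₗ[R] (C →₀ R)} (m : MorseMatching deg d)

/-- The critical cells. -/
def crit : Set C := {g | g ∉ m.upper ∧ g ∉ m.lower}

/-- The part of the differential which preserves the level `p`. -/
def d0 (p : ℕ) : (C →₀ R) →ₗ[R] (C →₀ R) :=
  open Classical in
  Finsupp.linearCombination R
    (fun g => if g ∈ m.upper ∧ m.level g = p then Finsupp.single (m.mate g) (m.sign g) else 0)

/-- The contraction of the matched pairs of level `p`. -/
def hmt (p : ℕ) : (C →₀ R) →ₗ[R] (C →₀ R) :=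
  open Classical in
  Finsupp.linearCombination R
    (fun g => if g ∈ m.lower ∧ m.level g = p then
      Finsupp.single (m.mate g) (m.sign (m.mate g)) else 0)

lemma belowLevel_mono {p q : ℕ} (h : p ≤ q) : belowLevel R m.level p ≤ belowLevel R m.level q :=
  Finsupp.supported_mono fun _ hg => lt_of_lt_of_le hg h

lemma mem_of_single {P : (C →₀ R) →ₗ[R] (C →₀ R)} {s : Set C} {T : Submodule R (C →₀ R)}
    (h : ∀ g ∈ s, P (Finsupp.single g 1) ∈ T) {x : C →₀ R} (hx : x ∈ Finsupp.supported R R s) :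
    P x ∈ T := by
  have : Finsupp.supported R R s ≤ T.comap P := by
    rw [Finsupp.supported_eq_span_single, Submodule.span_le]
    rintro _ ⟨g, hg, rfl⟩
    exact h g hg
  exact this hx

/-- The matched term is the only one that keeps the level, so `d0` is the differential of the graded
piece at level `p`. -/
lemma d_sub_d0 (p : ℕ) {x : C →₀ R} (hx : x ∈ belowLevel R m.level (p + 1)) :
    d x - m.d0 p x ∈ belowLevel R m.level p := by
  refine mem_of_single (P := d - m.d0 p) (fun g hg => ?_) hx
  have hg' : m.level g ≤ p := Nat.lt_succ_iff.mp hg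
  rw [LinearMap.sub_apply, d0, Finsupp.linearCombination_single, one_smul]
  by_cases hu : g ∈ m.upper
  · rcases hg'.eq_or_lt with h | h
    · rw [if_pos ⟨hu, h⟩, ← h]
      exact m.d_upper g hu
    · rw [if_neg (fun hh => h.ne hh.2), sub_zero]
      have h1 := m.belowLevel_mono hg' (m.d_upper g hu)
      have h2 : Finsupp.single (m.mate g) (m.sign g) ∈ belowLevel R m.level p :=
        Finsupp.single_mem_supported R _ (by
          change m.level _ < p
          rw [m.level_mate g (Or.inl hu)]
          exact h)
      simpa using Submodule.add_mem _ h1 h2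
  · rw [if_neg (fun hh => hu hh.1), sub_zero]
    exact m.belowLevel_mono hg' (m.d_other g hu)

lemma d0_mem (p : ℕ) (x : C →₀ R) : m.d0 p x ∈ belowLevel R m.level (p + 1) := by
  classical
  refine mem_of_single (P := m.d0 p) (s := Set.univ) (fun g _ => ?_) (by simp)
  rw [d0, Finsupp.linearCombination_single, one_smul]
  split_ifs with h
  · refine Finsupp.single_mem_supported R _ ?_
    change m.level _ < p + 1
    rw [m.level_mate g (Or.inl h.1), h.2]
    omega
  · exact Submodule.zero_mem _

lemma d_mem (p : ℕ) {x : C →₀ R} (hx : x ∈ belowLevel R m.level p) : d x ∈ belowLevel R m.level p := by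
  cases p with
  | zero =>
    have : x = 0 := by
      rw [Finsupp.mem_supported] at hx
      by_contra h
      obtain ⟨g, hg⟩ := Finsupp.support_nonempty_iff.mpr h
      exact absurd (hx hg) (Nat.not_lt_zero _)
    rw [this, map_zero]
    exact Submodule.zero_mem _
  | succ p =>
    have h := Submodule.add_mem _ (m.belowLevel_mono (Nat.le_succ p) (m.d_sub_d0 p hx))
      (m.d0_mem p x)
    simpa using h

lemma hmt_mem (p : ℕ) (x : C →₀ R) : m.hmt p x ∈ belowLevel R m.level (p + 1) := by
  classical
  refine mem_of_single (P := m.hmt p) (s := Set.univ) (fun g _ => ?_) (by simp)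
  rw [hmt, Finsupp.linearCombination_single, one_smul]
  split_ifs with h
  · refine Finsupp.single_mem_supported R _ ?_
    change m.level _ < p + 1
    rw [m.level_mate g (Or.inr h.1), h.2]
    omega
  · exact Submodule.zero_mem _

lemma hmt_inDegree (p k : ℕ) {x : C →₀ R} (hx : x ∈ inDegree R deg k) :
    m.hmt p x ∈ inDegree R deg (k + 1) := by
  refine mem_of_single (P := m.hmt p) (fun g hg => ?_) hx
  rw [hmt, Finsupp.linearCombination_single, one_smul]
  split_ifs with h
  · refine Finsupp.single_mem_supported R _ ?_
    have := m.deg_mate _ (m.mate_lower g h.1)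
    rw [m.mate_mate g (Or.inr h.1)] at this
    change deg _ = k + 1
    rw [← this, show deg g = k from hg]
  · exact Submodule.zero_mem _

lemma hmt_below (p : ℕ) {x : C →₀ R} (hx : x ∈ belowLevel R m.level p) : m.hmt p x = 0 := by
  rw [← Submodule.mem_bot (R := ℤ)]
  refine mem_of_single (P := m.hmt p) (T := ⊥) (fun g hg => ?_) hx
  rw [hmt, Finsupp.linearCombination_single, one_smul, if_neg]
  · exact Submodule.zero_mem _
  · exact fun h => (ne_of_lt hg) h.2

lemma hmt_eq_zero (p : ℕ) {x : C →₀ R} (hx : ∀ l ∈ m.lower, x l = 0) : m.hmt p x = 0 := by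
  rw [hmt, Finsupp.linearCombination_apply, Finsupp.sum, Finset.sum_eq_zero]
  intro g _
  split_ifs with h
  · rw [hx g h.1, zero_smul]
  · rw [smul_zero]

/-- The critical part of a chain, at level `p`. -/
def critPart (p : ℕ) : (C →₀ R) →ₗ[R] (C →₀ R) :=
  open Classical in
  Finsupp.linearCombination R
    (fun g => if g ∈ m.crit ∧ m.level g = p then Finsupp.single g 1 else 0)

/-- On a matched cell of level `p` one of `d0 ∘ hmt` and `hmt ∘ d0` is the identity, as `sign`
squares to `1`, and the other vanishes, as no cell is both upper and lower. On a critical cell both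
vanish. -/
lemma homotopy (p : ℕ) {x : C →₀ R} (hx : x ∈ belowLevel R m.level (p + 1)) :
    x - m.d0 p (m.hmt p x) - m.hmt p (m.d0 p x) - m.critPart p x ∈ belowLevel R m.level p := by
  classical
  refine mem_of_single
    (P := LinearMap.id - (m.d0 p).comp (m.hmt p) - (m.hmt p).comp (m.d0 p) - m.critPart p)
    (fun g hg => ?_) hx
  simp only [LinearMap.sub_apply, LinearMap.id_apply, LinearMap.comp_apply]
  simp only [d0, hmt, critPart, Finsupp.linearCombination_single, one_smul]
  by_cases hl : m.level g = p
  · by_cases hu : g ∈ m.upper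
    · have h1 := m.disj g hu
      have h2 := m.mate_upper g hu
      have h3 := m.mate_mate g (Or.inl hu)
      have h4 := m.level_mate g (Or.inl hu)
      simp [hu, h1, h2, h3, h4, hl, crit, m.sign_sq]
    · by_cases hlo : g ∈ m.lower
      · have h2 := m.mate_lower g hlo
        have h3 := m.mate_mate g (Or.inr hlo)
        have h4 := m.level_mate g (Or.inr hlo)
        simp [hu, h2, h3, h4, hl, hlo, crit, m.sign_sq]
      · simp [crit, hu, hlo, hl]
  · simp only [hl, and_false, if_false, map_zero, sub_zero]
    exact Finsupp.single_mem_supported R _ (lt_of_le_of_ne (Nat.lt_succ_iff.mp hg) hl)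

lemma critPart_eq_zero (p : ℕ) {x : C →₀ R} (hx : ∀ c ∈ m.crit, m.level c = p → x c = 0) :
    m.critPart p x = 0 := by
  rw [critPart, Finsupp.linearCombination_apply, Finsupp.sum, Finset.sum_eq_zero]
  intro g _
  split_ifs with h
  · rw [hx g h.1 h.2, zero_smul]
  · rw [smul_zero]

/-- For such an `x` the homotopy formula leaves only `d0 (hmt x)`, since `d0 x` and the critical
part contribute nothing at level `p`. Replacing `d0` by `d` changes only lower levels. -/
lemma exact_at_level (p : ℕ) {x : C →₀ R} (hx : x ∈ belowLevel R m.level (p + 1))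
    (hd : d x ∈ belowLevel R m.level p) (hc : ∀ c ∈ m.crit, m.level c = p → x c = 0) :
    x - d (m.hmt p x) ∈ belowLevel R m.level p := by
  have h0 : m.d0 p x ∈ belowLevel R m.level p := by
    have := Submodule.sub_mem _ hd (m.d_sub_d0 p hx)
    simpa using this
  have h1 := m.homotopy p hx
  rw [m.hmt_below p h0, m.critPart_eq_zero p hc, sub_zero, sub_zero] at h1
  have h2 := m.d_sub_d0 p (m.hmt_mem p x)
  have h3 := Submodule.sub_mem _ h1 h2
  convert h3 using 1
  abel

/-- The only terms which keep the level are mates of upper cells, and these are lower cells, never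
critical ones. -/
lemma d_crit (p : ℕ) {x : C →₀ R} (hx : x ∈ belowLevel R m.level (p + 1)) (c : C) (hc : c ∈ m.crit)
    (hp : m.level c = p) : d x c = 0 := by
  classical
  have h1 := m.d_sub_d0 p hx
  have h2 : (d x - m.d0 p x) c = 0 := by
    by_contra h
    exact absurd ((Finsupp.mem_supported R _).mp h1 (Finsupp.mem_support_iff.mpr h)) (by simp [hp])
  have h3 : m.d0 p x c = 0 := by
    rw [d0, Finsupp.linearCombination_apply, Finsupp.sum, Finsupp.finsetSum_apply,
      Finset.sum_eq_zero]
    intro g _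
    split_ifs with h
    · rw [Finsupp.smul_apply, Finsupp.single_apply, if_neg, smul_zero]
      rintro rfl
      exact hc.2 (m.mate_upper g h.1)
    · simp
  rw [Finsupp.sub_apply, h3, sub_zero] at h2
  exact h2

lemma mem_below_of_cycle (p : ℕ) {x : C →₀ R} (hx : x ∈ belowLevel R m.level (p + 1))
    (hd : d x = 0) (hc : ∀ c ∈ m.crit, x c = 0) (hl : ∀ l ∈ m.lower, x l = 0) :
    x ∈ belowLevel R m.level p := by
  have := m.exact_at_level p hx (by rw [hd]; exact Submodule.zero_mem _) (fun c h _ => hc c h)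
  rwa [m.hmt_eq_zero p hl, map_zero, sub_zero] at this

lemma exists_level (x : C →₀ R) : ∃ p, x ∈ belowLevel R m.level p := by
  classical
  refine ⟨x.support.sup m.level + 1, (Finsupp.mem_supported R _).mpr fun g hg => ?_⟩
  exact Nat.lt_succ_of_le (Finset.le_sup (f := m.level) hg)

lemma eq_zero_of_below_zero {x : C →₀ R} (hx : x ∈ belowLevel R m.level 0) : x = 0 := by
  rw [Finsupp.mem_supported] at hx
  by_contra h
  obtain ⟨g, hg⟩ := Finsupp.support_nonempty_iff.mpr h
  exact absurd (hx hg) (Nat.not_lt_zero _)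

/-- A chain of upper cells alone has `hmt x = 0`, so that `exact_at_level` pushes a cycle of this
kind down one level at a time until nothing is left. This is the injectivity behind the rank bound.
-/
lemma cycle_eq_zero {x : C →₀ R} (hd : d x = 0) (hc : ∀ c ∈ m.crit, x c = 0)
    (hl : ∀ l ∈ m.lower, x l = 0) : x = 0 := by
  obtain ⟨p, hp⟩ := m.exists_level x
  induction p with
  | zero => exact m.eq_zero_of_below_zero hp
  | succ p ih => exact ih (m.mem_below_of_cycle p hp hd hc hl)

/-- Gaussian elimination along the pairs, from the highest level downwards: subtracting `d (hmt x)`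
clears the coefficients at the lower cells of level `p` and disturbs only lower levels. -/
lemma exists_reduce (hdeg : ∀ k, ∀ x ∈ inDegree R deg (k + 1), d x ∈ inDegree R deg k) (k : ℕ) {x : C →₀ R} (hx : x ∈ inDegree R deg k) :
    ∃ w ∈ inDegree R deg (k + 1), ∀ l ∈ m.lower, (x - d w) l = 0 := by
  classical
  obtain ⟨p, hp⟩ := m.exists_level x
  induction p generalizing x with
  | zero =>
    refine ⟨0, Submodule.zero_mem _, fun l _ => ?_⟩
    rw [m.eq_zero_of_below_zero hp]
    simp
  | succ p ih =>
    have key : ∀ l ∈ m.lower, m.level l = p → (x - m.d0 p (m.hmt p x)) l = 0 := by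
      intro l hl hlp
      have h1 := m.homotopy p hp
      have h2 : (x - m.d0 p (m.hmt p x) - m.hmt p (m.d0 p x) - m.critPart p x) l = 0 := by
        by_contra h
        exact absurd ((Finsupp.mem_supported R _).mp h1 (Finsupp.mem_support_iff.mpr h))
          (by simp [hlp])
      have h3 : m.critPart p x l = 0 := by
        rw [critPart, Finsupp.linearCombination_apply, Finsupp.sum, Finsupp.finsetSum_apply,
          Finset.sum_eq_zero]
        intro g _
        split_ifs with h
        · rw [Finsupp.smul_apply, Finsupp.single_apply, if_neg, smul_zero]
          rintro rfl
          exact h.1.2 hl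
        · simp
      have h4 : ∀ y, m.hmt p y l = 0 := by
        intro y
        rw [hmt, Finsupp.linearCombination_apply, Finsupp.sum, Finsupp.finsetSum_apply,
          Finset.sum_eq_zero]
        intro g _
        split_ifs with h
        · rw [Finsupp.smul_apply, Finsupp.single_apply, if_neg, smul_zero]
          rintro rfl
          exact m.disj _ (m.mate_lower g h.1) hl
        · simp
      rw [Finsupp.sub_apply, Finsupp.sub_apply, h3, h4, sub_zero, sub_zero] at h2
      exact h2
    have hd : d (m.hmt p x) - m.d0 p (m.hmt p x) ∈ belowLevel R m.level p :=
      m.d_sub_d0 p (m.hmt_mem p x)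
    set z := x - d (m.hmt p x) with hz
    have hzp : z ∈ belowLevel R m.level (p + 1) :=
      Submodule.sub_mem _ hp (m.d_mem _ (m.hmt_mem p x))
    have hzk : z ∈ inDegree R deg k := Submodule.sub_mem _ hx (hdeg k _ (m.hmt_inDegree p k hx))
    have hzl : ∀ l ∈ m.lower, ¬ m.level l < p → z l = 0 := by
      intro l hl hlp
      by_cases h : m.level l = p
      · have h1 : (d (m.hmt p x) - m.d0 p (m.hmt p x)) l = 0 := by
          by_contra h2
          exact absurd ((Finsupp.mem_supported R _).mp hd (Finsupp.mem_support_iff.mpr h2)) hlp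
        have h2 := key l hl h
        rw [Finsupp.sub_apply] at h1 h2
        rw [hz, Finsupp.sub_apply, sub_eq_zero.mp h1]
        exact h2
      · by_contra h2
        have h3 := (Finsupp.mem_supported R _).mp hzp (Finsupp.mem_support_iff.mpr h2)
        have h4 : m.level l < p + 1 := h3
        omega
    -- Upper and critical cells of level `p` may remain in `z`, so the induction hypothesis is
    -- applied to its truncation. At lower cells the truncation loses nothing, by `hzl`.
    obtain ⟨w, hw, hwl⟩ := ih (x := z.filter (fun g => m.level g < p))
      ((Finsupp.mem_supported R _).mpr fun g hg =>
        (Finsupp.mem_supported R _).mp hzk (by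
          rw [SetLike.mem_coe, Finsupp.support_filter, Finset.mem_filter] at hg
          exact hg.1))
      ((Finsupp.mem_supported R _).mpr fun g hg => by
        rw [SetLike.mem_coe, Finsupp.support_filter, Finset.mem_filter] at hg
        exact hg.2)
    refine ⟨m.hmt p x + w, Submodule.add_mem _ (m.hmt_inDegree p k hx) hw, fun l hl => ?_⟩
    have h1 := hwl l hl
    rw [Finsupp.sub_apply, Finsupp.filter_apply] at h1
    rw [map_add, ← sub_sub, ← hz, Finsupp.sub_apply]
    split_ifs at h1 with h
    · exact h1
    · rw [hzl l hl h]
      exact h1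

end MorseMatching

/-! ### Based complexes: the level filtration and its two homological consequences -/

/-- A basis, indexed by cells with a degree, of a chain complex of modules. -/
structure BasedComplex (K : ChainComplex (ModuleCat.{0} R) ℕ) (deg : C → ℕ)
    (d : (C →₀ R) →ₗ[R] (C →₀ R)) where
  ι : ∀ k, K.X k →ₗ[R] (C →₀ R)
  inj : ∀ k, Function.Injective (ι k)
  range_eq : ∀ k, LinearMap.range (ι k) = inDegree R deg k
  d_eq : ∀ k x, ι k ((K.d (k + 1) k).hom x) = d (ι (k + 1) x)
  d_zero : ∀ x ∈ inDegree R deg 0, d x = 0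

namespace BasedComplex

variable {K : ChainComplex (ModuleCat.{0} R) ℕ} {deg : C → ℕ} {d : (C →₀ R) →ₗ[R] (C →₀ R)}
  (B : BasedComplex K deg d) (m : MorseMatching deg d)

lemma mem_deg (k : ℕ) (x : K.X k) : B.ι k x ∈ inDegree R deg k := by
  rw [← B.range_eq]
  exact ⟨x, rfl⟩

lemma exists_lift (k : ℕ) {y : C →₀ R} (hy : y ∈ inDegree R deg k) : ∃ x, B.ι k x = y := by
  rw [← B.range_eq] at hy
  exact hy

lemma d_deg (B : BasedComplex K deg d) (k : ℕ) (y : C →₀ R) (hy : y ∈ inDegree R deg (k + 1)) :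
    d y ∈ inDegree R deg k := by
  obtain ⟨x, rfl⟩ := B.exists_lift _ hy
  rw [← B.d_eq]
  exact B.mem_deg _ _

/-- The filtration of a based complex by the level of a Morse matching. -/
def filtration : ChainFiltration K where
  sub p k := (belowLevel R m.level (p + 1)).comap (B.ι k)
  mono k _ _ h := Submodule.comap_mono (m.belowLevel_mono (Nat.succ_le_succ h))
  map_d p k l x hx := by
    rw [Submodule.mem_comap] at hx ⊢
    by_cases h : l + 1 = k
    · subst h
      rw [B.d_eq]
      exact m.d_mem _ hx
    · rw [K.shape k l h]
      simp
  exhaustive k := by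
    rw [eq_top_iff]
    intro x _
    obtain ⟨p, hp⟩ := m.exists_level (B.ι k x)
    exact Submodule.mem_iSup_of_mem p (m.belowLevel_mono (Nat.le_succ p) hp)

lemma mem_prev (p k : ℕ) (x : K.X k) :
    x ∈ (B.filtration m).prev p k ↔ B.ι k x ∈ belowLevel R m.level p := by
  cases p with
  | zero =>
    constructor
    · intro h
      have h0 : x = 0 := h
      rw [h0, map_zero]
      exact Submodule.zero_mem _
    · intro h
      exact B.inj k (by rw [m.eq_zero_of_below_zero h, map_zero])
  | succ p => exact Iff.rfl

/-- The coefficients of an element of `F_p / F_{p-1}` at the critical cells of level `p`. -/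
def pieceCrit (p k : ℕ) : (B.filtration m).Piece p k →ₗ[R]
    ({c : C // (c ∈ m.crit ∧ deg c = k) ∧ m.level c = p} →₀ R) :=
  Submodule.liftQ _ ((Finsupp.lsubtypeDomain {c : C | (c ∈ m.crit ∧ deg c = k) ∧ m.level c = p}).comp
    ((B.ι k).comp (Submodule.subtype _))) (by
      intro x hx
      have h : B.ι k x ∈ belowLevel R m.level p := (B.mem_prev m p k x).mp hx
      refine Finsupp.ext fun c => ?_
      change B.ι k x c = 0
      by_contra h1
      exact (ne_of_lt ((Finsupp.mem_supported R _).mp h (Finsupp.mem_support_iff.mpr h1))) c.2.2)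

lemma pieceCrit_mk (p k : ℕ) (x : (B.filtration m).sub p k) (c) :
    B.pieceCrit m p k (Submodule.Quotient.mk x) c = B.ι k x c := rfl

lemma piece_mk_eq_zero (p k : ℕ) (x : (B.filtration m).sub p k) :
    (Submodule.Quotient.mk x : (B.filtration m).Piece p k) = 0 ↔
      B.ι k x ∈ belowLevel R m.level p := by
  rw [Submodule.Quotient.mk_eq_zero]
  exact B.mem_prev m p k x

lemma pieceCrit_d (p k : ℕ) (w : (B.filtration m).Piece p (k + 1)) :
    B.pieceCrit m p k ((B.filtration m).pieceD p (k + 1) k w) = 0 := by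
  obtain ⟨w, rfl⟩ := Submodule.Quotient.mk_surjective _ w
  refine Finsupp.ext fun c => ?_
  rw [ChainFiltration.pieceD_mk, pieceCrit_mk]
  change B.ι k ((K.d (k + 1) k).hom (w : K.X (k + 1))) c = 0
  rw [B.d_eq]
  exact m.d_crit p w.2 c c.2.1.1 c.2.2

/-- A critical cell is not upper, so its boundary lies in lower levels and the cell itself is a
cycle of the graded piece. -/
lemma pieceCrit_surj (p k : ℕ) (y : {c : C // (c ∈ m.crit ∧ deg c = k) ∧ m.level c = p} →₀ R) :
    ∃ x, (∀ l, (B.filtration m).pieceD p k l x = 0) ∧ B.pieceCrit m p k x = y := by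
  set z : C →₀ R := y.embDomain (Function.Embedding.subtype _) with hz
  have hzs : ∀ g ∈ z.support, (g ∈ m.crit ∧ deg g = k) ∧ m.level g = p := by
    intro g hg
    rw [hz, Finsupp.support_embDomain, Finset.mem_map] at hg
    obtain ⟨c, _, rfl⟩ := hg
    exact c.2
  have hzk : z ∈ inDegree R deg k := (Finsupp.mem_supported R _).mpr fun g hg => (hzs g hg).1.2
  have hzp : z ∈ belowLevel R m.level (p + 1) := (Finsupp.mem_supported R _).mpr fun g hg => by
    have := (hzs g hg).2
    change m.level g < p + 1
    omega
  have hdz : d z ∈ belowLevel R m.level p := by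
    refine MorseMatching.mem_of_single (P := d)
      (s := {g | (g ∈ m.crit ∧ deg g = k) ∧ m.level g = p}) (fun g hg => ?_)
      ((Finsupp.mem_supported R _).mpr hzs)
    have := m.d_other g hg.1.1.1
    rwa [hg.2] at this
  obtain ⟨x, hx⟩ := B.exists_lift k hzk
  refine ⟨Submodule.Quotient.mk ⟨x, by
    change B.ι k x ∈ belowLevel R m.level (p + 1)
    rwa [hx]⟩, fun l => ?_, ?_⟩
  · by_cases h : l + 1 = k
    · subst h
      rw [ChainFiltration.pieceD_mk, B.piece_mk_eq_zero]
      change B.ι l ((K.d (l + 1) l).hom x) ∈ _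
      rwa [B.d_eq, hx]
    · exact ChainFiltration.pieceD_shape _ p k l h _
  · refine Finsupp.ext fun c => ?_
    rw [pieceCrit_mk]
    change B.ι k x c = y c
    rw [hx, hz]
    exact Finsupp.embDomain_apply_self (Function.Embedding.subtype _) y c

/-- This is `exact_at_level` for a representative. In degree `0` there is no lower degree in which
to read off the cycle condition, and `d_zero` replaces it. -/
lemma piece_exact (p k : ℕ) (x : (B.filtration m).Piece p k)
    (hx : ∀ l, (B.filtration m).pieceD p k l x = 0) (hc : B.pieceCrit m p k x = 0) :
    ∃ w, (B.filtration m).pieceD p (k + 1) k w = x := by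
  obtain ⟨x, rfl⟩ := Submodule.Quotient.mk_surjective _ x
  have hxp : B.ι k x ∈ belowLevel R m.level (p + 1) := x.2
  have hxk : B.ι k x ∈ inDegree R deg k := B.mem_deg _ _
  have hd : d (B.ι k x) ∈ belowLevel R m.level p := by
    cases k with
    | zero =>
      rw [B.d_zero _ hxk]
      exact Submodule.zero_mem _
    | succ k =>
      have := hx k
      rw [ChainFiltration.pieceD_mk, B.piece_mk_eq_zero] at this
      change B.ι k ((K.d (k + 1) k).hom (x : K.X (k + 1))) ∈ _ at this
      rwa [B.d_eq] at this
  have hcrit : ∀ c ∈ m.crit, m.level c = p → B.ι k x c = 0 := by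
    intro c hcc hcp
    by_cases hck : deg c = k
    · have := DFunLike.congr_fun hc ⟨c, ⟨hcc, hck⟩, hcp⟩
      rwa [pieceCrit_mk] at this
    · by_contra h
      exact hck ((Finsupp.mem_supported R _).mp hxk (Finsupp.mem_support_iff.mpr h))
  have hw := m.exact_at_level p hxp hd hcrit
  obtain ⟨w, hwe⟩ := B.exists_lift (k + 1) (m.hmt_inDegree p k hxk)
  refine ⟨Submodule.Quotient.mk ⟨w, by
    change B.ι (k + 1) w ∈ belowLevel R m.level (p + 1)
    rw [hwe]
    exact m.hmt_mem p _⟩, ?_⟩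
  rw [ChainFiltration.pieceD_mk, ← sub_eq_zero, ← Submodule.Quotient.mk_sub, B.piece_mk_eq_zero]
  change B.ι k ((K.d (k + 1) k).hom w - (x : K.X k)) ∈ _
  rw [map_sub, B.d_eq, hwe, ← neg_sub]
  exact Submodule.neg_mem _ hw

/-- The homology of the associated graded complex is free on the critical cells. -/
theorem homology_assocGraded (k : ℕ) :
    Nonempty ((B.filtration m).assocGraded.homology k ≃ₗ[R] ({c // c ∈ m.crit ∧ deg c = k} →₀ R)) := by
  classical
  have e : (⨁ p, ({c : C // (c ∈ m.crit ∧ deg c = k) ∧ m.level c = p} →₀ R)) ≃ₗ[R]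
      ({c // c ∈ m.crit ∧ deg c = k} →₀ R) :=
    (sigmaFinsuppLequivDFinsupp R).symm.trans (Finsupp.domLCongr
      ((Equiv.sigmaCongrRight fun p =>
        (Equiv.subtypeSubtypeEquivSubtypeInter (fun c => c ∈ m.crit ∧ deg c = k)
          (fun c => m.level c = p)).symm).trans
        (Equiv.sigmaFiberEquiv fun c : {c // c ∈ m.crit ∧ deg c = k} => m.level c)))
  suffices h : Nonempty ((B.filtration m).assocGraded.homology k ≃ₗ[R]
      (⨁ p, ({c : C // (c ∈ m.crit ∧ deg c = k) ∧ m.level c = p} →₀ R))) from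
    h.map fun f => f.trans e
  let φ : (⨁ p, (B.filtration m).Piece p k) →ₗ[R]
      (⨁ p, ({c : C // (c ∈ m.crit ∧ deg c = k) ∧ m.level c = p} →₀ R)) :=
    DirectSum.lmap fun p => B.pieceCrit m p k
  refine chainComplex_homology_equiv (M := ⨁ p, ({c : C // (c ∈ m.crit ∧ deg c = k) ∧ m.level c = p} →₀ R))
    (B.filtration m).assocGraded k φ ?_ ?_ ?_
  · intro w
    let w' : ⨁ p, (B.filtration m).Piece p (k + 1) := w
    exact DFinsupp.ext fun p => B.pieceCrit_d m p k (w' p)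
  · intro y
    choose x hx hxy using fun p => B.pieceCrit_surj m p k (y p)
    -- A chosen lift of `0` need not be `0`, so the lifts are used only over the finite support of
    -- `y`.
    let z : ⨁ p, (B.filtration m).Piece p k :=
      DirectSum.mk _ (DFinsupp.support y) fun p => x p
    refine ⟨z, fun l => DFinsupp.ext fun p => ?_, DFinsupp.ext fun p => ?_⟩
    · change (B.filtration m).pieceD p k l (z p) = 0
      by_cases h : p ∈ DFinsupp.support y
      · rw [show z p = x p from DirectSum.mk_apply_of_mem h]
        exact hx p l
      · rw [show z p = 0 from DirectSum.mk_apply_of_notMem h, map_zero]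
    · change B.pieceCrit m p k (z p) = y p
      by_cases h : p ∈ DFinsupp.support y
      · rw [show z p = x p from DirectSum.mk_apply_of_mem h]
        exact hxy p
      · rw [show z p = 0 from DirectSum.mk_apply_of_notMem h, map_zero]
        exact (DFinsupp.notMem_support_iff.mp h).symm
  · intro x hx hφ
    let x' : ⨁ p, (B.filtration m).Piece p k := x
    choose w hw using fun p => B.piece_exact m p k (x' p)
      (fun l => DFunLike.congr_fun (show DirectSum.lmap (fun p => (B.filtration m).pieceD p k l) x' =
        (0 : ⨁ p, (B.filtration m).Piece p l) from hx l) p)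
      (DFunLike.congr_fun (hφ : φ x' = 0) p)
    let z : ⨁ p, (B.filtration m).Piece p (k + 1) :=
      DirectSum.mk _ (DFinsupp.support x') fun p => w p
    refine ⟨z, DFinsupp.ext fun p => ?_⟩
    change (B.filtration m).pieceD p (k + 1) k (z p) = x' p
    by_cases h : p ∈ DFinsupp.support x'
    · rw [show z p = w p from DirectSum.mk_apply_of_mem h]
      exact hw p
    · rw [show z p = 0 from DirectSum.mk_apply_of_notMem h, map_zero]
      exact (DFinsupp.notMem_support_iff.mp h).symm

/-- The rank of the homology is at most the number of critical cells. -/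
theorem rank_homology [Nontrivial R] (B : BasedComplex K deg d) (m : MorseMatching deg d) (k : ℕ) :
    Module.rank R (K.homology k) ≤ Cardinal.mk {c // c ∈ m.crit ∧ deg c = k} := by
  -- `T` consists of the cycles without coefficients at lower cells. Every cycle is homologous to
  -- one in `T` by `exists_reduce`, and an element of `T` is determined by its critical coefficients
  -- by `cycle_eq_zero`.
  let T : Submodule R (K.X k) :=
    ((LinearMap.ker d).comap (B.ι k)) ⊓ ((Finsupp.supported R R m.lowerᶜ).comap (B.ι k))
  have hT : ∀ x ∈ T, ∀ l ∈ m.lower, B.ι k x l = 0 := by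
    intro x hx l hl
    by_contra h
    exact (Finsupp.mem_supported R _).mp hx.2 (Finsupp.mem_support_iff.mpr h) hl
  refine (chainComplex_rank_homology_le K k T ?_ ?_).trans ?_
  · intro x hx l
    by_cases h : l + 1 = k
    · subst h
      refine B.inj l ?_
      rw [B.d_eq, map_zero]
      exact hx.1
    · rw [K.shape k l h]
      rfl
  · intro x hx
    have hdx : d (B.ι k x) = 0 := by
      cases k with
      | zero => exact B.d_zero _ (B.mem_deg _ _)
      | succ k => rw [← B.d_eq, hx, map_zero]
    obtain ⟨w, hw, hwl⟩ := m.exists_reduce B.d_deg k (B.mem_deg k x)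
    obtain ⟨w, rfl⟩ := B.exists_lift _ hw
    refine ⟨w, ?_, ?_⟩
    · change d (B.ι k _) = 0
      rw [map_sub, map_sub, hdx, zero_sub, neg_eq_zero]
      cases k with
      | zero =>
        rw [B.d_eq]
        exact B.d_zero _ (B.d_deg _ _ (B.mem_deg _ _))
      | succ k =>
        rw [← B.d_eq k]
        have : (K.d (k + 1) k).hom ((K.d (k + 2) (k + 1)).hom w) = 0 :=
          LinearMap.congr_fun (congrArg ModuleCat.Hom.hom (K.d_comp_d (k + 2) (k + 1) k)) w
        rw [this, map_zero]
    · refine (Finsupp.mem_supported R _).mpr fun g hg hgl => ?_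
      rw [map_sub, B.d_eq] at hg
      exact Finsupp.mem_support_iff.mp hg (hwl g hgl)
  · let ψ : T →ₗ[R] ({c // c ∈ m.crit ∧ deg c = k} →₀ R) :=
      (Finsupp.lsubtypeDomain {c : C | c ∈ m.crit ∧ deg c = k}).comp ((B.ι k).comp T.subtype)
    have hψ : Function.Injective ψ := by
      rw [← LinearMap.ker_eq_bot, LinearMap.ker_eq_bot']
      rintro ⟨x, hx⟩ h0
      refine Subtype.ext (B.inj k ?_)
      change B.ι k x = B.ι k 0
      rw [map_zero]
      refine m.cycle_eq_zero hx.1 (fun c hc => ?_) (hT x hx)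
      by_cases hk : deg c = k
      · exact DFunLike.congr_fun h0 ⟨c, hc, hk⟩
      · by_contra h
        exact hk ((Finsupp.mem_supported R _).mp (B.mem_deg k x) (Finsupp.mem_support_iff.mpr h))
    refine (LinearMap.rank_le_of_injective ψ hψ).trans ?_
    rw [rank_finsupp_self']

end BasedComplex

variable {n : ℕ} [NeZero n]

/-! ## Cyclic intervals -/

/-- It trades subtraction modulo `n` for the linear order on `Fin n`, after which `omega` settles
questions about cyclic intervals. -/
lemma inCyc_iff (i j c : Fin n) :
    InCyc i j c ↔ (i ≤ c ∧ c < j) ∨ (j < i ∧ (i ≤ c ∨ c < j)) := by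
  have h1 : (c - i).val = if i ≤ c then c.val - i.val else n + c.val - i.val := by
    split_ifs with h
    · exact Fin.coe_sub_iff_le.mpr h
    · exact Fin.coe_sub_iff_lt.mpr (not_le.mp h)
  have h2 : (j - i).val = if i ≤ j then j.val - i.val else n + j.val - i.val := by
    split_ifs with h
    · exact Fin.coe_sub_iff_le.mpr h
    · exact Fin.coe_sub_iff_lt.mpr (not_le.mp h)
  have := i.isLt
  have := j.isLt
  have := c.isLt
  rw [InCyc, Fin.lt_def, h1, h2]
  simp only [Fin.le_def, Fin.lt_def]
  split_ifs <;> omega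

lemma not_inCyc_right (i j : Fin n) : ¬ InCyc i j j := by
  rw [inCyc_iff]
  omega

lemma inCyc_left {i j : Fin n} (h : i ≠ j) : InCyc i j i := by
  rw [inCyc_iff]
  omega

lemma not_inCyc_self (i c : Fin n) : ¬ InCyc i i c := by
  rw [inCyc_iff]
  omega

lemma inCyc_sub_one_iff {i j c : Fin n} (hi : c ≠ i) (hj : c ≠ j) :
    InCyc i j (c - 1) ↔ InCyc i j c := by
  have h := inCyc_sub_one i j c
  rw [if_neg hj, if_neg hi] at h
  by_cases h1 : InCyc i j (c - 1) <;> by_cases h2 : InCyc i j c <;> simp [h1, h2] at h ⊢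

lemma inCyc_right_sub_one {i j : Fin n} (h : i ≠ j) : InCyc i j (j - 1) := by
  have h1 := inCyc_sub_one i j j
  rw [if_pos rfl, if_neg h.symm, if_neg (not_inCyc_right i j)] at h1
  by_contra h2
  simp [h2] at h1

lemma not_inCyc_left_sub_one (i j : Fin n) : ¬ InCyc i j (i - 1) := by
  by_cases h : i = j
  · subst h
    exact not_inCyc_self _ _
  · have h1 := inCyc_sub_one i j i
    rw [if_neg h, if_pos rfl, if_pos (inCyc_left h)] at h1
    intro h2
    simp [h2] at h1

/-- The position `c - b` of `c` in the linear order which starts at `b`. -/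
lemma inCyc_sub_iff (b i j c : Fin n) : InCyc (i - b) (j - b) (c - b) ↔ InCyc i j c := by
  rw [InCyc, InCyc, sub_sub_sub_cancel_right, sub_sub_sub_cancel_right]

lemma fin_neg_one_val : ((-1 : Fin n)).val = n - 1 := by
  have hn := NeZero.pos n
  rcases Nat.lt_or_ge 1 n with h | h
  · rw [← zero_sub, Fin.val_sub, Fin.val_one', Fin.val_zero, Nat.add_zero, Nat.mod_eq_of_lt h,
      Nat.mod_eq_of_lt (by omega)]
  · have := (-1 : Fin n).isLt
    omega

lemma le_neg_one (c : Fin n) : c ≤ -1 := by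
  rw [Fin.le_def, fin_neg_one_val]
  omega

/-- A cyclic interval passes over the gap in front of `b` if and only if it decreases in the linear
order which starts at `b`. -/
lemma inCyc_pred_iff {b i j : Fin n} : InCyc i j (b - 1) ↔ j - b < i - b := by
  have h1 : b - 1 - b = -1 := by abel
  rw [← inCyc_sub_iff b, h1, inCyc_iff]
  have := le_neg_one (i - b)
  have := le_neg_one (j - b)
  omega

/-- The test for whether a rectangle wraps around through the top row `-1`. -/
lemma inCyc_neg_one_iff {i j : Fin n} : InCyc i j (-1) ↔ j < i := by
  have h := inCyc_pred_iff (b := (0 : Fin n)) (i := i) (j := j)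
  rwa [zero_sub, sub_zero, sub_zero] at h

lemma fin_add_one_val {c : Fin n} (h : c ≠ -1) : (c + 1).val = c.val + 1 := by
  have h1 : c.val ≠ n - 1 := fun h1 => h (Fin.ext (h1.trans fin_neg_one_val.symm))
  have h2 := c.isLt
  rw [Fin.val_add, Fin.val_one', Nat.mod_eq_of_lt (show 1 < n by omega), Nat.mod_eq_of_lt (by omega)]

lemma inCyc_add_one_iff (hn : 2 ≤ n) {i c : Fin n} : InCyc i (i + 1) c ↔ c = i := by
  rw [← inCyc_sub_iff i, sub_self, add_sub_cancel_left, inCyc_iff, ← sub_eq_zero (a := c)]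
  have h1 : (1 : Fin n).val = 1 := by rw [Fin.val_one', Nat.mod_eq_of_lt hn]
  simp only [Fin.le_def, Fin.lt_def, Fin.ext_iff, Fin.val_zero, h1]
  omega

lemma eq_add_one_of_inCyc {i j : Fin n} (hij : i ≠ j) (h : ∀ c, InCyc i j c → c = i) :
    j = i + 1 := by
  have := h _ (inCyc_right_sub_one hij)
  rw [← this, sub_add_cancel]

lemma add_one_ne (hn : 2 ≤ n) (i : Fin n) : i ≠ i + 1 := by
  intro h
  have h1 : (1 : Fin n) = 0 := by
    have : i + 0 = i + 1 := by rw [add_zero]; exact h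
    exact (add_left_cancel this).symm
  have h2 : (1 : Fin n).val = 1 := by rw [Fin.val_one', Nat.mod_eq_of_lt hn]
  rw [h1] at h2
  simp at h2

/-! ## The Maslov index is additive -/

lemma sum_sub_one {M : Type} [AddCommMonoid M] (f : Fin n → M) : ∑ i, f (i - 1) = ∑ i, f i :=
  Equiv.sum_comp (Equiv.subRight (1 : Fin n)) f

/-- Cyclic summation by parts: the sum of the two summands is twice a difference of consecutive
values of `f * g`, which telescopes around the circle. -/
lemma sum_add_mul_sub (f g : Fin n → ℤ) :
    ∑ i, (f (i - 1) + f i) * (g (i - 1) - g i) = -∑ i, (g (i - 1) + g i) * (f (i - 1) - f i) := by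
  have h := sum_sub_one (fun i => f i * g i)
  rw [← sub_eq_zero, sub_neg_eq_add, ← Finset.sum_add_distrib]
  rw [← sub_eq_zero, ← Finset.sum_sub_distrib] at h
  have h2 : ∑ i, 2 * (f (i - 1) * g (i - 1) - f i * g i) = 0 := by rw [← Finset.mul_sum, h, mul_zero]
  rw [← h2]
  exact Finset.sum_congr rfl fun i _ => by ring

/-- The pairing of the corner sum of one chain with the boundary of another one is symmetric. -/
lemma cornerSum_pairing_symm (A B : Fin n → Fin n → ℤ) :
    ∑ i, ∑ j, (A (i - 1) (j - 1) + A (i - 1) j + A i (j - 1) + A i j) * alphaBoundary B i j =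
      ∑ i, ∑ j, (B (i - 1) (j - 1) + B (i - 1) j + B i (j - 1) + B i j) * alphaBoundary A i j := by
  -- The corner sum averages and `alphaBoundary` takes differences, each in both directions. One
  -- summation by parts over columns and one over rows exchange the roles of `A` and `B`, and the
  -- two signs cancel.
  have h1 : ∀ j, ∑ i, (A (i - 1) (j - 1) + A (i - 1) j + A i (j - 1) + A i j) * alphaBoundary B i j =
      -∑ i, ((B (i - 1) j - B (i - 1) (j - 1)) + (B i j - B i (j - 1))) *
        ((A (i - 1) (j - 1) + A (i - 1) j) - (A i (j - 1) + A i j)) := by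
    intro j
    rw [← sum_add_mul_sub (fun i => A i (j - 1) + A i j) (fun i => B i j - B i (j - 1))]
    exact Finset.sum_congr rfl fun i _ => by rw [alphaBoundary]; ring
  rw [Finset.sum_comm]
  simp only [h1]
  rw [Finset.sum_neg_distrib, Finset.sum_comm, ← Finset.sum_neg_distrib]
  refine Finset.sum_congr rfl fun i _ => ?_
  have h2 := sum_add_mul_sub (fun j => A (i - 1) j - A i j) (fun j => B (i - 1) j + B i j)
  rw [← Finset.sum_neg_distrib] at h2 ⊢
  calc _ = ∑ j, (A (i - 1) (j - 1) - A i (j - 1) + (A (i - 1) j - A i j)) *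
        (B (i - 1) (j - 1) + B i (j - 1) - (B (i - 1) j + B i j)) :=
        Finset.sum_congr rfl fun j _ => by ring
    _ = _ := by
        rw [h2]
        exact Finset.sum_congr rfl fun j _ => by rw [alphaBoundary]; ring

lemma sum_cornerSum_genChain (D : Fin n → Fin n → ℕ) (x : Equiv.Perm (Fin n)) :
    ((∑ i, cornerSum D i (x i) : ℕ) : ℤ) = ∑ i, ∑ j, (cornerSum D i j : ℤ) * genChain x i j := by
  push_cast
  refine Finset.sum_congr rfl fun i _ => ?_
  simp [genChain]

namespace PosDomain

/-- Four times the Maslov index. -/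
def num (D : PosDomain n) : ℕ :=
  ∑ i, cornerSum D.coeff i (D.src i) + ∑ i, cornerSum D.coeff i (D.tgt i)

lemma maslov_eq (D : PosDomain n) : D.maslov = D.num / 4 := rfl

/-- `C = A * B`. -/
structure IsComp (A B C : PosDomain n) : Prop where
  src : C.src = A.src
  mid : A.tgt = B.src
  tgt : C.tgt = B.tgt
  coeff : ∀ c r, C.coeff c r = A.coeff c r + B.coeff c r

/-- For `A` from `x` to `z` and `B` from `z` to `y`, the two sides differ by `(A(y) - A(z)) - (B(z)
- B(x))`, written in corner sums over generators. These brackets are the pairing of `A` with the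
boundary of `B` and that of `B` with the boundary of `A`, so they agree. Working with `num` avoids
the truncated division by `4`. -/
lemma IsComp.num_eq {A B C : PosDomain n} (h : IsComp A B C) : C.num = A.num + B.num := by
  have key := cornerSum_pairing_symm (fun c r => (A.coeff c r : ℤ)) (fun c r => (B.coeff c r : ℤ))
  simp only [A.boundary, B.boundary] at key
  have hcs : ∀ i j, cornerSum C.coeff i j = cornerSum A.coeff i j + cornerSum B.coeff i j := by
    intro i j
    simp only [cornerSum, h.coeff]
    ring
  have hN : ∀ (D : PosDomain n) (x y : Equiv.Perm (Fin n)),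
      ∑ i, ∑ j, ((D.coeff (i - 1) (j - 1) : ℤ) + D.coeff (i - 1) j + D.coeff i (j - 1) +
        D.coeff i j) * (genChain y i j - genChain x i j) =
      ((∑ i, cornerSum D.coeff i (y i) : ℕ) : ℤ) - ((∑ i, cornerSum D.coeff i (x i) : ℕ) : ℤ) := by
    intro D x y
    rw [sum_cornerSum_genChain, sum_cornerSum_genChain, ← Finset.sum_sub_distrib]
    refine Finset.sum_congr rfl fun i _ => ?_
    rw [← Finset.sum_sub_distrib]
    refine Finset.sum_congr rfl fun j _ => ?_
    simp only [cornerSum]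
    push_cast
    ring
  rw [hN, hN] at key
  have e : ∀ x : Equiv.Perm (Fin n), ∑ i, cornerSum C.coeff i (x i) =
      ∑ i, cornerSum A.coeff i (x i) + ∑ i, cornerSum B.coeff i (x i) := by
    intro x
    rw [← Finset.sum_add_distrib]
    exact Finset.sum_congr rfl fun i _ => hcs _ _
  simp only [num, e, h.src, h.tgt]
  rw [h.mid] at key ⊢
  omega

lemma isComp_removeFront (D R : PosDomain n) (hs : R.src = D.src) (hle : R.coeff ≤ D.coeff) :
    IsComp R (D.removeFront R hs hle) D :=
  ⟨hs.symm, rfl, rfl, fun c r => (Nat.add_sub_of_le (hle c r)).symm⟩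

lemma isComp_removeBack (D R : PosDomain n) (ht : R.tgt = D.tgt) (hle : R.coeff ≤ D.coeff) :
    IsComp (D.removeBack R ht hle) R D :=
  ⟨rfl, rfl, ht.symm, fun c r => (Nat.sub_add_cancel (hle c r)).symm⟩

/-- Exactly one of the four squares around each corner lies in the rectangle, and by emptiness the
other points of both generators touch none of its squares. So each generator contributes `2`. -/
lemma num_rect {x : Equiv.Perm (Fin n)} {i j : Fin n} (h : IsEmptyRect x i j) :
    (rect x i j).num = 4 := by
  have hij := h.1
  have hcs : ∀ c r, cornerSum (rectCoeff x i j) c r =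
      ((if InCyc i j (c - 1) then 1 else 0) + (if InCyc i j c then 1 else 0)) *
      ((if InCyc (x i) (x j) (r - 1) then 1 else 0) + (if InCyc (x i) (x j) r then 1 else 0)) := by
    intro c r
    simp only [cornerSum, rectCoeff]
    by_cases h1 : InCyc i j (c - 1) <;> by_cases h2 : InCyc i j c <;>
      by_cases h3 : InCyc (x i) (x j) (r - 1) <;> by_cases h4 : InCyc (x i) (x j) r <;>
      simp [h1, h2, h3, h4]
  have hx : x i ≠ x j := fun e => hij (x.injective e)
  have hother : ∀ k, k ≠ i → k ≠ j → ∀ r, (r = x k) → cornerSum (rectCoeff x i j) k r = 0 := by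
    rintro k hki hkj _ rfl
    rw [hcs, if_congr (inCyc_sub_one_iff hki hkj) rfl rfl,
      if_congr (inCyc_sub_one_iff (fun e => hki (x.injective e)) (fun e => hkj (x.injective e))) rfl rfl]
    have := h.2 k hki
    by_cases h1 : InCyc i j k
    · by_cases h2 : InCyc (x i) (x j) (x k)
      · exact absurd ⟨h1, h2⟩ this
      · simp [h2]
    · simp [h1]
  have hcol : ∀ {y : Fin n} {a b : Fin n}, a ≠ b → (y = a ∨ y = b) →
      ((if InCyc a b (y - 1) then 1 else 0) + (if InCyc a b y then 1 else 0)) = 1 := by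
    rintro y a b hab (rfl | rfl)
    · rw [if_neg (not_inCyc_left_sub_one _ _), if_pos (inCyc_left hab)]
    · rw [if_pos (inCyc_right_sub_one hab), if_neg (not_inCyc_right _ _)]
  have hsum : ∀ y : Equiv.Perm (Fin n), (∀ k, k ≠ i → k ≠ j → y k = x k) →
      (y i = x i ∨ y i = x j) → (y j = x i ∨ y j = x j) →
      ∑ k, cornerSum (rectCoeff x i j) k (y k) = 2 := by
    intro y hy hi hj
    rw [← Finset.add_sum_erase _ _ (Finset.mem_univ i),
      ← Finset.add_sum_erase _ _ (Finset.mem_erase.mpr ⟨hij.symm, Finset.mem_univ j⟩),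
      Finset.sum_eq_zero, hcs, hcs, hcol hij (Or.inl rfl), hcol hij (Or.inr rfl), hcol hx hi,
      hcol hx hj]
    · rfl
    · intro k hk
      simp only [Finset.mem_erase, Finset.mem_univ, and_true] at hk
      exact hother k hk.2 hk.1 _ (hy k hk.2 hk.1)
  have h1 := hsum x (fun _ _ _ => rfl) (Or.inl rfl) (Or.inr rfl)
  have h2 := hsum (x * Equiv.swap i j)
    (fun k hi hj => by rw [Equiv.Perm.mul_apply, Equiv.swap_apply_of_ne_of_ne hi hj])
    (Or.inr (by simp)) (Or.inl (by simp))
  change ∑ k, cornerSum (rectCoeff x i j) k (x k) +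
    ∑ k, cornerSum (rectCoeff x i j) k ((x * Equiv.swap i j) k) = 4
  rw [h1, h2]

lemma num_colAnnulus (x : Equiv.Perm (Fin n)) (c : Fin n) : (colAnnulus x c).num = 8 := by
  have h : ∑ i, cornerSum (colAnnulus x c).coeff i (x i) = 4 := by
    have h1 : ∀ i r, cornerSum (colAnnulus x c).coeff i r =
        2 * (if i - 1 = c then 1 else 0) + 2 * (if i = c then 1 else 0) := by
      intro i r
      simp only [cornerSum, colAnnulus]
      ring
    simp only [h1, Finset.sum_add_distrib, ← Finset.mul_sum]
    rw [sum_sub_one (fun i => if i = c then 1 else 0)]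
    simp
  change ∑ i, cornerSum (colAnnulus x c).coeff i (x i) +
    ∑ i, cornerSum (colAnnulus x c).coeff i (x i) = 8
  rw [h]

lemma num_rowAnnulus (x : Equiv.Perm (Fin n)) (r : Fin n) : (rowAnnulus x r).num = 8 := by
  have h : ∑ i, cornerSum (rowAnnulus x r).coeff i (x i) = 4 := by
    have h1 : ∀ i s, cornerSum (rowAnnulus x r).coeff i s =
        2 * (if s - 1 = r then 1 else 0) + 2 * (if s = r then 1 else 0) := by
      intro i s
      simp only [cornerSum, rowAnnulus]
      ring
    simp only [h1]
    rw [Equiv.sum_comp x (fun s => 2 * (if s - 1 = r then 1 else 0) + 2 * (if s = r then 1 else 0))]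
    simp only [Finset.sum_add_distrib, ← Finset.mul_sum]
    rw [sum_sub_one (fun i => if i = r then 1 else 0)]
    simp
  change ∑ i, cornerSum (rowAnnulus x r).coeff i (x i) +
    ∑ i, cornerSum (rowAnnulus x r).coeff i (x i) = 8
  rw [h]

lemma IsComp.maslov_of_num_left {A B C : PosDomain n} (h : IsComp A B C) {k : ℕ}
    (hA : A.num = 4 * k) : C.maslov = k + B.maslov := by
  rw [maslov_eq, maslov_eq, h.num_eq, hA]
  omega

lemma IsComp.maslov_of_num_right {A B C : PosDomain n} (h : IsComp A B C) {k : ℕ}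
    (hB : B.num = 4 * k) : C.maslov = k + A.maslov := by
  rw [maslov_eq, maslov_eq, h.num_eq, hB]
  omega

end PosDomain

/-! ## Compositions of two rectangles -/

instance (x : Equiv.Perm (Fin n)) (i j : Fin n) : Decidable (IsEmptyRect x i j) :=
  inferInstanceAs (Decidable (i ≠ j ∧ ∀ k, k ≠ i → ¬ (InCyc i j k ∧ InCyc (x i) (x j) (x k))))

/-- The 2-chain of the composition of two rectangles. -/
def pairCoeff (x : Equiv.Perm (Fin n)) (i j k l : Fin n) (c r : Fin n) : ℕ :=
  rectCoeff x i j c r + rectCoeff (x * Equiv.swap i j) k l c r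

/-- Another decomposition of the composition of two rectangles. -/
def SamePair (ξ : Equiv.Perm (Fin n)) (i j k l i₂ j₂ k₂ l₂ : Fin n) : Prop :=
  (IsEmptyRect ξ i₂ j₂ ∧ IsEmptyRect (ξ * Equiv.swap i₂ j₂) k₂ l₂) ∧
    (∀ c, ξ (Equiv.swap i₂ j₂ (Equiv.swap k₂ l₂ c)) = ξ (Equiv.swap i j (Equiv.swap k l c))) ∧
    (∀ c r, pairCoeff ξ i₂ j₂ k₂ l₂ c r = pairCoeff ξ i j k l c r)

instance (ξ : Equiv.Perm (Fin n)) (i j k l i₂ j₂ k₂ l₂ : Fin n) :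
    Decidable (SamePair ξ i j k l i₂ j₂ k₂ l₂) :=
  inferInstanceAs (Decidable (_ ∧ _ ∧ _))

/-- The rectangles that can be split off at the front. -/
def FrontSpec (ξ : Equiv.Perm (Fin n)) (i j k l i₂ j₂ : Fin n) : Prop :=
  ∀ a b, IsEmptyRect ξ a b → (∀ c r, rectCoeff ξ a b c r ≤ pairCoeff ξ i j k l c r) →
        ((a = i ∧ b = j) ∨ (a = i₂ ∧ b = j₂))

/-- The rectangles that can be split off at the back. -/
def BackSpec (ξ : Equiv.Perm (Fin n)) (i j k l k₂ l₂ : Fin n) : Prop :=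
  ∀ a b, IsEmptyRect (ξ * Equiv.swap i j * Equiv.swap k l * Equiv.swap a b) a b →
        (∀ c r, rectCoeff (ξ * Equiv.swap i j * Equiv.swap k l * Equiv.swap a b) a b c r ≤ pairCoeff ξ i j k l c r) →
        ((a = k ∧ b = l) ∨ (a = k₂ ∧ b = l₂))
instance (ξ : Equiv.Perm (Fin n)) (i j k l i₂ j₂ : Fin n) : Decidable (FrontSpec ξ i j k l i₂ j₂) := 
  inferInstanceAs (Decidable (∀ _ _, _ → _ → (_ ∨ _)))
instance (ξ : Equiv.Perm (Fin n)) (i j k l i₂ j₂ : Fin n) : Decidable (BackSpec ξ i j k l i₂ j₂) := 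
  inferInstanceAs (Decidable (∀ _ _, _ → _ → (_ ∨ _)))

/-- There is a second decomposition, these two are the only ones, and the domain does not contain an
annulus. -/
def TwoDecomp (ξ : Equiv.Perm (Fin n)) (i j k l : Fin n) : Prop :=
  (∃ i₂ j₂ k₂ l₂, SamePair ξ i j k l i₂ j₂ k₂ l₂ ∧ ¬ (i₂ = i ∧ j₂ = j) ∧ ¬ (k₂ = k ∧ l₂ = l) ∧
     FrontSpec ξ i j k l i₂ j₂ ∧ BackSpec ξ i j k l k₂ l₂) ∧
  (∀ c, ∃ r, pairCoeff ξ i j k l c r = 0) ∧ (∀ r, ∃ c, pairCoeff ξ i j k l c r = 0)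

instance (ξ : Equiv.Perm (Fin n)) (i j k l : Fin n) : Decidable (TwoDecomp ξ i j k l) := 
  inferInstanceAs (Decidable ((∃ _ _ _ _, _ ∧ _ ∧ _ ∧ _ ∧ _) ∧ _ ∧ _))

/-- The exhaustive check for two rectangles which share exactly one vertical circle, so that only
three circles of each kind carry corners. -/
lemma twoDecomp_three : ∀ (ξ : Equiv.Perm (Fin 3)) (i j : Fin 3), IsEmptyRect ξ i j →
    ∀ k l : Fin 3, IsEmptyRect (ξ * Equiv.swap i j) k l → ¬ (k = i ∧ l = j) → ¬ (k = j ∧ l = i) →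
    TwoDecomp ξ i j k l := by
  decide +kernel

/-- The case of two rectangles which have no column in common: they commute. -/
def CommDecomp (ξ : Equiv.Perm (Fin n)) (i j k l : Fin n) : Prop :=
  SamePair ξ i j k l k l i j ∧ FrontSpec ξ i j k l k l ∧ BackSpec ξ i j k l i j ∧
    (∀ c, ∃ r, pairCoeff ξ i j k l c r = 0) ∧ (∀ r, ∃ c, pairCoeff ξ i j k l c r = 0)

instance (ξ : Equiv.Perm (Fin n)) (i j k l : Fin n) : Decidable (CommDecomp ξ i j k l) :=
  inferInstanceAs (Decidable (_ ∧ _ ∧ _ ∧ _ ∧ _))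

/-- With disjoint corner columns the second decomposition is known to be the same two rectangles in
the other order. Naming it spares the kernel an existential search over four indices. -/
lemma commDecomp_four : ∀ (ξ : Equiv.Perm (Fin 4)) (i j : Fin 4), IsEmptyRect ξ i j →
    ∀ k l : Fin 4, IsEmptyRect (ξ * Equiv.swap i j) k l → (k ≠ i ∧ k ≠ j ∧ l ≠ i ∧ l ≠ j) →
    CommDecomp ξ i j k l := by
  decide +kernel

/-! ### Reduction to the circles involved -/

section Arc

variable {m : ℕ} [NeZero m]

/-- The number of marked points up to `c`. -/
def markedUpTo (e : Fin m → Fin n) (c : Fin n) : ℕ := (Finset.univ.filter fun a => e a ≤ c).card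

lemma le_iff_markedUpTo {e : Fin m → Fin n} (he : StrictMono e) (a : Fin m) (c : Fin n) :
    e a ≤ c ↔ a.val < markedUpTo e c := by
  constructor
  · intro h
    have : Finset.Iic a ⊆ Finset.univ.filter fun a => e a ≤ c := fun b hb => by
      rw [Finset.mem_filter]
      exact ⟨Finset.mem_univ _, (he.monotone (Finset.mem_Iic.mp hb)).trans h⟩
    have := Finset.card_le_card this
    rwa [Fin.card_Iic] at this
  · intro h
    by_contra hc
    have : (Finset.univ.filter fun a => e a ≤ c) ⊆ Finset.Iio a := fun b hb => by
      rw [Finset.mem_Iio]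
      by_contra hab
      exact hc ((he.monotone (not_lt.mp hab)).trans (Finset.mem_filter.mp hb).2)
    have := Finset.card_le_card this
    rw [Fin.card_Iio] at this
    exact absurd h (not_lt.mpr this)

lemma markedUpTo_le (e : Fin m → Fin n) (c : Fin n) : markedUpTo e c ≤ m :=
  (Finset.card_le_univ _).trans (by simp)

/-- The arc between consecutive marked points which contains `c`. -/
def arc (e : Fin m → Fin n) (c : Fin n) : Fin m :=
  if markedUpTo e c = 0 then -1
  else ⟨markedUpTo e c - 1, by
    have := markedUpTo_le e c
    have := NeZero.pos m
    omega⟩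

/-- An interval between marked points is a union of arcs, so the multiplicity of a rectangle with
marked corners depends only on the arcs that contain the square. This transports statements about
2-chains to the small grid. -/
lemma inCyc_arc {e : Fin m → Fin n} (he : StrictMono e) (a b : Fin m) (c : Fin n) :
    InCyc (e a) (e b) c ↔ InCyc a b (arc e c) := by
  rw [inCyc_iff, inCyc_iff, he.lt_iff_lt, le_iff_markedUpTo he, ← not_le (a := e b),
    le_iff_markedUpTo he, arc]
  split_ifs with h
  · have h1 := le_neg_one a
    have h2 := le_neg_one b
    simp only [Fin.le_def, Fin.lt_def] at *
    omega
  · simp only [Fin.le_def, Fin.lt_def]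
    omega

lemma arc_self {e : Fin m → Fin n} (he : StrictMono e) (a : Fin m) : arc e (e a) = a := by
  have h : ∀ b, b.val < markedUpTo e (e a) ↔ b ≤ a := fun b => by
    rw [← le_iff_markedUpTo he, he.le_iff_le]
  have h1 := (h a).mpr le_rfl
  have h2 := markedUpTo_le e (e a)
  rw [arc, if_neg (by omega)]
  refine le_antisymm ?_ (by change a.val ≤ markedUpTo e (e a) - 1; omega)
  exact (h ⟨markedUpTo e (e a) - 1, by omega⟩).mp (by simp only; omega)

/-- Stepping back over an unmarked circle changes no count of marked points, except from `0` around
to the last position, where the count jumps from `0` to `m`. Both counts name the last arc, hence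
the value `-1` in `arc`. -/
lemma arc_sub_one {e : Fin m → Fin n} {c : Fin n} (hc : ∀ a, e a ≠ c) :
    arc e (c - 1) = arc e c := by
  by_cases h0 : c = 0
  · have h1 : markedUpTo e (c - 1) = m := by
      rw [markedUpTo, Finset.filter_true_of_mem]
      · simp
      · intro a _
        rw [h0, zero_sub]
        exact le_neg_one _
    have h2 : markedUpTo e c = 0 := by
      rw [markedUpTo, Finset.card_eq_zero, Finset.filter_eq_empty_iff]
      intro a _ h
      refine hc a (le_antisymm h ?_)
      rw [h0]
      exact Fin.zero_le _
    rw [arc, arc, if_neg (by rw [h1]; exact NeZero.ne m), if_pos h2]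
    refine Fin.ext ?_
    rw [fin_neg_one_val]
    simp only [h1]
  · have hv : (c - 1).val + 1 = c.val := by
      have h1 : c - 1 ≠ -1 := fun h => h0 (by
        have : c - 1 + 1 = -1 + 1 := by rw [h]
        simpa using this)
      have := fin_add_one_val h1
      rw [sub_add_cancel] at this
      exact this.symm
    have : markedUpTo e (c - 1) = markedUpTo e c := by
      rw [markedUpTo, markedUpTo]
      congr 1
      refine Finset.filter_congr fun a _ => ?_
      have := hc a
      simp only [Fin.le_def, ne_eq, Fin.ext_iff] at *
      omega
    simp only [arc, this]

/-- The permutation `ξ` describes `x` on the marked columns, with values in the marked rows. -/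
structure Models (e f : Fin m → Fin n) (x : Equiv.Perm (Fin n)) (ξ : Equiv.Perm (Fin m)) :
    Prop where
  col : StrictMono e
  row : StrictMono f
  eq : ∀ a, x (e a) = f (ξ a)

variable {e f : Fin m → Fin n} {x : Equiv.Perm (Fin n)} {ξ : Equiv.Perm (Fin m)}

lemma swap_marked (he : StrictMono e) (a b c : Fin m) :
    Equiv.swap (e a) (e b) (e c) = e (Equiv.swap a b c) :=
  (he.injective.map_swap a b c).symm

lemma Models.swap (h : Models e f x ξ) (a b : Fin m) :
    Models e f (x * Equiv.swap (e a) (e b)) (ξ * Equiv.swap a b) :=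
  ⟨h.col, h.row, fun c => by
    rw [Equiv.Perm.mul_apply, swap_marked h.col, h.eq, Equiv.Perm.mul_apply]⟩

lemma swap_unmarked {k : Fin n} (hk : ∀ c, e c ≠ k) (a b : Fin m) :
    Equiv.swap (e a) (e b) k = k :=
  Equiv.swap_apply_of_ne_of_ne (hk a).symm (hk b).symm

lemma Models.row_unmarked (h : Models e f x ξ) {k : Fin n} (hk : ∀ c, e c ≠ k) (c : Fin m) :
    f c ≠ x k := by
  intro hc
  have h1 := h.eq (ξ.symm c)
  rw [Equiv.apply_symm_apply, hc] at h1
  exact hk _ (x.injective h1)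

lemma Models.rectCoeff (h : Models e f x ξ) (a b : Fin m) (c r : Fin n) :
    rectCoeff x (e a) (e b) c r = rectCoeff ξ a b (arc e c) (arc f r) := by
  simp only [_root_.rectCoeff, h.eq, inCyc_arc h.col, inCyc_arc h.row]

lemma Models.pairCoeff (h : Models e f x ξ) (i j k l : Fin m) (c r : Fin n) :
    pairCoeff x (e i) (e j) (e k) (e l) c r = pairCoeff ξ i j k l (arc e c) (arc f r) := by
  rw [_root_.pairCoeff, _root_.pairCoeff, h.rectCoeff, (h.swap i j).rectCoeff]

lemma rectCoeff_eq_zero_iff {x : Equiv.Perm (Fin n)} {i j c r : Fin n} :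
    _root_.rectCoeff x i j c r = 0 ↔ ¬ (InCyc i j c ∧ InCyc (x i) (x j) r) := by
  rw [_root_.rectCoeff]
  split_ifs with h <;> simp [h]

/-- Emptiness at the marked points is emptiness of the model. At the unmarked points it is phrased
as a vanishing multiplicity, so that it can be inferred from the total 2-chain of another
decomposition. -/
lemma Models.isEmptyRect_iff (h : Models e f x ξ) (a b : Fin m) :
    IsEmptyRect x (e a) (e b) ↔ IsEmptyRect ξ a b ∧
      ∀ k, (∀ c, e c ≠ k) → _root_.rectCoeff x (e a) (e b) k (x k) = 0 := by
  simp only [rectCoeff_eq_zero_iff]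
  constructor
  · rintro ⟨h1, h2⟩
    refine ⟨⟨fun hab => h1 (by rw [hab]), fun k hk hc => ?_⟩, fun k hk => h2 k (hk a).symm⟩
    refine h2 (e k) (h.col.injective.ne hk) ?_
    rw [inCyc_arc h.col, h.eq, h.eq, h.eq, inCyc_arc h.row, arc_self h.col, arc_self h.row]
    exact hc
  · rintro ⟨⟨h1, h2⟩, h3⟩
    refine ⟨h.col.injective.ne h1, fun k hk => ?_⟩
    by_cases hm : ∃ c, e c = k
    · obtain ⟨c, rfl⟩ := hm
      rw [inCyc_arc h.col, h.eq, h.eq, h.eq, inCyc_arc h.row, arc_self h.col, arc_self h.row]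
      exact h2 c (fun hc => hk (by rw [hc]))
    · exact h3 k (not_exists.mp hm)

/-- The 2-chain vanishes at every unmarked point (`hzero`), and this is a property of the chain
alone. Hence the second pair, which has the same chain, is empty too, and a rectangle inside the
chain cannot have an unmarked corner, next to which its multiplicity would be `1`. -/
lemma Models.twoDecomp (h : Models e f x ξ) {i j k l : Fin m}
    (h1 : IsEmptyRect x (e i) (e j)) (h2 : IsEmptyRect (x * Equiv.swap (e i) (e j)) (e k) (e l))
    (hs : TwoDecomp ξ i j k l) : TwoDecomp x (e i) (e j) (e k) (e l) := by
  obtain ⟨⟨i₂, j₂, k₂, l₂, ⟨⟨s1, s2⟩, s3, s4⟩, hij, hkl, hF, hB⟩, hcol, hrow⟩ := hs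
  have hzero : ∀ k', (∀ c, e c ≠ k') →
      _root_.pairCoeff x (e i) (e j) (e k) (e l) k' (x k') = 0 := by
    intro k' hk'
    have a1 := ((h.isEmptyRect_iff i j).mp h1).2 k' hk'
    have a2 := (((h.swap i j).isEmptyRect_iff k l).mp h2).2 k' hk'
    rw [Equiv.Perm.mul_apply, swap_unmarked hk'] at a2
    rw [_root_.pairCoeff, a1, a2]
  have hsame : ∀ c r, _root_.pairCoeff x (e i₂) (e j₂) (e k₂) (e l₂) c r =
      _root_.pairCoeff x (e i) (e j) (e k) (e l) c r := by
    intro c r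
    rw [h.pairCoeff, h.pairCoeff, s4]
  refine ⟨⟨e i₂, e j₂, e k₂, e l₂, ⟨⟨?_, ?_⟩, ?_, hsame⟩, ?_, ?_, ?_, ?_⟩, ?_, ?_⟩
  · refine (h.isEmptyRect_iff i₂ j₂).mpr ⟨s1, fun k' hk' => ?_⟩
    have := hsame k' (x k')
    rw [hzero k' hk', _root_.pairCoeff] at this
    omega
  · refine ((h.swap i₂ j₂).isEmptyRect_iff k₂ l₂).mpr ⟨s2, fun k' hk' => ?_⟩
    have := hsame k' (x k')
    rw [hzero k' hk', _root_.pairCoeff] at this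
    rw [Equiv.Perm.mul_apply, swap_unmarked hk']
    omega
  · intro c
    by_cases hm : ∃ a, e a = c
    · obtain ⟨a, rfl⟩ := hm
      rw [swap_marked h.col, swap_marked h.col, swap_marked h.col, swap_marked h.col, h.eq, h.eq, s3]
    · have hm' := not_exists.mp hm
      simp only [swap_unmarked hm']
  · rintro ⟨a1, a2⟩
    exact hij ⟨h.col.injective a1, h.col.injective a2⟩
  · rintro ⟨a1, a2⟩
    exact hkl ⟨h.col.injective a1, h.col.injective a2⟩
  · intro α β hαβ hle
    have hα : ∃ a, e a = α := by
      by_contra hm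
      have := hle α (x α)
      rw [hzero α (not_exists.mp hm), Nat.le_zero, rectCoeff_eq_zero_iff] at this
      exact this ⟨inCyc_left hαβ.1, inCyc_left (x.injective.ne hαβ.1)⟩
    have hβ : ∃ b, e b = β := by
      by_contra hm
      have hm' := not_exists.mp hm
      -- The square inside the top right corner. As `β` and its row are unmarked, it lies in the
      -- same arcs as the square at the point itself, where `hzero` applies.
      have := hle (β - 1) (x β - 1)
      rw [h.pairCoeff, arc_sub_one hm', arc_sub_one (h.row_unmarked hm'), ← h.pairCoeff,
        hzero β hm', Nat.le_zero, rectCoeff_eq_zero_iff] at this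
      exact this ⟨inCyc_right_sub_one hαβ.1, inCyc_right_sub_one (x.injective.ne hαβ.1)⟩
    obtain ⟨a, rfl⟩ := hα
    obtain ⟨b, rfl⟩ := hβ
    have := hF a b ((h.isEmptyRect_iff a b).mp hαβ).1 (fun c r => by
      have := hle (e c) (f r)
      rwa [h.rectCoeff, h.pairCoeff, arc_self h.col, arc_self h.row] at this)
    rcases this with ⟨rfl, rfl⟩ | ⟨rfl, rfl⟩
    · exact Or.inl ⟨rfl, rfl⟩
    · exact Or.inr ⟨rfl, rfl⟩
  · intro α β hαβ hle
    set z := x * Equiv.swap (e i) (e j) * Equiv.swap (e k) (e l) with hz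
    have hzk : ∀ k', (∀ c, e c ≠ k') → z k' = x k' := by
      intro k' hk'
      rw [hz, Equiv.Perm.mul_apply, Equiv.Perm.mul_apply, swap_unmarked hk', swap_unmarked hk']
    have hne : z β ≠ z α := z.injective.ne hαβ.1.symm
    have e1 : (z * Equiv.swap α β) α = z β := by simp
    have e2 : (z * Equiv.swap α β) β = z α := by simp
    -- The points of the final generator are the top left and the bottom right corner, so the inner
    -- squares are `(α, x α - 1)` and `(β - 1, x β)`.
    have hα : ∃ a, e a = α := by
      by_contra hm
      have hm' := not_exists.mp hm
      have := hle α (x α - 1)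
      rw [h.pairCoeff, arc_sub_one (h.row_unmarked hm'), ← h.pairCoeff,
        hzero α hm', Nat.le_zero, rectCoeff_eq_zero_iff, e1, e2, hzk α hm'] at this
      rw [hzk α hm'] at hne
      exact this ⟨inCyc_left hαβ.1, inCyc_right_sub_one hne⟩
    have hβ : ∃ b, e b = β := by
      by_contra hm
      have hm' := not_exists.mp hm
      have := hle (β - 1) (x β)
      rw [h.pairCoeff, arc_sub_one hm', ← h.pairCoeff,
        hzero β hm', Nat.le_zero, rectCoeff_eq_zero_iff, e1, e2, hzk β hm'] at this
      rw [hzk β hm'] at hne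
      exact this ⟨inCyc_right_sub_one hαβ.1, inCyc_left hne⟩
    obtain ⟨a, rfl⟩ := hα
    obtain ⟨b, rfl⟩ := hβ
    have hM := ((h.swap i j).swap k l).swap a b
    have := hB a b ((hM.isEmptyRect_iff a b).mp hαβ).1 (fun c r => by
      have := hle (e c) (f r)
      rwa [hM.rectCoeff, h.pairCoeff, arc_self h.col, arc_self h.row] at this)
    rcases this with ⟨rfl, rfl⟩ | ⟨rfl, rfl⟩
    · exact Or.inl ⟨rfl, rfl⟩
    · exact Or.inr ⟨rfl, rfl⟩
  · intro c
    obtain ⟨r, hr⟩ := hcol (arc e c)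
    exact ⟨f r, by rw [h.pairCoeff, arc_self h.row, hr]⟩
  · intro r
    obtain ⟨c, hc⟩ := hrow (arc f r)
    exact ⟨e c, by rw [h.pairCoeff, arc_self h.col, hc]⟩

end Arc

lemma exists_models (x : Equiv.Perm (Fin n)) (s : Finset (Fin n)) {m : ℕ} [NeZero m]
    (hm : s.card = m) : ∃ e f ξ, Models (m := m) e f x ξ ∧ ∀ i ∈ s, ∃ a, e a = i := by
  classical
  have ht : (s.image x).card = m := by rw [Finset.card_image_of_injective _ x.injective, hm]
  have hmem : ∀ a, x (s.orderEmbOfFin hm a) ∈ s.image x := fun a =>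
    Finset.mem_image_of_mem _ (Finset.orderEmbOfFin_mem s hm a)
  let g : Fin m → Fin m := fun a => ((s.image x).orderIsoOfFin ht).symm ⟨_, hmem a⟩
  have hg : Function.Injective g := by
    intro a b hab
    have := ((s.image x).orderIsoOfFin ht).symm.injective hab
    exact (s.orderEmbOfFin hm).injective (x.injective (Subtype.ext_iff.mp this))
  refine ⟨s.orderEmbOfFin hm, (s.image x).orderEmbOfFin ht,
    Equiv.ofBijective g (Finite.injective_iff_bijective.mp hg),
    ⟨(s.orderEmbOfFin hm).strictMono, ((s.image x).orderEmbOfFin ht).strictMono, fun a => ?_⟩, ?_⟩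
  · change _ = (s.image x).orderEmbOfFin ht (g a)
    exact (congrArg Subtype.val
      (OrderIso.apply_symm_apply ((s.image x).orderIsoOfFin ht) ⟨_, hmem a⟩)).symm
  · intro i hi
    have : i ∈ Set.range (s.orderEmbOfFin hm) := by
      rw [Finset.range_orderEmbOfFin]
      exact hi
    exact this

lemma CommDecomp.twoDecomp {ξ : Equiv.Perm (Fin n)} {i j k l : Fin n} (h : CommDecomp ξ i j k l)
    (hk : k ≠ i) : TwoDecomp ξ i j k l :=
  ⟨⟨k, l, i, j, h.1, fun h1 => hk h1.1, fun h1 => hk h1.1.symm, h.2.1, h.2.2.1⟩, h.2.2.2⟩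

/-- The composition of two rectangles with different corners has exactly two decompositions. -/
theorem twoDecomp (x : Equiv.Perm (Fin n)) (i j k l : Fin n) (h1 : IsEmptyRect x i j)
    (h2 : IsEmptyRect (x * Equiv.swap i j) k l) (hn1 : ¬ (k = i ∧ l = j))
    (hn2 : ¬ (k = j ∧ l = i)) : TwoDecomp x i j k l := by
  classical
  have hij := h1.1
  have hkl := h2.1
  -- The two pairs of columns are disjoint or share exactly one column, as `hn1` and `hn2` exclude
  -- equal pairs. So the corners occupy four or three columns.
  by_cases hc : k ≠ i ∧ k ≠ j ∧ l ≠ i ∧ l ≠ j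
  · have hcard : ({i, j, k, l} : Finset (Fin n)).card = 4 := by
      rw [Finset.card_insert_of_notMem, Finset.card_insert_of_notMem, Finset.card_pair hkl]
      · simp [hc.2.1.symm, hc.2.2.2.symm]
      · simp [hij, hc.1.symm, hc.2.2.1.symm]
    obtain ⟨e, f, ξ, hM, hmem⟩ := exists_models x _ hcard
    obtain ⟨i, rfl⟩ := hmem i (by simp)
    obtain ⟨j, rfl⟩ := hmem j (by simp)
    obtain ⟨k, rfl⟩ := hmem k (by simp)
    obtain ⟨l, rfl⟩ := hmem l (by simp)
    have hc' : k ≠ i ∧ k ≠ j ∧ l ≠ i ∧ l ≠ j := by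
      refine ⟨?_, ?_, ?_, ?_⟩ <;> rintro rfl <;> simp at hc
    exact hM.twoDecomp h1 h2 ((commDecomp_four ξ i j ((hM.isEmptyRect_iff i j).mp h1).1 k l
      (((hM.swap i j).isEmptyRect_iff k l).mp h2).1 hc').twoDecomp hc'.1)
  · have hcard : ({i, j, k, l} : Finset (Fin n)).card = 3 := by
      by_cases hk : k = i ∨ k = j
      · have hl : l ≠ i ∧ l ≠ j := by
          rcases hk with rfl | rfl
          · exact ⟨hkl.symm, fun h => hn1 ⟨rfl, h⟩⟩
          · exact ⟨fun h => hn2 ⟨rfl, h⟩, hkl.symm⟩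
        have : ({i, j, k, l} : Finset (Fin n)) = {i, j, l} := by
          ext a
          simp only [Finset.mem_insert, Finset.mem_singleton]
          rcases hk with rfl | rfl <;> tauto
        rw [this, Finset.card_eq_three]
        exact ⟨i, j, l, hij, hl.1.symm, hl.2.symm, rfl⟩
      · have hl : l = i ∨ l = j := by tauto
        have : ({i, j, k, l} : Finset (Fin n)) = {i, j, k} := by
          ext a
          simp only [Finset.mem_insert, Finset.mem_singleton]
          rcases hl with rfl | rfl <;> tauto
        rw [this, Finset.card_eq_three]
        exact ⟨i, j, k, hij, fun h => hk (Or.inl h.symm), fun h => hk (Or.inr h.symm), rfl⟩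
    obtain ⟨e, f, ξ, hM, hmem⟩ := exists_models x _ hcard
    obtain ⟨i, rfl⟩ := hmem i (by simp)
    obtain ⟨j, rfl⟩ := hmem j (by simp)
    obtain ⟨k, rfl⟩ := hmem k (by simp)
    obtain ⟨l, rfl⟩ := hmem l (by simp)
    refine hM.twoDecomp h1 h2 (twoDecomp_three ξ i j ((hM.isEmptyRect_iff i j).mp h1).1 k l
      (((hM.swap i j).isEmptyRect_iff k l).mp h2).1 ?_ ?_)
    · rintro ⟨rfl, rfl⟩
      exact hn1 ⟨rfl, rfl⟩
    · rintro ⟨rfl, rfl⟩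
      exact hn2 ⟨rfl, rfl⟩

/-! ### Annuli -/

lemma inCyc_swap {i j : Fin n} (h : i ≠ j) (c : Fin n) : InCyc j i c ↔ ¬ InCyc i j c := by
  rw [inCyc_iff, inCyc_iff]
  omega

/-- The two rectangles have complementary row intervals, so a point of `x` in a column strictly
between the corners would lie in one of them. -/
lemma vertical_pair {x : Equiv.Perm (Fin n)} {i j : Fin n} (h1 : IsEmptyRect x i j)
    (h2 : IsEmptyRect (x * Equiv.swap i j) i j) : j = i + 1 := by
  refine eq_add_one_of_inCyc h1.1 fun c hc => ?_
  by_contra hci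
  have a1 := h1.2 c hci
  have a2 := h2.2 c hci
  have hcj : c ≠ j := by
    rintro rfl
    exact not_inCyc_right _ _ hc
  simp only [Equiv.Perm.mul_apply, Equiv.swap_apply_left, Equiv.swap_apply_right,
    Equiv.swap_apply_of_ne_of_ne hci hcj, inCyc_swap (x.injective.ne h1.1)] at a2
  tauto

/-- Here the column intervals are complementary, and the same argument applies to a point in a row
strictly between the corners. -/
lemma horizontal_pair {x : Equiv.Perm (Fin n)} {i j : Fin n} (h1 : IsEmptyRect x i j)
    (h2 : IsEmptyRect (x * Equiv.swap i j) j i) : x j = x i + 1 := by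
  refine eq_add_one_of_inCyc (x.injective.ne h1.1) fun r hr => ?_
  by_contra hri
  obtain ⟨c, rfl⟩ := x.surjective r
  have hci : c ≠ i := fun h => hri (by rw [h])
  have hcj : c ≠ j := by
    rintro rfl
    exact not_inCyc_right _ _ hr
  have a1 := h1.2 c hci
  have a2 := h2.2 c hcj
  simp only [Equiv.Perm.mul_apply, Equiv.swap_apply_left, Equiv.swap_apply_right,
    Equiv.swap_apply_of_ne_of_ne hci hcj, inCyc_swap h1.1] at a2
  tauto

lemma isEmptyRect_col (hn : 2 ≤ n) (x : Equiv.Perm (Fin n)) (i : Fin n) :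
    IsEmptyRect x i (i + 1) :=
  ⟨add_one_ne hn i, fun _ hk h => hk ((inCyc_add_one_iff hn).mp h.1)⟩

lemma isEmptyRect_row (hn : 2 ≤ n) (x : Equiv.Perm (Fin n)) {i j : Fin n} (h : x j = x i + 1) :
    IsEmptyRect x i j := by
  refine ⟨fun hij => add_one_ne hn (x i) (by rw [← h, hij]), fun k hk hc => hk ?_⟩
  rw [h, inCyc_add_one_iff hn] at hc
  exact x.injective hc.2

lemma pairCoeff_vertical {x : Equiv.Perm (Fin n)} {i j : Fin n} (hij : i ≠ j) (c r : Fin n) :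
    pairCoeff x i j i j c r = if InCyc i j c then 1 else 0 := by
  simp only [pairCoeff, rectCoeff, Equiv.Perm.mul_apply, Equiv.swap_apply_left,
    Equiv.swap_apply_right, inCyc_swap (x.injective.ne hij)]
  by_cases h1 : InCyc i j c <;> by_cases h2 : InCyc (x i) (x j) r <;> simp [h1, h2]

lemma pairCoeff_horizontal {x : Equiv.Perm (Fin n)} {i j : Fin n} (hij : i ≠ j) (c r : Fin n) :
    pairCoeff x i j j i c r = if InCyc (x i) (x j) r then 1 else 0 := by
  simp only [pairCoeff, rectCoeff, Equiv.Perm.mul_apply, Equiv.swap_apply_left,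
    Equiv.swap_apply_right, inCyc_swap hij]
  by_cases h1 : InCyc i j c <;> by_cases h2 : InCyc (x i) (x j) r <;> simp [h1, h2]

/-! ## Operators on positive domains -/

section Lift

variable {A : Type} [CommRing A] {C : Type}

/-- The linear extension of a map from basis elements to chains. -/
abbrev lift (f : C → C →₀ A) : Module.End A (C →₀ A) := Finsupp.linearCombination A f

lemma lift_single (f : C → C →₀ A) (c : C) (a : A) : lift f (Finsupp.single c a) = a • f c :=
  Finsupp.linearCombination_single A a c

lemma lift_single_one (f : C → C →₀ A) (c : C) : lift f (Finsupp.single c 1) = f c := by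
  rw [lift_single, one_smul]

lemma end_ext {S T : Module.End A (C →₀ A)}
    (h : ∀ c, S (Finsupp.single c 1) = T (Finsupp.single c 1)) : S = T :=
  Finsupp.lhom_ext' fun c => LinearMap.ext_ring (h c)

end Lift

namespace PosDomain

variable (A : Type) [CommRing A]

/-- The domain `E` with `R * E = D`, or `0` if there is none. -/
def remF (D R : PosDomain n) : PosDomain n →₀ A :=
  open Classical in
  if h : R.src = D.src ∧ R.coeff ≤ D.coeff then Finsupp.single (D.removeFront R h.1 h.2) 1 else 0

/-- The domain `E` with `E * R = D`, or `0` if there is none. -/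
def remB (D R : PosDomain n) : PosDomain n →₀ A :=
  open Classical in
  if h : R.tgt = D.tgt ∧ R.coeff ≤ D.coeff then Finsupp.single (D.removeBack R h.1 h.2) 1 else 0

variable {A}

lemma IsComp.le_left {A B C : PosDomain n} (h : IsComp A B C) : A.coeff ≤ C.coeff := fun c r => by
  rw [h.coeff]
  exact Nat.le_add_right _ _

lemma IsComp.le_right {A B C : PosDomain n} (h : IsComp A B C) : B.coeff ≤ C.coeff := fun c r => by
  rw [h.coeff]
  exact Nat.le_add_left _ _

lemma remF_of {D R E : PosDomain n} (h : IsComp R E D) : remF A D R = Finsupp.single E 1 := by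
  have h1 : R.src = D.src ∧ R.coeff ≤ D.coeff := ⟨h.src.symm, h.le_left⟩
  rw [remF, dif_pos h1]
  congr 1
  refine PosDomain.ext h.mid h.tgt ?_
  funext c r
  change D.coeff c r - R.coeff c r = _
  rw [h.coeff]
  omega

lemma remB_of {D R E : PosDomain n} (h : IsComp E R D) : remB A D R = Finsupp.single E 1 := by
  have h1 : R.tgt = D.tgt ∧ R.coeff ≤ D.coeff := ⟨h.tgt.symm, h.le_right⟩
  rw [remB, dif_pos h1]
  congr 1
  refine PosDomain.ext h.src h.mid.symm ?_
  funext c r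
  change D.coeff c r - R.coeff c r = _
  rw [h.coeff]
  omega

lemma remF_eq_zero {D R : PosDomain n} (h : ∀ E, ¬ IsComp R E D) : remF A D R = 0 := by
  rw [remF, dif_neg]
  rintro ⟨h1, h2⟩
  exact h _ (isComp_removeFront D R h1 h2)

lemma remB_eq_zero {D R : PosDomain n} (h : ∀ E, ¬ IsComp E R D) : remB A D R = 0 := by
  rw [remB, dif_neg]
  rintro ⟨h1, h2⟩
  exact h _ (isComp_removeBack D R h1 h2)

lemma IsComp.assoc_right {P Q C E D : PosDomain n} (h : IsComp P Q C) (h' : IsComp C E D) :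
    ∃ F, IsComp P F D ∧ IsComp Q E F := by
  have hs : P.src = D.src := by rw [h'.src, h.src]
  have hle : P.coeff ≤ D.coeff := h.le_left.trans h'.le_left
  refine ⟨D.removeFront P hs hle, isComp_removeFront D P hs hle, h.mid, ?_, h'.tgt, fun c r => ?_⟩
  · rw [← h.tgt, h'.mid]
  · change D.coeff c r - P.coeff c r = _
    rw [h'.coeff, h.coeff]
    omega

lemma IsComp.assoc_left {P Q C E D : PosDomain n} (h : IsComp P Q C) (h' : IsComp E C D) :
    ∃ F, IsComp F Q D ∧ IsComp E P F := by
  have hs : Q.tgt = D.tgt := by rw [h'.tgt, h.tgt]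
  have hle : Q.coeff ≤ D.coeff := h.le_right.trans h'.le_right
  refine ⟨D.removeBack Q hs hle, isComp_removeBack D Q hs hle, h'.src, ?_, h.mid.symm, fun c r => ?_⟩
  · rw [h'.mid, h.src]
  · change D.coeff c r - Q.coeff c r = _
    rw [h'.coeff, h.coeff]
    omega

/-- Removing `P` and then `Q` from the front is removing `P * Q`. -/
lemma remF_remF {P Q C : PosDomain n} (h : IsComp P Q C) (D : PosDomain n) :
    lift (fun E => remF A E Q) (remF A D P) = remF A D C := by
  by_cases h1 : ∃ E, IsComp C E D
  · obtain ⟨E, hE⟩ := h1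
    obtain ⟨F, hF, hF'⟩ := h.assoc_right hE
    rw [remF_of hF, lift_single_one, remF_of hF', remF_of hE]
  · rw [remF_eq_zero (not_exists.mp h1)]
    by_cases h2 : ∃ F, IsComp P F D
    · obtain ⟨F, hF⟩ := h2
      rw [remF_of hF, lift_single_one, remF_eq_zero]
      intro E hE
      exact h1 ⟨E, by rw [hF.src, h.src], by rw [h.tgt, hE.mid], by rw [hF.tgt, hE.tgt],
        fun c r => by rw [hF.coeff, hE.coeff, h.coeff]; omega⟩
    · rw [remF_eq_zero (not_exists.mp h2), map_zero]

/-- Removing `Q` and then `P` from the back is removing `P * Q`. -/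
lemma remB_remB {P Q C : PosDomain n} (h : IsComp P Q C) (D : PosDomain n) :
    lift (fun E => remB A E P) (remB A D Q) = remB A D C := by
  by_cases h1 : ∃ E, IsComp E C D
  · obtain ⟨E, hE⟩ := h1
    obtain ⟨F, hF, hF'⟩ := h.assoc_left hE
    rw [remB_of hF, lift_single_one, remB_of hF', remB_of hE]
  · rw [remB_eq_zero (not_exists.mp h1)]
    by_cases h2 : ∃ F, IsComp F Q D
    · obtain ⟨F, hF⟩ := h2
      rw [remB_of hF, lift_single_one, remB_eq_zero]
      intro E hE
      exact h1 ⟨E, by rw [hF.src, hE.src], by rw [h.src, hE.mid], by rw [hF.tgt, h.tgt],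
        fun c r => by rw [hF.coeff, hE.coeff, h.coeff]; omega⟩
    · rw [remB_eq_zero (not_exists.mp h2), map_zero]

/-- Removals from the front commute with removals from the back. -/
lemma remF_remB_comm (D R S : PosDomain n) :
    lift (fun E => remF A E R) (remB A D S) = lift (fun E => remB A E S) (remF A D R) := by
  have key : ∀ E F, IsComp E S D → IsComp R F E → ∃ E', IsComp R E' D ∧ IsComp F S E' := by
    intro E F h1 h2
    have hC : IsComp F S (D.removeFront R (by rw [h1.src, h2.src])
        (h2.le_left.trans h1.le_left)) :=
      ⟨h2.mid, by rw [← h2.tgt, h1.mid], h1.tgt, fun c r => by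
        change D.coeff c r - R.coeff c r = _
        rw [h1.coeff, h2.coeff]
        omega⟩
    exact ⟨_, isComp_removeFront _ _ _ _, hC⟩
  have key' : ∀ E F, IsComp R E D → IsComp F S E → ∃ E', IsComp E' S D ∧ IsComp R F E' := by
    intro E F h1 h2
    have hC : IsComp R F (D.removeBack S (by rw [h1.tgt, h2.tgt])
        (h2.le_right.trans h1.le_right)) :=
      ⟨h1.src, by rw [← h2.src, h1.mid], h2.mid.symm, fun c r => by
        change D.coeff c r - S.coeff c r = _
        rw [h1.coeff, h2.coeff]
        omega⟩
    exact ⟨_, isComp_removeBack _ _ _ _, hC⟩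
  by_cases h1 : ∃ E F, IsComp E S D ∧ IsComp R F E
  · obtain ⟨E, F, hE, hF⟩ := h1
    obtain ⟨E', hE', hF'⟩ := key E F hE hF
    rw [remB_of hE, remF_of hE', lift_single_one, lift_single_one, remF_of hF, remB_of hF']
  · have z1 : lift (fun E => remF A E R) (remB A D S) = 0 := by
      by_cases h2 : ∃ E, IsComp E S D
      · obtain ⟨E, hE⟩ := h2
        rw [remB_of hE, lift_single_one, remF_eq_zero]
        exact fun F hF => h1 ⟨E, F, hE, hF⟩
      · rw [remB_eq_zero (not_exists.mp h2), map_zero]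
    have z2 : lift (fun E => remB A E S) (remF A D R) = 0 := by
      by_cases h2 : ∃ E, IsComp R E D
      · obtain ⟨E, hE⟩ := h2
        rw [remF_of hE, lift_single_one, remB_eq_zero]
        intro F hF
        obtain ⟨E', hE', hF'⟩ := key' E F hE hF
        exact h1 ⟨E', F, hE', hF'⟩
      · rw [remF_eq_zero (not_exists.mp h2), map_zero]
    rw [z1, z2]

variable (A)

/-- Splitting off rectangles at the front; `sR R` is the sign of the rectangle `R`. -/
def frontOp (sR : PosDomain n → ZMod 2) : Module.End A (PosDomain n →₀ A) :=
  lift fun D => ∑ p : Fin n × Fin n, if IsEmptyRect D.src p.1 p.2 then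
    sgn A (sR (rect D.src p.1 p.2)) • remF A D (rect D.src p.1 p.2) else 0

/-- The rectangle which ends at `z` and has top left and bottom right corners on `β_i`, `β_j`. -/
abbrev rectTo (z : Equiv.Perm (Fin n)) (p : Fin n × Fin n) : PosDomain n :=
  rect (z * Equiv.swap p.1 p.2) p.1 p.2

lemma rectTo_tgt (z : Equiv.Perm (Fin n)) (p : Fin n × Fin n) : (rectTo z p).tgt = z := by
  simp [rectTo, rect, mul_assoc]

/-- Splitting off rectangles at the back. -/
def backOp (sR : PosDomain n → ZMod 2) : Module.End A (PosDomain n →₀ A) :=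
  lift fun D => ∑ p : Fin n × Fin n, if IsEmptyRect (D.tgt * Equiv.swap p.1 p.2) p.1 p.2 then
    sgn A (sR (rectTo D.tgt p)) • remB A D (rectTo D.tgt p) else 0

variable {A}

lemma frontOp_remF (sR : PosDomain n → ZMod 2) (D R : PosDomain n) :
    frontOp A sR (remF A D R) = ∑ p : Fin n × Fin n, if IsEmptyRect R.tgt p.1 p.2 then
      sgn A (sR (rect R.tgt p.1 p.2)) •
        lift (fun E => remF A E (rect R.tgt p.1 p.2)) (remF A D R) else 0 := by
  by_cases h : ∃ E, IsComp R E D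
  · obtain ⟨E, hE⟩ := h
    rw [remF_of hE, frontOp, lift_single_one, hE.mid]
    simp only [lift_single_one]
  · rw [remF_eq_zero (not_exists.mp h)]
    simp

lemma frontOp_remB (sR : PosDomain n → ZMod 2) (D R : PosDomain n) :
    frontOp A sR (remB A D R) = ∑ p : Fin n × Fin n, if IsEmptyRect D.src p.1 p.2 then
      sgn A (sR (rect D.src p.1 p.2)) •
        lift (fun E => remF A E (rect D.src p.1 p.2)) (remB A D R) else 0 := by
  by_cases h : ∃ E, IsComp E R D
  · obtain ⟨E, hE⟩ := h
    rw [remB_of hE, frontOp, lift_single_one, hE.src]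
    simp only [lift_single_one]
  · rw [remB_eq_zero (not_exists.mp h)]
    simp

lemma backOp_remB (sR : PosDomain n → ZMod 2) (D R : PosDomain n) :
    backOp A sR (remB A D R) = ∑ p : Fin n × Fin n,
      if IsEmptyRect (R.src * Equiv.swap p.1 p.2) p.1 p.2 then
      sgn A (sR (rectTo R.src p)) • lift (fun E => remB A E (rectTo R.src p)) (remB A D R)
      else 0 := by
  by_cases h : ∃ E, IsComp E R D
  · obtain ⟨E, hE⟩ := h
    rw [remB_of hE, backOp, lift_single_one, hE.mid]
    simp only [lift_single_one]
  · rw [remB_eq_zero (not_exists.mp h)]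
    simp

lemma backOp_remF (sR : PosDomain n → ZMod 2) (D R : PosDomain n) :
    backOp A sR (remF A D R) = ∑ p : Fin n × Fin n,
      if IsEmptyRect (D.tgt * Equiv.swap p.1 p.2) p.1 p.2 then
      sgn A (sR (rectTo D.tgt p)) • lift (fun E => remB A E (rectTo D.tgt p)) (remF A D R)
      else 0 := by
  by_cases h : ∃ E, IsComp R E D
  · obtain ⟨E, hE⟩ := h
    rw [remF_of hE, backOp, lift_single_one, hE.tgt]
    simp only [lift_single_one]
  · rw [remF_eq_zero (not_exists.mp h)]
    simp

/-- Which rectangles may be split off at the front depends on the initial generator, which a removal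
at the back preserves, and conversely. Inclusion of 2-chains is symmetric in the two removals. -/
lemma frontOp_backOp_comm (sR : PosDomain n → ZMod 2) :
    frontOp A sR * backOp A sR = backOp A sR * frontOp A sR := by
  refine end_ext fun D => ?_
  have h1 : frontOp A sR (backOp A sR (Finsupp.single D 1)) =
      ∑ q : Fin n × Fin n, ∑ p : Fin n × Fin n,
      if IsEmptyRect (D.tgt * Equiv.swap q.1 q.2) q.1 q.2 ∧ IsEmptyRect D.src p.1 p.2 then
        (sgn A (sR (rectTo D.tgt q)) * sgn A (sR (rect D.src p.1 p.2))) •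
          lift (fun E => remF A E (rect D.src p.1 p.2)) (remB A D (rectTo D.tgt q)) else 0 := by
    rw [backOp, lift_single_one, map_sum]
    refine Finset.sum_congr rfl fun q _ => ?_
    by_cases hq : IsEmptyRect (D.tgt * Equiv.swap q.1 q.2) q.1 q.2
    · rw [if_pos hq, map_smul, frontOp_remB, Finset.smul_sum]
      refine Finset.sum_congr rfl fun p _ => ?_
      by_cases hp : IsEmptyRect D.src p.1 p.2 <;> simp [hq, hp, mul_smul]
    · simp [hq]
  have h2 : backOp A sR (frontOp A sR (Finsupp.single D 1)) =
      ∑ p : Fin n × Fin n, ∑ q : Fin n × Fin n,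
      if IsEmptyRect (D.tgt * Equiv.swap q.1 q.2) q.1 q.2 ∧ IsEmptyRect D.src p.1 p.2 then
        (sgn A (sR (rectTo D.tgt q)) * sgn A (sR (rect D.src p.1 p.2))) •
          lift (fun E => remB A E (rectTo D.tgt q)) (remF A D (rect D.src p.1 p.2)) else 0 := by
    rw [frontOp, lift_single_one, map_sum]
    refine Finset.sum_congr rfl fun p _ => ?_
    by_cases hp : IsEmptyRect D.src p.1 p.2
    · rw [if_pos hp, map_smul, backOp_remF, Finset.smul_sum]
      refine Finset.sum_congr rfl fun q _ => ?_
      by_cases hq : IsEmptyRect (D.tgt * Equiv.swap q.1 q.2) q.1 q.2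
      · rw [if_pos hq, if_pos ⟨hq, hp⟩, smul_smul, mul_comm]
      · simp [hq]
    · simp [hp]
  rw [Module.End.mul_apply, Module.End.mul_apply, h1, h2, Finset.sum_comm]
  refine Finset.sum_congr rfl fun p _ => Finset.sum_congr rfl fun q _ => ?_
  rw [remF_remB_comm]

/-! ### Removing annuli -/

/-- A family of periodic domains, one at each generator, with the same 2-chain. -/
structure IsPeriodic (K : Equiv.Perm (Fin n) → PosDomain n) : Prop where
  src : ∀ x, (K x).src = x
  tgt : ∀ x, (K x).tgt = x
  coeff : ∀ x y, (K x).coeff = (K y).coeff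

lemma isPeriodic_col (c : Fin n) : IsPeriodic (fun x => colAnnulus x c) :=
  ⟨fun _ => rfl, fun _ => rfl, fun _ _ => rfl⟩

lemma isPeriodic_row (r : Fin n) : IsPeriodic (fun x => rowAnnulus x r) :=
  ⟨fun _ => rfl, fun _ => rfl, fun _ _ => rfl⟩

variable (A)

/-- Splitting off a periodic domain. -/
def periodicOp (K : Equiv.Perm (Fin n) → PosDomain n) : Module.End A (PosDomain n →₀ A) :=
  lift fun D => remB A D (K D.tgt)

variable {A}

/-- A periodic domain changes neither generator, so the remainder is the same at both ends. Hence
its removal commutes both with `frontOp` and with `backOp`. -/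
lemma IsPeriodic.remF_eq_remB {K : Equiv.Perm (Fin n) → PosDomain n} (hK : IsPeriodic K)
    (D : PosDomain n) : remF A D (K D.src) = remB A D (K D.tgt) := by
  by_cases h : ∃ E, IsComp (K D.src) E D
  · obtain ⟨E, hE⟩ := h
    rw [remF_of hE, remB_of (E := E)]
    refine ⟨?_, ?_, ?_, fun c r => ?_⟩
    · rw [← hE.mid, hK.tgt]
    · rw [← hE.tgt, hK.src]
    · rw [hK.tgt]
    · rw [hE.coeff, hK.coeff _ D.tgt, Nat.add_comm]
  · rw [remF_eq_zero (not_exists.mp h), remB_eq_zero]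
    intro E hE
    refine h ⟨E, ?_, ?_, ?_, fun c r => ?_⟩
    · rw [hK.src]
    · rw [hK.tgt, hE.src]
    · rw [hE.mid, hK.src]
    · rw [hE.coeff, hK.coeff D.src D.tgt, Nat.add_comm]

lemma IsPeriodic.op_remF {K : Equiv.Perm (Fin n) → PosDomain n} (hK : IsPeriodic K)
    (D R : PosDomain n) :
    periodicOp A K (remF A D R) = lift (fun E => remF A E (K R.tgt)) (remF A D R) := by
  by_cases h : ∃ E, IsComp R E D
  · obtain ⟨E, hE⟩ := h
    rw [remF_of hE, periodicOp, lift_single_one, lift_single_one, ← hK.remF_eq_remB, hE.mid]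
  · rw [remF_eq_zero (not_exists.mp h), map_zero, map_zero]

lemma IsPeriodic.op_remB {K : Equiv.Perm (Fin n) → PosDomain n}
    (D R : PosDomain n) :
    periodicOp A K (remB A D R) = lift (fun E => remB A E (K R.src)) (remB A D R) := by
  by_cases h : ∃ E, IsComp E R D
  · obtain ⟨E, hE⟩ := h
    rw [remB_of hE, periodicOp, lift_single_one, lift_single_one, hE.mid]
  · rw [remB_eq_zero (not_exists.mp h), map_zero, map_zero]

/-- The composition of `R` with a periodic domain. -/
def addPeriodic (R P : PosDomain n) (h : P.src = P.tgt) : PosDomain n where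
  src := R.src
  tgt := R.tgt
  coeff := fun c r => R.coeff c r + P.coeff c r
  boundary := by
    intro i j
    have h1 := R.boundary i j
    have h2 := P.boundary i j
    rw [h, sub_self] at h2
    simp only [alphaBoundary] at h1 h2 ⊢
    push_cast
    linarith

lemma IsPeriodic.isComp_right {K : Equiv.Perm (Fin n) → PosDomain n} (hK : IsPeriodic K)
    (R : PosDomain n) (x : Equiv.Perm (Fin n)) :
    IsComp R (K R.tgt) (addPeriodic R (K x) (by rw [hK.src, hK.tgt])) :=
  ⟨rfl, (hK.src _).symm, (hK.tgt _).symm, fun c r => by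
    rw [hK.coeff _ x]
    rfl⟩

lemma IsPeriodic.isComp_left {K : Equiv.Perm (Fin n) → PosDomain n} (hK : IsPeriodic K)
    (R : PosDomain n) (x : Equiv.Perm (Fin n)) :
    IsComp (K R.src) R (addPeriodic R (K x) (by rw [hK.src, hK.tgt])) :=
  ⟨(hK.src _).symm, hK.tgt _, rfl, fun c r => by
    rw [hK.coeff _ x, Nat.add_comm]
    rfl⟩

lemma IsPeriodic.comm_frontOp {K : Equiv.Perm (Fin n) → PosDomain n} (hK : IsPeriodic K)
    (sR : PosDomain n → ZMod 2) :
    frontOp A sR * periodicOp A K = periodicOp A K * frontOp A sR := by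
  refine end_ext fun D => ?_
  rw [Module.End.mul_apply, Module.End.mul_apply, periodicOp, lift_single_one, ← periodicOp,
    ← hK.remF_eq_remB, frontOp_remF, hK.tgt]
  rw [frontOp, lift_single_one, map_sum]
  refine Finset.sum_congr rfl fun p _ => ?_
  by_cases hp : IsEmptyRect D.src p.1 p.2
  · rw [if_pos hp, if_pos hp, map_smul, hK.op_remF, remF_remF (hK.isComp_right _ D.src),
      remF_remF (C := addPeriodic (rect D.src p.1 p.2) (K D.src) (by rw [hK.src, hK.tgt]))]
    exact hK.isComp_left (rect D.src p.1 p.2) D.src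
  · rw [if_neg hp, if_neg hp, map_zero]

lemma IsPeriodic.comm_backOp {K : Equiv.Perm (Fin n) → PosDomain n} (hK : IsPeriodic K)
    (sR : PosDomain n → ZMod 2) :
    backOp A sR * periodicOp A K = periodicOp A K * backOp A sR := by
  refine end_ext fun D => ?_
  rw [Module.End.mul_apply, Module.End.mul_apply, periodicOp, lift_single_one, ← periodicOp,
    backOp_remB, hK.src]
  rw [backOp, lift_single_one, map_sum]
  refine Finset.sum_congr rfl fun p _ => ?_
  by_cases hp : IsEmptyRect (D.tgt * Equiv.swap p.1 p.2) p.1 p.2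
  · have h1 := hK.isComp_right (rectTo D.tgt p) D.tgt
    rw [rectTo_tgt] at h1
    rw [if_pos hp, if_pos hp, map_smul, IsPeriodic.op_remB, remB_remB (hK.isComp_left _ D.tgt),
      remB_remB h1]
  · rw [if_neg hp, if_neg hp, map_zero]

lemma IsPeriodic.comm {K L : Equiv.Perm (Fin n) → PosDomain n} (hK : IsPeriodic K)
    (hL : IsPeriodic L) : periodicOp A K * periodicOp A L = periodicOp A L * periodicOp A K := by
  refine end_ext fun D => ?_
  have h1 := hK.isComp_left (L D.tgt) D.tgt
  have h2 := hK.isComp_right (L D.tgt) D.tgt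
  rw [hL.src] at h1
  rw [hL.tgt] at h2
  have e1 : periodicOp A K (periodicOp A L (Finsupp.single D 1)) =
      remB A D (addPeriodic (L D.tgt) (K D.tgt) (by rw [hK.src, hK.tgt])) := by
    have e3 := IsPeriodic.op_remB (A := A) (K := K) D (L D.tgt)
    simp only [hL.src] at e3
    rw [periodicOp, periodicOp, lift_single_one, ← periodicOp, e3, remB_remB h1]
  have e2 : periodicOp A L (periodicOp A K (Finsupp.single D 1)) =
      remB A D (addPeriodic (L D.tgt) (K D.tgt) (by rw [hK.src, hK.tgt])) := by
    have e3 := IsPeriodic.op_remB (A := A) (K := L) D (K D.tgt)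
    simp only [hK.src] at e3
    rw [periodicOp, periodicOp, lift_single_one, ← periodicOp, e3, remB_remB h2]
  rw [Module.End.mul_apply, Module.End.mul_apply, e1, e2]

end PosDomain

/-! ## Operators which act on one component of the generators -/

section Lens

variable {A : Type} [CommRing A] {C X Y : Type}

/-- A component of the elements of `C`, with values in `X`, which can be read and overwritten. -/
structure Lens (C X : Type) where
  get : C → X
  set : C → X → C
  get_set : ∀ c x, get (set c x) = x
  set_set : ∀ c x y, set (set c x) y = set c y

/-- The action of an operator on one component. -/
def Lens.act (φ : Lens C X) (T : Module.End A (X →₀ A)) : Module.End A (C →₀ A) :=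
  lift fun c => Finsupp.lmapDomain A A (φ.set c) (T (Finsupp.single (φ.get c) 1))

lemma Lens.act_single (φ : Lens C X) (T : Module.End A (X →₀ A)) (c : C) :
    φ.act T (Finsupp.single c 1) =
      Finsupp.lmapDomain A A (φ.set c) (T (Finsupp.single (φ.get c) 1)) :=
  lift_single_one _ c

lemma lmapDomain_single_one {S : Type} (f : X → S) (x : X) :
    Finsupp.lmapDomain A A f (Finsupp.single x 1) = Finsupp.single (f x) 1 :=
  Finsupp.mapDomain_single

lemma Lens.act_lmapDomain (φ : Lens C X) (T : Module.End A (X →₀ A)) (c : C) (v : X →₀ A) :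
    φ.act T (Finsupp.lmapDomain A A (φ.set c) v) = Finsupp.lmapDomain A A (φ.set c) (T v) := by
  have : φ.act T ∘ₗ Finsupp.lmapDomain A A (φ.set c) = Finsupp.lmapDomain A A (φ.set c) ∘ₗ T := by
    refine Finsupp.lhom_ext' fun x => LinearMap.ext_ring ?_
    change φ.act T (Finsupp.lmapDomain A A (φ.set c) (Finsupp.single x 1)) =
      Finsupp.lmapDomain A A (φ.set c) (T (Finsupp.single x 1))
    rw [lmapDomain_single_one, φ.act_single, φ.get_set]
    congr 2
    funext y
    exact φ.set_set c x y
  exact LinearMap.congr_fun this v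

lemma Lens.act_mul (φ : Lens C X) (S T : Module.End A (X →₀ A)) :
    φ.act (S * T) = φ.act S * φ.act T := by
  refine end_ext fun c => ?_
  rw [Module.End.mul_apply, φ.act_single, φ.act_single, φ.act_lmapDomain, Module.End.mul_apply]

lemma Lens.act_add (φ : Lens C X) (S T : Module.End A (X →₀ A)) :
    φ.act (S + T) = φ.act S + φ.act T := by
  refine end_ext fun c => ?_
  rw [LinearMap.add_apply, φ.act_single, φ.act_single, φ.act_single, LinearMap.add_apply, map_add]

lemma Lens.act_zero (φ : Lens C X) : φ.act (0 : Module.End A (X →₀ A)) = 0 := by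
  refine end_ext fun c => ?_
  rw [φ.act_single, LinearMap.zero_apply, map_zero, LinearMap.zero_apply]

lemma Lens.act_smul (φ : Lens C X) (u : A) (T : Module.End A (X →₀ A)) :
    φ.act (u • T) = u • φ.act T := by
  refine end_ext fun c => ?_
  rw [LinearMap.smul_apply, φ.act_single, φ.act_single, LinearMap.smul_apply, map_smul]

/-- The two components are independent of each other. -/
structure Lens.Indep (φ : Lens C X) (ψ : Lens C Y) : Prop where
  left : ∀ c y, φ.get (ψ.set c y) = φ.get c
  right : ∀ c x, ψ.get (φ.set c x) = ψ.get c
  set : ∀ c x y, φ.set (ψ.set c y) x = ψ.set (φ.set c x) y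

/-- Both orders expand into the same double sum over terms of `S` and terms of `T`. No sign appears
because all position-dependent signs are kept apart, in diagonal operators. -/
lemma Lens.Indep.comm {φ : Lens C X} {ψ : Lens C Y} (h : φ.Indep ψ) (S : Module.End A (X →₀ A))
    (T : Module.End A (Y →₀ A)) : φ.act S * ψ.act T = ψ.act T * φ.act S := by
  refine end_ext fun c => ?_
  rw [Module.End.mul_apply, Module.End.mul_apply, φ.act_single, ψ.act_single]
  generalize hu : S (Finsupp.single (φ.get c) 1) = u
  generalize hv : T (Finsupp.single (ψ.get c) 1) = v
  have h1 : φ.act S (Finsupp.lmapDomain A A (ψ.set c) v) =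
      Finsupp.linearCombination A
        (fun y => Finsupp.lmapDomain A A (fun x => ψ.set (φ.set c x) y) u) v := by
    have : φ.act S ∘ₗ Finsupp.lmapDomain A A (ψ.set c) = Finsupp.linearCombination A
        (fun y => Finsupp.lmapDomain A A (fun x => ψ.set (φ.set c x) y) u) := by
      refine Finsupp.lhom_ext' fun y => LinearMap.ext_ring ?_
      change φ.act S (Finsupp.lmapDomain A A (ψ.set c) (Finsupp.single y 1)) =
        Finsupp.linearCombination A _ (Finsupp.single y 1)
      rw [lmapDomain_single_one, φ.act_single, h.left, hu, Finsupp.linearCombination_single, one_smul]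
      congr 2
      funext x
      exact h.set c x y
    exact LinearMap.congr_fun this v
  have h2 : ψ.act T (Finsupp.lmapDomain A A (φ.set c) u) =
      Finsupp.linearCombination A
        (fun x => Finsupp.lmapDomain A A (fun y => ψ.set (φ.set c x) y) v) u := by
    have : ψ.act T ∘ₗ Finsupp.lmapDomain A A (φ.set c) = Finsupp.linearCombination A
        (fun x => Finsupp.lmapDomain A A (fun y => ψ.set (φ.set c x) y) v) := by
      refine Finsupp.lhom_ext' fun x => LinearMap.ext_ring ?_
      change ψ.act T (Finsupp.lmapDomain A A (φ.set c) (Finsupp.single x 1)) =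
        Finsupp.linearCombination A _ (Finsupp.single x 1)
      rw [lmapDomain_single_one, ψ.act_single, h.right, hv, Finsupp.linearCombination_single, one_smul]
    exact LinearMap.congr_fun this u
  rw [h1, h2]
  simp only [Finsupp.linearCombination_apply, Finsupp.lmapDomain_apply, Finsupp.mapDomain,
    Finsupp.smul_sum, Finsupp.smul_single]
  rw [Finsupp.sum_comm]
  simp only [smul_eq_mul, mul_comm]

/-- A diagonal operator. -/
def diag (ε : C → A) : Module.End A (C →₀ A) := lift fun c => Finsupp.single c (ε c)

lemma diag_single (ε : C → A) (c : C) : diag ε (Finsupp.single c 1) = Finsupp.single c (ε c) :=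
  lift_single_one _ c

lemma diag_mul (ε δ : C → A) : diag ε * diag δ = diag (fun c => ε c * δ c) := by
  refine end_ext fun c => ?_
  rw [Module.End.mul_apply, diag_single, diag_single, diag, lift_single, Finsupp.smul_single,
    smul_eq_mul, mul_comm]

lemma diag_sq {ε : C → A} (h : ∀ c, ε c * ε c = 1) : diag ε * diag ε = 1 := by
  rw [diag_mul]
  refine end_ext fun c => ?_
  rw [diag_single, h]
  rfl

end Lens

/-! ## Operators on ordered partitions -/

namespace OrdPartition

variable (A : Type) [CommRing A]

/-- The signed sum of the unit enlargements. -/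
def insOp : Module.End A (OrdPartition →₀ A) :=
  lift fun l => ∑ p ∈ Finset.range (l.length + 1), Finsupp.single (l.unitEnlarge p) ((-1) ^ p)

/-- The signed sum of the elementary coarsenings. -/
def coarOp : Module.End A (OrdPartition →₀ A) :=
  lift fun l => ∑ p ∈ Finset.range (l.length - 1), Finsupp.single (l.coarsen p) ((-1) ^ (p + 1))

/-- The initial reduction. -/
def headOp (t : ZMod 2) : Module.End A (OrdPartition →₀ A) :=
  lift fun l => if h : l ≠ [] then Finsupp.single l.tail (sgn A (((l.head h : ℕ+) : ℕ) * t)) else 0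

/-- The final reduction. -/
def lastOp (t : ZMod 2) : Module.End A (OrdPartition →₀ A) :=
  lift fun l => if h : l ≠ [] then
    Finsupp.single l.dropLast ((-1) ^ l.length * sgn A (((l.getLast h : ℕ+) : ℕ) * t)) else 0

/-- Adding a first part. -/
def consOp (a : ℕ+) : Module.End A (OrdPartition →₀ A) := Finsupp.lmapDomain A A (List.cons a)

/-- Adding `a` to the first part. -/
def addOp (a : ℕ+) : Module.End A (OrdPartition →₀ A) :=
  lift fun l => match l with
    | [] => 0
    | b :: l => Finsupp.single ((a + b) :: l) 1

/-- The projection to the empty partition. -/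
def nilOp : Module.End A (OrdPartition →₀ A) :=
  lift fun l => match l with
    | [] => Finsupp.single [] 1
    | _ :: _ => 0

variable {A}

lemma consOp_single (a : ℕ+) (l : OrdPartition) (u : A) :
    consOp A a (Finsupp.single l u) = Finsupp.single (a :: l) u :=
  Finsupp.mapDomain_single

lemma addOp_nil (a : ℕ+) : addOp A a (Finsupp.single [] 1) = 0 := lift_single_one _ _

lemma addOp_cons (a b : ℕ+) (l : OrdPartition) :
    addOp A a (Finsupp.single (b :: l) 1) = Finsupp.single ((a + b) :: l) 1 := lift_single_one _ _

lemma nilOp_nil : nilOp A (Finsupp.single [] 1) = Finsupp.single [] 1 := lift_single_one _ _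

lemma nilOp_cons (a : ℕ+) (l : OrdPartition) : nilOp A (Finsupp.single (a :: l) 1) = 0 :=
  lift_single_one _ _

lemma insOp_nil : insOp A (Finsupp.single [] 1) = Finsupp.single [1] 1 := by
  rw [insOp, lift_single_one]
  simp [unitEnlarge]

lemma coarOp_nil : coarOp A (Finsupp.single [] 1) = 0 := by
  rw [coarOp, lift_single_one]
  simp

lemma headOp_nil (t : ZMod 2) : headOp A t (Finsupp.single [] 1) = 0 := by
  rw [headOp, lift_single_one]
  simp

lemma lastOp_nil (t : ZMod 2) : lastOp A t (Finsupp.single [] 1) = 0 := by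
  rw [lastOp, lift_single_one]
  simp

lemma eq_of_single {S T : Module.End A (OrdPartition →₀ A)}
    (h : ∀ l, S (Finsupp.single l 1) = T (Finsupp.single l 1)) (v : OrdPartition →₀ A) :
    S v = T v :=
  LinearMap.congr_fun (end_ext h) v

/-- Peeling off the first part turns the alternating sums into recursions whose only sign is a
minus. The identities below then follow by induction on the list, without reindexing positions. -/
lemma insOp_cons (a : ℕ+) (v : OrdPartition →₀ A) :
    insOp A (consOp A a v) = consOp A 1 (consOp A a v) - consOp A a (insOp A v) := by
  refine eq_of_single (S := insOp A * consOp A a)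
    (T := consOp A 1 * consOp A a - consOp A a * insOp A) (fun l => ?_) v
  simp only [Module.End.mul_apply, LinearMap.sub_apply, consOp_single]
  rw [insOp, lift_single_one, lift_single_one, List.length_cons, Finset.sum_range_succ',
    map_sum, sub_eq_add_neg, add_comm, ← Finset.sum_neg_distrib]
  congr 1
  · simp [unitEnlarge]
  · refine Finset.sum_congr rfl fun p _ => ?_
    rw [consOp_single, pow_succ, mul_neg_one, Finsupp.single_neg]
    rfl

lemma coarOp_cons (a : ℕ+) (v : OrdPartition →₀ A) :
    coarOp A (consOp A a v) = -addOp A a v - consOp A a (coarOp A v) := by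
  refine eq_of_single (S := coarOp A * consOp A a)
    (T := -addOp A a - consOp A a * coarOp A) (fun l => ?_) v
  simp only [Module.End.mul_apply, LinearMap.sub_apply, LinearMap.neg_apply, consOp_single]
  rcases l with _ | ⟨b, l⟩
  · rw [addOp_nil, coarOp_nil, coarOp, lift_single_one]
    simp
  · rw [addOp_cons, coarOp, lift_single_one, lift_single_one]
    simp only [List.length_cons, Nat.add_sub_cancel]
    rw [Finset.sum_range_succ', map_sum, sub_eq_add_neg, add_comm, ← Finset.sum_neg_distrib]
    congr 1
    · rw [← Finsupp.single_neg]
      simp [coarsen]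
    · refine Finset.sum_congr rfl fun p _ => ?_
      rw [consOp_single, pow_succ _ (p + 1), mul_neg_one, Finsupp.single_neg]
      rfl

lemma headOp_cons (t : ZMod 2) (a : ℕ+) (v : OrdPartition →₀ A) :
    headOp A t (consOp A a v) = sgn A ((a : ℕ) * t) • v := by
  refine eq_of_single (S := headOp A t * consOp A a)
    (T := sgn A ((a : ℕ) * t) • 1) (fun l => ?_) v
  rw [Module.End.mul_apply, consOp_single, headOp, lift_single_one]
  simp

lemma lastOp_cons (t : ZMod 2) (a : ℕ+) (v : OrdPartition →₀ A) :
    lastOp A t (consOp A a v) = -(consOp A a (lastOp A t v)) - sgn A ((a : ℕ) * t) • nilOp A v := by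
  refine eq_of_single (S := lastOp A t * consOp A a)
    (T := -(consOp A a * lastOp A t) - sgn A ((a : ℕ) * t) • nilOp A) (fun l => ?_) v
  simp only [Module.End.mul_apply, LinearMap.sub_apply, LinearMap.neg_apply, LinearMap.smul_apply,
    consOp_single]
  rcases l with _ | ⟨b, l⟩
  · rw [nilOp_nil, lastOp_nil, lastOp, lift_single_one]
    simp
  · rw [nilOp_cons, lastOp, lift_single_one, lift_single_one, dif_pos (List.cons_ne_nil _ _),
      dif_pos (List.cons_ne_nil _ _), consOp_single, smul_zero, sub_zero, ← Finsupp.single_neg,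
      List.getLast_cons (List.cons_ne_nil _ _), List.length_cons (as := b :: l), pow_succ,
      mul_neg_one, neg_mul]
    rfl

lemma addOp_consOp (a b : ℕ+) (v : OrdPartition →₀ A) :
    addOp A a (consOp A b v) = consOp A (a + b) v := by
  refine eq_of_single (S := addOp A a * consOp A b) (T := consOp A (a + b)) (fun l => ?_) v
  rw [Module.End.mul_apply, consOp_single, addOp_cons, consOp_single]

lemma nilOp_consOp (a : ℕ+) (v : OrdPartition →₀ A) : nilOp A (consOp A a v) = 0 := by
  refine eq_of_single (S := nilOp A * consOp A a) (T := 0) (fun l => ?_) v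
  rw [Module.End.mul_apply, consOp_single, nilOp_cons, LinearMap.zero_apply]

/-- Operators agree if they agree on the empty partition and after adding a first part. -/
lemma eq_of_cons {S T : Module.End A (OrdPartition →₀ A)}
    (h0 : S (Finsupp.single [] 1) = T (Finsupp.single [] 1))
    (h : ∀ a v, S (consOp A a v) = T (consOp A a v)) (v : OrdPartition →₀ A) : S v = T v := by
  refine eq_of_single (fun l => ?_) v
  rcases l with _ | ⟨a, l⟩
  · exact h0
  · simpa [consOp_single] using h a (Finsupp.single l 1)

lemma eq_zero_of_cons {T : Module.End A (OrdPartition →₀ A)}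
    (h0 : T (Finsupp.single [] 1) = 0)
    (h : ∀ a v, T (consOp A a v) = consOp A a (T v)) (v : OrdPartition →₀ A) : T v = 0 := by
  refine eq_of_single (T := 0) (fun l => ?_) v
  rw [LinearMap.zero_apply]
  induction l with
  | nil => exact h0
  | cons a l ih => simpa [consOp_single, ih] using h a (Finsupp.single l 1)

lemma insOp_insOp (v : OrdPartition →₀ A) : insOp A (insOp A v) = 0 := by
  refine eq_zero_of_cons (T := insOp A * insOp A) ?_ (fun a v => ?_) v
  · rw [Module.End.mul_apply, insOp_nil, ← consOp_single, insOp_cons, insOp_nil, sub_eq_zero,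
      consOp_single]
  · simp only [Module.End.mul_apply, insOp_cons, map_sub]
    abel

lemma nilOp_nilOp (v : OrdPartition →₀ A) : nilOp A (nilOp A v) = nilOp A v :=
  eq_of_cons (S := nilOp A * nilOp A) (by simp [nilOp_nil]) (fun a v => by simp [nilOp_consOp]) v

lemma nilOp_addOp (a : ℕ+) (v : OrdPartition →₀ A) : nilOp A (addOp A a v) = 0 :=
  eq_of_cons (S := nilOp A * addOp A a) (T := 0) (by simp [addOp_nil])
    (fun b v => by simp [addOp_consOp, nilOp_consOp]) v

lemma addOp_nilOp (a : ℕ+) (v : OrdPartition →₀ A) : addOp A a (nilOp A v) = 0 :=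
  eq_of_cons (S := addOp A a * nilOp A) (T := 0) (by simp [nilOp_nil, addOp_nil])
    (fun b v => by simp [nilOp_consOp]) v

lemma nilOp_insOp (v : OrdPartition →₀ A) : nilOp A (insOp A v) = 0 :=
  eq_of_cons (S := nilOp A * insOp A) (T := 0) (by simp [insOp_nil, nilOp_cons])
    (fun a v => by simp [insOp_cons, nilOp_consOp]) v

lemma insOp_nilOp (v : OrdPartition →₀ A) : insOp A (nilOp A v) = consOp A 1 (nilOp A v) :=
  eq_of_cons (S := insOp A * nilOp A) (T := consOp A 1 * nilOp A)
    (by simp [nilOp_nil, insOp_nil, consOp_single])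
    (fun a v => by simp [nilOp_consOp]) v

lemma addOp_addOp (a b : ℕ+) (v : OrdPartition →₀ A) :
    addOp A a (addOp A b v) = addOp A (a + b) v :=
  eq_of_cons (S := addOp A a * addOp A b) (by simp [addOp_nil])
    (fun c v => by simp [addOp_consOp, add_assoc]) v

/-- The coarsenings together with the final reduction. -/
def shrinkOp (A : Type) [CommRing A] (t : ZMod 2) : Module.End A (OrdPartition →₀ A) :=
  coarOp A + lastOp A t

lemma shrinkOp_nil (t : ZMod 2) : shrinkOp A t (Finsupp.single [] 1) = 0 := by
  rw [shrinkOp, LinearMap.add_apply, coarOp_nil, lastOp_nil, add_zero]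

lemma shrinkOp_cons (t : ZMod 2) (a : ℕ+) (v : OrdPartition →₀ A) :
    shrinkOp A t (consOp A a v) =
      -addOp A a v - consOp A a (shrinkOp A t v) - sgn A ((a : ℕ) * t) • nilOp A v := by
  rw [shrinkOp, LinearMap.add_apply, LinearMap.add_apply, coarOp_cons, lastOp_cons, map_add]
  abel

lemma shrinkOp_nilOp (t : ZMod 2) (v : OrdPartition →₀ A) : shrinkOp A t (nilOp A v) = 0 :=
  eq_of_cons (S := shrinkOp A t * nilOp A) (T := 0) (by simp [nilOp_nil, shrinkOp_nil])
    (fun a v => by simp [nilOp_consOp]) v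

lemma headOp_nilOp (t : ZMod 2) (v : OrdPartition →₀ A) : headOp A t (nilOp A v) = 0 :=
  eq_of_cons (S := headOp A t * nilOp A) (T := 0) (by simp [nilOp_nil, headOp_nil])
    (fun a v => by simp [nilOp_consOp]) v

lemma sgn_add (s t : ZMod 2) : sgn A (s + t) = sgn A s * sgn A t := by
  rw [sgn, sgn, sgn, ZMod.val_add, ← pow_add, ← neg_one_pow_eq_pow_mod_two]

lemma sgn_pnat_add (t : ZMod 2) (a b : ℕ+) :
    sgn A (((a + b : ℕ+) : ℕ) * t) = sgn A ((a : ℕ) * t) * sgn A ((b : ℕ) * t) := by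
  rw [← sgn_add, PNat.add_coe, Nat.cast_add, add_mul]

lemma shrinkOp_addOp (t : ZMod 2) (a : ℕ+) (v : OrdPartition →₀ A) :
    shrinkOp A t (addOp A a v) =
      addOp A a (shrinkOp A t v) + sgn A ((a : ℕ) * t) • nilOp A (shrinkOp A t v) := by
  refine eq_of_cons (S := shrinkOp A t * addOp A a)
    (T := addOp A a * shrinkOp A t + sgn A ((a : ℕ) * t) • (nilOp A * shrinkOp A t))
    ?_ (fun b v => ?_) v
  · simp [addOp_nil, shrinkOp_nil]
  · simp only [Module.End.mul_apply, LinearMap.add_apply, LinearMap.smul_apply, addOp_consOp,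
      shrinkOp_cons, map_sub, map_neg, map_smul, addOp_addOp, addOp_nilOp, nilOp_addOp,
      nilOp_consOp, nilOp_nilOp, sgn_pnat_add, mul_smul]
    simp [sub_eq_add_neg]

/-- The contribution of the empty remainder in `shrinkOp_addOp` cancels that in `shrinkOp_cons`. The
square therefore commutes with adding a first part, and it kills the empty partition. -/
lemma shrinkOp_shrinkOp (t : ZMod 2) (v : OrdPartition →₀ A) :
    shrinkOp A t (shrinkOp A t v) = 0 := by
  refine eq_zero_of_cons (T := shrinkOp A t * shrinkOp A t) ?_ (fun a v => ?_) v
  · simp [shrinkOp_nil]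
  · simp only [Module.End.mul_apply, shrinkOp_cons, map_sub, map_neg, map_smul, shrinkOp_addOp,
      shrinkOp_nilOp, smul_zero]
    abel

lemma headOp_addOp (t : ZMod 2) (a : ℕ+) (v : OrdPartition →₀ A) :
    headOp A t (addOp A a v) = sgn A ((a : ℕ) * t) • headOp A t v := by
  refine eq_of_cons (S := headOp A t * addOp A a) (T := sgn A ((a : ℕ) * t) • headOp A t)
    ?_ (fun b v => ?_) v
  · simp [addOp_nil, headOp_nil]
  · simp only [Module.End.mul_apply, LinearMap.smul_apply, addOp_consOp, headOp_cons,
      sgn_pnat_add, mul_smul]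

/-- Deleting the first two parts in turn cancels against deleting their sum, because `sgn` is
multiplicative in the size of the part. All other terms anticommute. -/
lemma headOp_shrinkOp (t : ZMod 2) (v : OrdPartition →₀ A) :
    shrinkOp A t (headOp A t v) + headOp A t (shrinkOp A t v) + headOp A t (headOp A t v) = 0 := by
  refine eq_of_cons (S := shrinkOp A t * headOp A t + headOp A t * shrinkOp A t +
    headOp A t * headOp A t) (T := 0) ?_ (fun a v => ?_) v
  · simp [headOp_nil, shrinkOp_nil]
  · simp only [Module.End.mul_apply, LinearMap.add_apply, LinearMap.zero_apply, headOp_cons,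
      shrinkOp_cons, map_sub, map_neg, map_smul, headOp_addOp, headOp_nilOp, smul_zero]
    abel

/-- What survives is a `1` inserted in front and deleted again. In `insOp_shrinkOp` a `1` inserted
at the end gives the opposite term, and the two cancel in `insOp_redOp`. -/
lemma insOp_headOp (t : ZMod 2) (v : OrdPartition →₀ A) :
    insOp A (headOp A t v) + headOp A t (insOp A v) = sgn A t • v := by
  refine eq_of_cons (S := insOp A * headOp A t + headOp A t * insOp A)
    (T := sgn A t • 1) ?_ (fun a v => ?_) v
  · simp [headOp_nil, insOp_nil, ← consOp_single, headOp_cons]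
  · simp only [Module.End.mul_apply, LinearMap.add_apply, LinearMap.smul_apply, headOp_cons,
      insOp_cons, map_sub, map_smul, Module.End.one_apply, PNat.one_coe, Nat.cast_one, one_mul]
    abel

lemma insOp_addOp (a : ℕ+) (v : OrdPartition →₀ A) :
    insOp A (addOp A a v) =
      consOp A 1 (addOp A a v) + addOp A a (insOp A v) - consOp A (1 + a) v := by
  refine eq_of_cons (S := insOp A * addOp A a)
    (T := consOp A 1 * addOp A a + addOp A a * insOp A - consOp A (1 + a)) ?_ (fun b v => ?_) v
  · simp [addOp_nil, insOp_nil, addOp_cons, consOp_single, add_comm]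
  · simp only [Module.End.mul_apply, LinearMap.add_apply, LinearMap.sub_apply, addOp_consOp,
      insOp_cons, map_sub, add_comm 1 a]
    abel

lemma insOp_shrinkOp (t : ZMod 2) (v : OrdPartition →₀ A) :
    insOp A (shrinkOp A t v) + shrinkOp A t (insOp A v) + sgn A t • v = 0 := by
  refine eq_zero_of_cons (T := insOp A * shrinkOp A t + shrinkOp A t * insOp A + sgn A t • 1)
    ?_ (fun a v => ?_) v
  · simp [shrinkOp_nil, insOp_nil, ← consOp_single, shrinkOp_cons, addOp_nil, nilOp_nil]
  · simp only [Module.End.mul_apply, LinearMap.add_apply, LinearMap.smul_apply,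
      Module.End.one_apply, insOp_cons, shrinkOp_cons, map_sub, map_neg, map_smul, map_add,
      insOp_addOp, insOp_nilOp, nilOp_consOp, addOp_consOp, nilOp_insOp, smul_zero]
    abel

/-- All the reductions of an ordered partition. -/
def redOp (A : Type) [CommRing A] (t : ZMod 2) : Module.End A (OrdPartition →₀ A) :=
  coarOp A + headOp A t + lastOp A t

lemma redOp_apply (t : ZMod 2) (v : OrdPartition →₀ A) :
    redOp A t v = shrinkOp A t v + headOp A t v := by
  simp only [redOp, shrinkOp, LinearMap.add_apply]
  abel

lemma redOp_mul_redOp (t : ZMod 2) : redOp A t * redOp A t = 0 := by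
  refine LinearMap.ext fun v => ?_
  have h := headOp_shrinkOp t v
  rw [Module.End.mul_apply, redOp_apply, redOp_apply, map_add, map_add, shrinkOp_shrinkOp, zero_add,
    ← add_assoc, h, LinearMap.zero_apply]

lemma insOp_mul_insOp : insOp A * insOp A = 0 := LinearMap.ext insOp_insOp

lemma insOp_redOp (t : ZMod 2) : insOp A * redOp A t + redOp A t * insOp A = 0 := by
  refine LinearMap.ext fun v => ?_
  have h1 := insOp_headOp t v
  have h2 := insOp_shrinkOp t v
  rw [← h1] at h2
  rw [LinearMap.add_apply, Module.End.mul_apply, Module.End.mul_apply, redOp_apply, redOp_apply,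
    map_add, LinearMap.zero_apply, ← h2]
  abel

end OrdPartition

/-! ## The differential in terms of operators -/

namespace CDPGen

/-- The domain of a generator. -/
def domLens : Lens (CDPGen n) (PosDomain n) := ⟨dom, setDom, fun _ _ => rfl, fun _ _ _ => rfl⟩

/-- One of the partitions of a generator. -/
def partLens (j : Fin n) : Lens (CDPGen n) OrdPartition :=
  ⟨fun g => g.part j, fun g l => g.setPart j l, fun g l => by simp [setPart],
    fun g l l' => by simp [setPart]⟩

lemma domLens_indep (j : Fin n) : (domLens (n := n)).Indep (partLens j) :=
  ⟨fun _ _ => rfl, fun _ _ => rfl, fun _ _ _ => rfl⟩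

lemma partLens_indep {i j : Fin n} (h : i ≠ j) : (partLens i).Indep (partLens j) := by
  refine ⟨fun g l => ?_, fun g l => ?_, fun g k l => ?_⟩
  · simp [partLens, setPart, h]
  · simp [partLens, setPart, h.symm]
  · simp only [partLens, setPart]
    rw [Function.update_comm h]

end CDPGen

open CDPGen PosDomain OrdPartition

section

variable (A : Type) [CommRing A]

/-- The sign `(-1)^μ(D)` as a diagonal operator. -/
def maslovSign : Module.End A (CDPGen n →₀ A) := diag fun g => (-1) ^ g.dom.maslov

/-- The sign `(-1)^(l(λ_1) + ⋯ + l(λ_{j-1}))` as a diagonal operator. -/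
def preSignOp (j : Fin n) : Module.End A (CDPGen n →₀ A) := diag fun g => preSign A g j

/-- Splitting off the vertical annulus through `O_j`, minus splitting off the horizontal one. -/
def annOp (G : GridDiagram n) (j : Fin n) : Module.End A (PosDomain n →₀ A) :=
  periodicOp A (fun x => colAnnulus x (G.oCol j)) +
    (-1 : A) • periodicOp A (fun x => rowAnnulus x (G.oRow j))

/-- The terms which involve `λ_j`, without the common sign. -/
def markOp (G : GridDiagram n) (sB : Fin n → ZMod 2) (j : Fin n) : Module.End A (CDPGen n →₀ A) :=
  (partLens j).act (redOp A (sB j)) + (partLens j).act (insOp A) * domLens.act (annOp A G j)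

variable {A}

lemma front_term (g : CDPGen n) (R : PosDomain n) (h : R.src = g.dom.src) {P : Prop} [Decidable P]
    [Decidable (P ∧ R.coeff ≤ g.dom.coeff)] (u : A) :
    (if h' : P ∧ R.coeff ≤ g.dom.coeff then
        Finsupp.single (g.setDom (g.dom.removeFront R h h'.2)) u else 0) =
      Finsupp.lmapDomain A A g.setDom (if P then u • remF A g.dom R else 0) := by
  by_cases h1 : P
  · by_cases h2 : R.coeff ≤ g.dom.coeff
    · rw [dif_pos ⟨h1, h2⟩, if_pos h1, remF, dif_pos ⟨h, h2⟩, map_smul, lmapDomain_single_one,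
        Finsupp.smul_single, smul_eq_mul, mul_one]
    · rw [dif_neg (fun h' => h2 h'.2), if_pos h1, remF, dif_neg (fun h' => h2 h'.2), smul_zero,
        map_zero]
  · rw [dif_neg (fun h' => h1 h'.1), if_neg h1, map_zero]

lemma back_term (g : CDPGen n) (R : PosDomain n) (h : R.tgt = g.dom.tgt) {P : Prop} [Decidable P]
    [Decidable (P ∧ R.coeff ≤ g.dom.coeff)] (u w : A) :
    (if h' : P ∧ R.coeff ≤ g.dom.coeff then
        Finsupp.single (g.setDom (g.dom.removeBack R h h'.2)) (w * u) else 0) =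
      w • Finsupp.lmapDomain A A g.setDom (if P then u • remB A g.dom R else 0) := by
  by_cases h1 : P
  · by_cases h2 : R.coeff ≤ g.dom.coeff
    · rw [dif_pos ⟨h1, h2⟩, if_pos h1, remB, dif_pos ⟨h, h2⟩, map_smul, lmapDomain_single_one,
        smul_smul, Finsupp.smul_single, smul_eq_mul, mul_one]
    · rw [dif_neg (fun h' => h2 h'.2), if_pos h1, remB, dif_neg (fun h' => h2 h'.2), smul_zero,
        map_zero, smul_zero]
  · rw [dif_neg (fun h' => h1 h'.1), if_neg h1, map_zero, smul_zero]

lemma bdryI_eq (sR : PosDomain n → ZMod 2) (g : CDPGen n) :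
    bdryI A sR g = domLens.act (frontOp A sR) (Finsupp.single g 1) +
      domLens.act (backOp A sR) (maslovSign A (Finsupp.single g 1)) := by
  rw [maslovSign, diag_single, ← mul_one ((-1 : A) ^ _), ← smul_eq_mul, ← Finsupp.smul_single,
    map_smul, Lens.act_single, Lens.act_single, frontOp, backOp, lift_single_one, lift_single_one,
    map_sum, map_sum, Fintype.sum_prod_type, Fintype.sum_prod_type, bdryI, Finset.smul_sum]
  congr 1
  · refine Finset.sum_congr rfl fun i _ => Finset.sum_congr rfl fun j _ => ?_
    classical
    convert front_term g (rect g.dom.src i j) rfl (P := IsEmptyRect g.dom.src i j) _ <;> rfl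
  · refine Finset.sum_congr rfl fun i _ => ?_
    rw [Finset.smul_sum]
    refine Finset.sum_congr rfl fun j _ => ?_
    classical
    convert back_term g (rectTo g.dom.tgt (i, j)) (rectTo_tgt _ (i, j))
        (P := IsEmptyRect (g.dom.tgt * Equiv.swap i j) i j) _ _ <;> rfl

lemma insOp_act_setDom (j : Fin n) (g : CDPGen n) (E : PosDomain n) :
    (partLens j).act (insOp A) (Finsupp.single (g.setDom E) 1) =
      ∑ p ∈ Finset.range ((g.part j).length + 1),
        Finsupp.single ((g.setDom E).setPart j ((g.part j).unitEnlarge p)) ((-1 : A) ^ p) := by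
  rw [Lens.act_single, insOp, lift_single_one, map_sum]
  exact Finset.sum_congr rfl fun p _ => Finsupp.mapDomain_single

lemma periodic_terms {K : Equiv.Perm (Fin n) → PosDomain n} (hK : IsPeriodic K) (j : Fin n)
    (g : CDPGen n) (u : A) :
    u • (partLens j).act (insOp A) (domLens.act (periodicOp A K) (Finsupp.single g 1)) =
      open Classical in
      if h : (K g.dom.tgt).coeff ≤ g.dom.coeff then
        ∑ p ∈ Finset.range ((g.part j).length + 1),
          Finsupp.single ((g.setDom (g.dom.removeBack (K g.dom.tgt) (hK.tgt _) h)).setPart j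
            ((g.part j).unitEnlarge p)) (u * (-1 : A) ^ p)
      else 0 := by
  rw [Lens.act_single, periodicOp, lift_single_one]
  change u • (partLens j).act (insOp A) (Finsupp.lmapDomain A A g.setDom (remB A g.dom _)) = _
  by_cases h : (K g.dom.tgt).coeff ≤ g.dom.coeff
  · rw [dif_pos h, remB, dif_pos ⟨hK.tgt _, h⟩, lmapDomain_single_one, insOp_act_setDom,
      Finset.smul_sum]
    simp only [Finsupp.smul_single, smul_eq_mul]
    rfl
  · rw [dif_neg h, remB, dif_neg (fun h' => h h'.2), map_zero, map_zero, smul_zero]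

/-- Signs that depend on the whole generator become diagonal operators applied first. The remaining
factors each act on a single component, so `∂² = 0` becomes a matter of commutation relations. -/
lemma bdry_eq (G : GridDiagram n) (sR : PosDomain n → ZMod 2) (sB : Fin n → ZMod 2) :
    bdry A G sR sB = domLens.act (frontOp A sR) + domLens.act (backOp A sR) * maslovSign A +
      ∑ j, markOp A G sB j * (preSignOp A j * maslovSign A) := by
  refine end_ext fun g => ?_
  have hE : ∀ j, (markOp A G sB j * (preSignOp A j * maslovSign A) : Module.End A (CDPGen n →₀ A))
      (Finsupp.single g 1) =
      ((-1) ^ g.dom.maslov * preSign A g j) • markOp A G sB j (Finsupp.single g 1) := by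
    intro j
    rw [maslovSign, preSignOp, diag_mul, Module.End.mul_apply, diag_single, ← mul_one (preSign A g j * _),
      ← smul_eq_mul, ← Finsupp.smul_single, map_smul, mul_comm]
  rw [LinearMap.add_apply, LinearMap.add_apply, Module.End.mul_apply, ← bdryI_eq, bdry,
    Finsupp.linearCombination_single, one_smul, add_assoc, add_assoc, LinearMap.sum_apply]
  congr 1
  simp only [hE]
  rw [bdryII, bdryIII, bdryIV]
  simp only [← Finset.sum_add_distrib]
  refine Finset.sum_congr rfl fun j _ => ?_
  have hred : (partLens j).act (redOp A (sB j)) (Finsupp.single g 1) =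
      Finsupp.lmapDomain A A (g.setPart j) (redOp A (sB j) (Finsupp.single (g.part j) 1)) :=
    Lens.act_single _ _ _
  rw [markOp, LinearMap.add_apply, smul_add, Module.End.mul_apply, annOp, Lens.act_add,
    LinearMap.add_apply, Lens.act_smul, LinearMap.smul_apply, map_add, smul_add, map_smul, smul_smul,
    periodic_terms (isPeriodic_col _), periodic_terms (isPeriodic_row _), hred, redOp,
    LinearMap.add_apply, LinearMap.add_apply, coarOp, headOp, lastOp, lift_single_one,
    lift_single_one, lift_single_one, map_add, map_add, map_sum, smul_add, smul_add]
  refine (add_comm _ _).trans (congrArg₂ (· + ·) ((add_assoc _ _ _).symm.trans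
    (congrArg₂ (· + ·) (congrArg₂ (· + ·) ?_ ?_) ?_))
    ((add_comm _ _).trans (congrArg₂ (· + ·) ?_ ?_)))
  · rw [Finset.smul_sum]
    refine Finset.sum_congr rfl fun p _ => ?_
    rw [Finsupp.lmapDomain_apply, Finsupp.mapDomain_single, Finsupp.smul_single, smul_eq_mul]
  · by_cases h : g.part j ≠ []
    · rw [dif_pos h, dif_pos h, Finsupp.lmapDomain_apply, Finsupp.mapDomain_single,
        Finsupp.smul_single, smul_eq_mul]
    · rw [dif_neg h, dif_neg h, map_zero, smul_zero]
  · by_cases h : g.part j ≠ []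
    · rw [dif_pos h, dif_pos h, Finsupp.lmapDomain_apply, Finsupp.mapDomain_single,
        Finsupp.smul_single, smul_eq_mul]
      congr 1
      ring
    · rw [dif_neg h, dif_neg h, map_zero, smul_zero]
  · split_ifs with h
    · rfl
    · rfl
  · split_ifs with h
    · refine Finset.sum_congr rfl fun p _ => congrArg _ ?_
      rw [pow_add]
      ring
    · rfl

end

/-! ## Consequences of the sign assignment -/

namespace PosDomain

/-- The composition of two domains. -/
def comp (P Q : PosDomain n) (h : P.tgt = Q.src) : PosDomain n where
  src := P.src
  tgt := Q.tgt
  coeff := fun c r => P.coeff c r + Q.coeff c r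
  boundary := by
    intro i j
    have h1 := P.boundary i j
    have h2 := Q.boundary i j
    rw [h] at h1
    simp only [alphaBoundary] at h1 h2 ⊢
    push_cast
    linarith

lemma isComp_comp (P Q : PosDomain n) (h : P.tgt = Q.src) : IsComp P Q (comp P Q h) :=
  ⟨rfl, h, rfl, fun _ _ => rfl⟩

/-- The composition of two rectangles. -/
def pairDom (x : Equiv.Perm (Fin n)) (p q : Fin n × Fin n) : PosDomain n :=
  comp (rect x p.1 p.2) (rect (x * Equiv.swap p.1 p.2) q.1 q.2) rfl

lemma isComp_pairDom (x : Equiv.Perm (Fin n)) (p q : Fin n × Fin n) :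
    IsComp (rect x p.1 p.2) (rect (x * Equiv.swap p.1 p.2) q.1 q.2) (pairDom x p q) :=
  isComp_comp _ _ _

/-- The two rectangles are empty. -/
def ValidPair (x : Equiv.Perm (Fin n)) (p q : Fin n × Fin n) : Prop :=
  IsEmptyRect x p.1 p.2 ∧ IsEmptyRect (x * Equiv.swap p.1 p.2) q.1 q.2

instance (x : Equiv.Perm (Fin n)) (p q : Fin n × Fin n) : Decidable (ValidPair x p q) :=
  inferInstanceAs (Decidable (_ ∧ _))

lemma maslov_pairDom {x : Equiv.Perm (Fin n)} {p q : Fin n × Fin n} (h : ValidPair x p q) :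
    (pairDom x p q).maslov = 2 := by
  rw [maslov_eq, (isComp_pairDom x p q).num_eq, num_rect h.1, num_rect h.2]

end PosDomain

section Cochain

variable (G : GridDiagram n) (s : CDPGen n → ZMod 2)

lemma neg_one_pow_zmod_two (k : ℕ) : (-1 : ZMod 2) ^ k = 1 := by
  rw [show (-1 : ZMod 2) = 1 from rfl, one_pow]

lemma sgn_zmod_two (t : ZMod 2) : sgn (ZMod 2) t = 1 := neg_one_pow_zmod_two _

lemma coboundary_eq (g : CDPGen n) : coboundary G s g =
    Finsupp.linearCombination (ZMod 2) s
      (domLens.act (frontOp (ZMod 2) 0) (Finsupp.single g 1)) +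
    Finsupp.linearCombination (ZMod 2) s
      (domLens.act (backOp (ZMod 2) 0) (Finsupp.single g 1)) +
    ∑ j, Finsupp.linearCombination (ZMod 2) s (markOp (ZMod 2) G 0 j (Finsupp.single g 1)) := by
  have hm : maslovSign (ZMod 2) (n := n) = 1 := by
    refine end_ext fun g => ?_
    rw [maslovSign, diag_single, neg_one_pow_zmod_two]
    rfl
  have hp : ∀ j, preSignOp (ZMod 2) (n := n) j = 1 := by
    refine fun j => end_ext fun g => ?_
    rw [preSignOp, diag_single, preSign, neg_one_pow_zmod_two]
    rfl
  rw [coboundary, bdry_eq, hm]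
  simp only [hp, mul_one, LinearMap.add_apply, map_add, LinearMap.sum_apply, map_sum]

lemma front_sum {g : CDPGen n} : domLens.act (frontOp (ZMod 2) 0) (Finsupp.single g 1) =
    ∑ p : Fin n × Fin n, if IsEmptyRect g.dom.src p.1 p.2 then
      Finsupp.lmapDomain (ZMod 2) (ZMod 2) g.setDom (remF (ZMod 2) g.dom (rect g.dom.src p.1 p.2))
      else 0 := by
  rw [Lens.act_single, frontOp, lift_single_one, map_sum]
  refine Finset.sum_congr rfl fun p _ => ?_
  rw [sgn_zmod_two, one_smul, apply_ite (Finsupp.lmapDomain _ _ _), map_zero]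
  rfl

lemma back_sum {g : CDPGen n} : domLens.act (backOp (ZMod 2) 0) (Finsupp.single g 1) =
    ∑ p : Fin n × Fin n, if IsEmptyRect (g.dom.tgt * Equiv.swap p.1 p.2) p.1 p.2 then
      Finsupp.lmapDomain (ZMod 2) (ZMod 2) g.setDom (remB (ZMod 2) g.dom (rectTo g.dom.tgt p))
      else 0 := by
  rw [Lens.act_single, backOp, lift_single_one, map_sum]
  refine Finset.sum_congr rfl fun p _ => ?_
  rw [sgn_zmod_two, one_smul, apply_ite (Finsupp.lmapDomain _ _ _), map_zero]
  rfl

variable {G s}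

/-- The front terms, if there is only one. -/
lemma front_unique {g : CDPGen n} {p : Fin n × Fin n} {E : PosDomain n}
    (hp : IsEmptyRect g.dom.src p.1 p.2) (hE : IsComp (rect g.dom.src p.1 p.2) E g.dom)
    (h : ∀ q : Fin n × Fin n, IsEmptyRect g.dom.src q.1 q.2 →
      (∀ c r, rectCoeff g.dom.src q.1 q.2 c r ≤ g.dom.coeff c r) → q = p) :
    domLens.act (frontOp (ZMod 2) 0) (Finsupp.single g 1) = Finsupp.single (g.setDom E) 1 := by
  rw [front_sum, Fintype.sum_eq_single p, if_pos hp, remF_of hE, lmapDomain_single_one]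
  intro q hq
  split_ifs with hq'
  · rw [remF_eq_zero, map_zero]
    exact fun F hF => hq (h q hq' hF.le_left)
  · rfl

lemma back_unique {g : CDPGen n} {p : Fin n × Fin n} {E : PosDomain n}
    (hp : IsEmptyRect (g.dom.tgt * Equiv.swap p.1 p.2) p.1 p.2)
    (hE : IsComp E (rectTo g.dom.tgt p) g.dom)
    (h : ∀ q : Fin n × Fin n, IsEmptyRect (g.dom.tgt * Equiv.swap q.1 q.2) q.1 q.2 →
      (∀ c r, rectCoeff (g.dom.tgt * Equiv.swap q.1 q.2) q.1 q.2 c r ≤ g.dom.coeff c r) → q = p) :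
    domLens.act (backOp (ZMod 2) 0) (Finsupp.single g 1) = Finsupp.single (g.setDom E) 1 := by
  rw [back_sum, Fintype.sum_eq_single p, if_pos hp, remB_of hE, lmapDomain_single_one]
  intro q hq
  split_ifs with hq'
  · rw [remB_eq_zero, map_zero]
    exact fun F hF => hq (h q hq' hF.le_right)
  · rfl

/-- The front terms, if there are two. -/
lemma front_two {g : CDPGen n} {p q : Fin n × Fin n} {E F : PosDomain n} (hne : p ≠ q)
    (hp : IsEmptyRect g.dom.src p.1 p.2) (hE : IsComp (rect g.dom.src p.1 p.2) E g.dom)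
    (hq : IsEmptyRect g.dom.src q.1 q.2) (hF : IsComp (rect g.dom.src q.1 q.2) F g.dom)
    (h : ∀ t : Fin n × Fin n, IsEmptyRect g.dom.src t.1 t.2 →
      (∀ c r, rectCoeff g.dom.src t.1 t.2 c r ≤ g.dom.coeff c r) → t = p ∨ t = q) :
    domLens.act (frontOp (ZMod 2) 0) (Finsupp.single g 1) =
      Finsupp.single (g.setDom E) 1 + Finsupp.single (g.setDom F) 1 := by
  rw [front_sum, Fintype.sum_eq_add p q hne, if_pos hp, if_pos hq, remF_of hE, remF_of hF,
    lmapDomain_single_one, lmapDomain_single_one]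
  intro t ht
  split_ifs with ht'
  · rw [remF_eq_zero, map_zero]
    intro F hF
    rcases h t ht' hF.le_left with h1 | h1
    exacts [ht.1 h1, ht.2 h1]
  · rfl

lemma back_two {g : CDPGen n} {p q : Fin n × Fin n} {E F : PosDomain n} (hne : p ≠ q)
    (hp : IsEmptyRect (g.dom.tgt * Equiv.swap p.1 p.2) p.1 p.2)
    (hE : IsComp E (rectTo g.dom.tgt p) g.dom)
    (hq : IsEmptyRect (g.dom.tgt * Equiv.swap q.1 q.2) q.1 q.2)
    (hF : IsComp F (rectTo g.dom.tgt q) g.dom)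
    (h : ∀ t : Fin n × Fin n, IsEmptyRect (g.dom.tgt * Equiv.swap t.1 t.2) t.1 t.2 →
      (∀ c r, rectCoeff (g.dom.tgt * Equiv.swap t.1 t.2) t.1 t.2 c r ≤ g.dom.coeff c r) →
      t = p ∨ t = q) :
    domLens.act (backOp (ZMod 2) 0) (Finsupp.single g 1) =
      Finsupp.single (g.setDom E) 1 + Finsupp.single (g.setDom F) 1 := by
  rw [back_sum, Fintype.sum_eq_add p q hne, if_pos hp, if_pos hq, remB_of hE, remB_of hF,
    lmapDomain_single_one, lmapDomain_single_one]
  intro t ht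
  split_ifs with ht'
  · rw [remB_eq_zero, map_zero]
    intro F hF
    rcases h t ht' hF.le_right with h1 | h1
    exacts [ht.1 h1, ht.2 h1]
  · rfl

/-- The terms which involve an empty partition. -/
lemma markOp_of_nil {g : CDPGen n} {j : Fin n} {E : PosDomain n} (hE : g.dom = E)
    (h : g.part j = []) :
    markOp (ZMod 2) G 0 j (Finsupp.single g 1) =
      Finsupp.lmapDomain (ZMod 2) (ZMod 2) (fun D => (g.setDom D).setPart j [1])
        (remB (ZMod 2) E (colAnnulus E.tgt (G.oCol j)) +
          remB (ZMod 2) E (rowAnnulus E.tgt (G.oRow j))) := by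
  subst hE
  have h0 : (partLens j).act (redOp (ZMod 2) ((0 : Fin n → ZMod 2) j)) (Finsupp.single g 1) = 0 := by
    rw [Lens.act_single]
    change Finsupp.lmapDomain (ZMod 2) (ZMod 2) _ (redOp (ZMod 2) _ (Finsupp.single (g.part j) 1)) = 0
    rw [h, redOp_apply, shrinkOp_nil, headOp_nil, add_zero, map_zero]
  have h1 : (partLens j).act (insOp (ZMod 2)) ∘ₗ Finsupp.lmapDomain (ZMod 2) (ZMod 2) g.setDom =
      Finsupp.lmapDomain (ZMod 2) (ZMod 2) (fun D => (g.setDom D).setPart j [1]) := by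
    refine Finsupp.lhom_ext' fun D => LinearMap.ext_ring ?_
    change (partLens j).act (insOp (ZMod 2))
      (Finsupp.lmapDomain (ZMod 2) (ZMod 2) g.setDom (Finsupp.single D 1)) =
      Finsupp.lmapDomain (ZMod 2) (ZMod 2) _ (Finsupp.single D 1)
    rw [lmapDomain_single_one, lmapDomain_single_one, insOp_act_setDom, h]
    simp [unitEnlarge]
  rw [markOp, LinearMap.add_apply, h0, zero_add, ← h1, Module.End.mul_apply, LinearMap.comp_apply]
  congr 1
  rw [Lens.act_single]
  change Finsupp.lmapDomain (ZMod 2) (ZMod 2) g.setDom (annOp (ZMod 2) G j (Finsupp.single g.dom 1)) = _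
  rw [annOp, LinearMap.add_apply, LinearMap.smul_apply, show (-1 : ZMod 2) = 1 from rfl, one_smul,
    periodicOp, periodicOp, lift_single_one, lift_single_one]

lemma ev_single (g : CDPGen n) :
    Finsupp.linearCombination (ZMod 2) s (Finsupp.single g 1) = s g := by
  rw [Finsupp.linearCombination_single, one_smul]

lemma remB_colAnnulus_eq_zero {A : Type} [CommRing A] {D : PosDomain n} {c : Fin n}
    (h : ∃ r, D.coeff c r = 0) (x : Equiv.Perm (Fin n)) : remB A D (colAnnulus x c) = 0 := by
  refine remB_eq_zero fun E hE => ?_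
  obtain ⟨r, hr⟩ := h
  have := hE.le_right c r
  simp [colAnnulus, hr] at this

lemma remB_rowAnnulus_eq_zero {A : Type} [CommRing A] {D : PosDomain n} {r : Fin n}
    (h : ∃ c, D.coeff c r = 0) (x : Equiv.Perm (Fin n)) : remB A D (rowAnnulus x r) = 0 := by
  refine remB_eq_zero fun E hE => ?_
  obtain ⟨c, hr⟩ := h
  have := hE.le_right c r
  simp [rowAnnulus, hr] at this

/-- This is `square` evaluated: the two front and the two back terms are the four rectangles of the
decompositions. As every row and column contains a square of multiplicity `0`, no annulus splits
off. -/
lemma signs_of_twoDecomp (hs : IsSignAssignment G s) {x : Equiv.Perm (Fin n)}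
    {p q p' q' : Fin n × Fin n} (hv : ValidPair x p q) (hv' : ValidPair x p' q')
    (hD : pairDom x p' q' = pairDom x p q) (hp : p ≠ p') (hq : q ≠ q')
    (hF : FrontSpec x p.1 p.2 q.1 q.2 p'.1 p'.2) (hB : BackSpec x p.1 p.2 q.1 q.2 q'.1 q'.2)
    (hcol : ∀ c, ∃ r, (pairDom x p q).coeff c r = 0)
    (hrow : ∀ r, ∃ c, (pairDom x p q).coeff c r = 0) :
    (s (ofDom (rect x p.1 p.2)) + s (ofDom (rect (x * Equiv.swap p.1 p.2) q.1 q.2))) +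
      (s (ofDom (rect x p'.1 p'.2)) + s (ofDom (rect (x * Equiv.swap p'.1 p'.2) q'.1 q'.2))) = 1 := by
  have h := hs.square (pairDom x p q) (maslov_pairDom hv)
    (fun y c hy => by
      obtain ⟨r, hr⟩ := hcol c
      rw [hy] at hr
      simp [colAnnulus] at hr)
    (fun y r hy => by
      obtain ⟨c, hc⟩ := hrow r
      rw [hy] at hc
      simp [rowAnnulus] at hc)
  have ht : (pairDom x p q).tgt * Equiv.swap q.1 q.2 = x * Equiv.swap p.1 p.2 :=
    Equiv.mul_swap_mul_self _ _ _
  have ht' : (pairDom x p q).tgt * Equiv.swap q'.1 q'.2 = x * Equiv.swap p'.1 p'.2 := by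
    rw [← hD]
    exact Equiv.mul_swap_mul_self _ _ _
  have hC := isComp_pairDom x p' q'
  rw [hD] at hC
  rw [coboundary_eq, front_two (g := ofDom (pairDom x p q)) hp hv.1 (isComp_pairDom x p q) hv'.1 hC,
    back_two (g := ofDom (pairDom x p q)) (p := q) (q := q') (E := rect x p.1 p.2)
      (F := rect x p'.1 p'.2) hq] at h
  rotate_left
  · change IsEmptyRect ((pairDom x p q).tgt * _) _ _
    rw [ht]
    exact hv.2
  · change IsComp _ (rect ((pairDom x p q).tgt * _) _ _) (pairDom x p q)
    rw [ht]
    exact isComp_pairDom x p q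
  · change IsEmptyRect ((pairDom x p q).tgt * _) _ _
    rw [ht']
    exact hv'.2
  · change IsComp _ (rect ((pairDom x p q).tgt * _) _ _) (pairDom x p q)
    rw [ht']
    exact hC
  · intro t h1 h2
    exact (hB t.1 t.2 h1 h2).imp (fun h => Prod.ext h.1 h.2) (fun h => Prod.ext h.1 h.2)
  · intro t h1 h2
    exact (hF t.1 t.2 h1 h2).imp (fun h => Prod.ext h.1 h.2) (fun h => Prod.ext h.1 h.2)
  rw [Finset.sum_eq_zero, map_add, map_add, ev_single, ev_single, ev_single, ev_single] at h
  · rw [← h]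
    simp only [ofDom, setDom]
    abel
  · intro j _
    rw [markOp_of_nil (E := pairDom x p q) rfl rfl, remB_colAnnulus_eq_zero (hcol _), remB_rowAnnulus_eq_zero (hrow _),
      add_zero, map_zero, map_zero]

lemma eq_of_rectCoeff_le_col {x : Equiv.Perm (Fin n)} {D : Fin n → Fin n → ℕ} {c : Fin n}
    (hD : ∀ c' r, c' ≠ c → D c' r = 0) {p : Fin n × Fin n} (hp : IsEmptyRect x p.1 p.2)
    (hle : ∀ c r, rectCoeff x p.1 p.2 c r ≤ D c r) : p = (c, c + 1) := by
  have key : ∀ k, InCyc p.1 p.2 k → k = c := by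
    intro k hk
    by_contra hkc
    have h1 := hle k (x p.1)
    rw [hD k _ hkc, Nat.le_zero, rectCoeff_eq_zero_iff] at h1
    exact h1 ⟨hk, inCyc_left (x.injective.ne hp.1)⟩
  have h1 := key _ (inCyc_left hp.1)
  have h2 := eq_add_one_of_inCyc hp.1 fun k hk => (key k hk).trans h1.symm
  rw [h1] at h2
  exact Prod.ext h1 h2

lemma eq_of_rectCoeff_le_row {x : Equiv.Perm (Fin n)} {D : Fin n → Fin n → ℕ} {r : Fin n}
    (hD : ∀ c r', r' ≠ r → D c r' = 0) {p : Fin n × Fin n} (hp : IsEmptyRect x p.1 p.2)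
    (hle : ∀ c r, rectCoeff x p.1 p.2 c r ≤ D c r) : x p.1 = r ∧ x p.2 = r + 1 := by
  have key : ∀ k, InCyc (x p.1) (x p.2) k → k = r := by
    intro k hk
    by_contra hkc
    have h1 := hle p.1 k
    rw [hD _ k hkc, Nat.le_zero, rectCoeff_eq_zero_iff] at h1
    exact h1 ⟨inCyc_left hp.1, hk⟩
  have h1 := key _ (inCyc_left (x.injective.ne hp.1))
  have h2 := eq_add_one_of_inCyc (x.injective.ne hp.1) fun k hk => (key k hk).trans h1.symm
  rw [h1] at h2
  exact ⟨h1, h2⟩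

lemma pairDom_vertical (hn : 2 ≤ n) (x : Equiv.Perm (Fin n)) (c : Fin n) :
    pairDom x (c, c + 1) (c, c + 1) = colAnnulus x c := by
  refine PosDomain.ext rfl (Equiv.mul_swap_mul_self _ _ _) ?_
  funext c' r
  refine (pairCoeff_vertical (add_one_ne hn c) c' r).trans ?_
  simp only [inCyc_add_one_iff hn]
  rfl

lemma pairDom_horizontal (hn : 2 ≤ n) (x : Equiv.Perm (Fin n)) {i j : Fin n} (h : x j = x i + 1) :
    pairDom x (i, j) (j, i) = rowAnnulus x (x i) := by
  have hij : i ≠ j := fun hij => add_one_ne hn (x i) (by rw [← h, hij])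
  refine PosDomain.ext rfl ?_ ?_
  · change x * Equiv.swap i j * Equiv.swap j i = x
    rw [Equiv.swap_comm j i, Equiv.mul_swap_mul_self]
  · funext c r
    refine (pairCoeff_horizontal hij c r).trans ?_
    simp only [h, inCyc_add_one_iff hn]
    rfl

lemma isComp_const_left (K : PosDomain n) : IsComp (const K.src) K K :=
  ⟨rfl, rfl, rfl, fun _ _ => (Nat.zero_add _).symm⟩

lemma exists_ne_fin (hn : 2 ≤ n) (c : Fin n) : ∃ c', c' ≠ c := ⟨c + 1, (add_one_ne hn c).symm⟩

/-- Inside a single column only one rectangle fits at each end, so the coboundary of the annulus has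
three terms: these two rectangles and the bubble that the marking in the column produces. -/
lemma signs_of_vertical (hs : IsSignAssignment G s) (hn : 2 ≤ n) (x : Equiv.Perm (Fin n))
    (j : Fin n) {c : Fin n} (hc : G.oCol j = c) :
    s (ofDom (rect x c (c + 1))) + s (ofDom (rect (x * Equiv.swap c (c + 1)) c (c + 1))) +
      s (CDPGen.single (const x) j 1) = 1 := by
  have h := hs.vertical x c
  have hC := isComp_pairDom x (c, c + 1) (c, c + 1)
  rw [pairDom_vertical hn] at hC
  have hD : ∀ c' r, c' ≠ c → (colAnnulus x c).coeff c' r = 0 := fun c' r h => by simp [colAnnulus, h]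
  rw [coboundary_eq, front_unique (g := ofDom (colAnnulus x c)) (p := (c, c + 1)) (isEmptyRect_col hn x c) hC
      (fun q h1 h2 => eq_of_rectCoeff_le_col hD h1 h2),
    back_unique (g := ofDom (colAnnulus x c)) (p := (c, c + 1)) (E := rect x c (c + 1))
      (isEmptyRect_col hn _ c) hC (fun q h1 h2 => eq_of_rectCoeff_le_col hD h1 h2), ev_single,
    ev_single, Fintype.sum_eq_single j, markOp_of_nil (E := colAnnulus x c) rfl rfl, remB_rowAnnulus_eq_zero, add_zero, hc] at h
  · have hcol : remB (ZMod 2) (colAnnulus x c) (colAnnulus x c) =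
        Finsupp.single (const x) 1 := remB_of (isComp_const_left (colAnnulus x c))
    change _ + _ + Finsupp.linearCombination (ZMod 2) s (Finsupp.lmapDomain (ZMod 2) (ZMod 2) _
      (remB (ZMod 2) (colAnnulus x c) (colAnnulus x c))) = 1 at h
    rw [hcol, lmapDomain_single_one, ev_single] at h
    rw [← h, add_comm (s _) (s _)]
    rfl
  · obtain ⟨c', hc'⟩ := exists_ne_fin hn c
    exact ⟨c', hD _ _ hc'⟩
  · intro j' hj'
    rw [markOp_of_nil (E := colAnnulus x c) rfl rfl, remB_colAnnulus_eq_zero, remB_rowAnnulus_eq_zero, add_zero, map_zero,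
      map_zero]
    · obtain ⟨c', hc'⟩ := exists_ne_fin hn c
      exact ⟨c', hD _ _ hc'⟩
    · exact ⟨0, hD _ _ fun h => hj' (G.oCol.injective (h.trans hc.symm))⟩

lemma signs_of_horizontal (hs : IsSignAssignment G s) (hn : 2 ≤ n) (x : Equiv.Perm (Fin n))
    (j : Fin n) {a b : Fin n} (hc : G.oRow j = x a) (hab : x b = x a + 1) :
    s (ofDom (rect x a b)) + s (ofDom (rect (x * Equiv.swap a b) b a)) +
      s (CDPGen.single (const x) j 1) = 0 := by
  have h := hs.horizontal x (x a)
  have hC := isComp_pairDom x (a, b) (b, a)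
  rw [pairDom_horizontal hn x hab] at hC
  have hD : ∀ c r, r ≠ x a → (rowAnnulus x (x a)).coeff c r = 0 :=
    fun c r h => by simp [rowAnnulus, h]
  have hsw : x * Equiv.swap b a = x * Equiv.swap a b := by rw [Equiv.swap_comm]
  rw [coboundary_eq, front_unique (g := ofDom (rowAnnulus x (x a))) (p := (a, b))
      (isEmptyRect_row hn x hab) hC (fun q h1 h2 => ?_),
    back_unique (g := ofDom (rowAnnulus x (x a))) (p := (b, a)) (E := rect x a b)
      (isEmptyRect_row hn _ ?_) ?_ (fun q h1 h2 => ?_), ev_single,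
    ev_single, Fintype.sum_eq_single j, markOp_of_nil (E := rowAnnulus x (x a)) rfl rfl, remB_colAnnulus_eq_zero, zero_add, hc] at h
  · have hrow : remB (ZMod 2) (rowAnnulus x (x a)) (rowAnnulus x (x a)) =
        Finsupp.single (const x) 1 := remB_of (isComp_const_left (rowAnnulus x (x a)))
    change _ + _ + Finsupp.linearCombination (ZMod 2) s (Finsupp.lmapDomain (ZMod 2) (ZMod 2) _
      (remB (ZMod 2) (rowAnnulus x (x a)) (rowAnnulus x (x a)))) = 0 at h
    rw [hrow, lmapDomain_single_one, ev_single] at h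
    rw [← h, add_comm (s _) (s _)]
    rfl
  · obtain ⟨c', hc'⟩ := exists_ne_fin hn (x a)
    exact ⟨c', hD _ _ hc'⟩
  · intro j' hj'
    rw [markOp_of_nil (E := rowAnnulus x (x a)) rfl rfl, remB_colAnnulus_eq_zero, remB_rowAnnulus_eq_zero, add_zero, map_zero,
      map_zero]
    · exact ⟨0, hD _ _ fun h => hj' (G.oRow.injective (h.trans hc.symm))⟩
    · obtain ⟨c', hc'⟩ := exists_ne_fin hn (x a)
      exact ⟨c', hD _ _ hc'⟩
  · change (x * Equiv.swap b a) a = (x * Equiv.swap b a) b + 1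
    simp [hab]
  · change IsComp _ (rect (x * Equiv.swap b a) b a) _
    rw [hsw]
    exact hC
  · have := eq_of_rectCoeff_le_row hD h1 h2
    simp only [Equiv.Perm.mul_apply, Equiv.swap_apply_left, Equiv.swap_apply_right] at this
    refine Prod.ext (x.injective (this.2.trans hab.symm)) (x.injective this.1)
  · have := eq_of_rectCoeff_le_row hD h1 h2
    exact Prod.ext (x.injective this.1) (x.injective (this.2.trans hab.symm))

end Cochain

/-! ### The bubble signs do not depend on the generator -/

section Bubble

variable {G : GridDiagram n} {s : CDPGen n → ZMod 2}

/-- A rectangle contains no full row or column, so nothing of type II occurs, and the initial and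
the final reduction of `(1)` cancel modulo `2`. -/
lemma markOp_single_rect (x : Equiv.Perm (Fin n)) (c j i : Fin n) :
    Finsupp.linearCombination (ZMod 2) s
      (markOp (ZMod 2) G 0 i (Finsupp.single (CDPGen.single (rect x c (c + 1)) j 1) 1)) = 0 := by
  have hcol : ∀ c', ∃ r, (rect x c (c + 1)).coeff c' r = 0 := by
    refine fun c' => ⟨x (c + 1), rectCoeff_eq_zero_iff.mpr fun h => ?_⟩
    exact not_inCyc_right _ _ h.2
  have hrow : ∀ r, ∃ c', (rect x c (c + 1)).coeff c' r = 0 := by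
    refine fun r => ⟨c + 1, rectCoeff_eq_zero_iff.mpr fun h => ?_⟩
    exact not_inCyc_right _ _ h.1
  have hann : annOp (ZMod 2) G i (Finsupp.single (rect x c (c + 1)) 1) = 0 := by
    rw [annOp, LinearMap.add_apply, LinearMap.smul_apply, periodicOp, periodicOp, lift_single_one,
      lift_single_one, remB_colAnnulus_eq_zero (hcol _), remB_rowAnnulus_eq_zero (hrow _), smul_zero,
      add_zero]
  have hdom : domLens.act (annOp (ZMod 2) G i)
      (Finsupp.single (CDPGen.single (rect x c (c + 1)) j 1) 1) = 0 := by
    rw [Lens.act_single]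
    change Finsupp.lmapDomain (ZMod 2) (ZMod 2) _
      (annOp (ZMod 2) G i (Finsupp.single (rect x c (c + 1)) 1)) = 0
    rw [hann, map_zero]
  rw [markOp, LinearMap.add_apply, Module.End.mul_apply, hdom, map_zero, add_zero, Lens.act_single]
  change Finsupp.linearCombination (ZMod 2) s (Finsupp.lmapDomain (ZMod 2) (ZMod 2) _
    (redOp (ZMod 2) 0 (Finsupp.single (Function.update (fun _ => []) j [1] i) 1))) = 0
  have hred : redOp (ZMod 2) 0 (Finsupp.single (Function.update (fun _ => []) j [1] i) 1) = 0 := by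
    by_cases hij : i = j
    · subst hij
      rw [Function.update_self, ← consOp_single, redOp_apply, shrinkOp_cons, headOp_cons, addOp_nil,
        shrinkOp_nil, nilOp_nil]
      simp
    · rw [Function.update_of_ne hij, redOp_apply, shrinkOp_nil, headOp_nil, add_zero]
  rw [hred, map_zero, map_zero]

/-- For a rectangle of width one, the condition `rect` of the sign assignment reduces to the two
terms that leave a constant domain, at the two ends of the rectangle. -/
lemma bubble_swap (hs : IsSignAssignment G s) (hn : 2 ≤ n) (x : Equiv.Perm (Fin n)) (c j : Fin n) :
    s (CDPGen.single (const (x * Equiv.swap c (c + 1))) j 1) = s (CDPGen.single (const x) j 1) := by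
  have h := hs.rect (rect x c (c + 1)) j 1 ⟨x, c, c + 1, isEmptyRect_col hn x c, rfl⟩
  have hD : ∀ c' r, c' ≠ c → (rect x c (c + 1)).coeff c' r = 0 := fun c' r h =>
    rectCoeff_eq_zero_iff.mpr fun h' => h ((inCyc_add_one_iff hn).mp h'.1)
  have hsw : x * Equiv.swap c (c + 1) * Equiv.swap c (c + 1) = x := Equiv.mul_swap_mul_self _ _ _
  have hbk : rectTo (x * Equiv.swap c (c + 1)) (c, c + 1) = rect x c (c + 1) := by
    change rect (x * Equiv.swap c (c + 1) * Equiv.swap c (c + 1)) c (c + 1) = _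
    rw [hsw]
  rw [coboundary_eq, front_unique (g := CDPGen.single (rect x c (c + 1)) j 1) (p := (c, c + 1))
      (E := const (x * Equiv.swap c (c + 1))) (isEmptyRect_col hn x c)
      ⟨rfl, rfl, rfl, fun _ _ => (Nat.add_zero _).symm⟩
      (fun q h1 h2 => eq_of_rectCoeff_le_col hD h1 h2),
    back_unique (g := CDPGen.single (rect x c (c + 1)) j 1) (p := (c, c + 1)) (E := const x)
      (isEmptyRect_col hn _ c) ?_ (fun q h1 h2 => eq_of_rectCoeff_le_col hD h1 h2), ev_single,
    ev_single, Finset.sum_eq_zero fun i _ => markOp_single_rect x c j i, add_zero] at h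
  · have h2 := eq_neg_of_add_eq_zero_left h
    rw [CharTwo.neg_eq] at h2
    exact h2
  · change IsComp _ (rectTo (x * Equiv.swap c (c + 1)) (c, c + 1)) (rect x c (c + 1))
    rw [hbk]
    exact isComp_const_left (rect x c (c + 1))

/-- Adjacent transpositions generate the symmetric group already as a monoid, so no inverses are
needed. -/
lemma perm_induction_swap {f : Equiv.Perm (Fin n) → ZMod 2}
    (h : ∀ x (c : Fin n), f (x * Equiv.swap c (c + 1)) = f x) (x : Equiv.Perm (Fin n)) :
    f x = f 1 := by
  obtain ⟨m, rfl⟩ : ∃ m, n = m + 1 := ⟨n - 1, (Nat.succ_pred_eq_of_pos (NeZero.pos n)).symm⟩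
  have key : ∀ y ∈ Submonoid.closure (Set.range fun i : Fin m ↦ Equiv.swap i.castSucc i.succ),
      ∀ x, f (x * y) = f x := by
    intro y hy
    induction hy using Submonoid.closure_induction with
    | mem y hy =>
      obtain ⟨i, rfl⟩ := hy
      intro x
      have := h x i.castSucc
      rwa [show i.castSucc + 1 = i.succ by simp] at this
    | one => simp
    | mul y z _ _ hy hz =>
      intro x
      rw [← mul_assoc, hz, hy]
  rw [Equiv.Perm.mclosure_swap_castSucc_succ] at key
  have := key x trivial 1
  rwa [one_mul] at this

lemma bubble_eq (hs : IsSignAssignment G s) (hn : 2 ≤ n) (x : Equiv.Perm (Fin n)) (j : Fin n) :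
    s (CDPGen.single (const x) j 1) = bubbleSign s j :=
  perm_induction_swap (f := fun x => s (CDPGen.single (const x) j 1))
    (fun x c => bubble_swap hs hn x c j) x

end Bubble

/-! ## The squares of the rectangle operators -/

section Square

variable {A : Type} [CommRing A]

lemma sgn_mul_self (t : ZMod 2) : sgn A t * sgn A t = 1 := by
  rw [← sgn_add, CharTwo.add_self_eq_zero, sgn, ZMod.val_zero, pow_zero]

lemma sgn_add_one (t : ZMod 2) : sgn A (t + 1) = -sgn A t := by
  rw [sgn_add]
  simp [sgn, ZMod.val_one]

variable (A)

/-- The sign of a pair of rectangles. -/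
def pairSign (s : CDPGen n → ZMod 2) (x : Equiv.Perm (Fin n)) (p q : Fin n × Fin n) : A :=
  sgn A (s (ofDom (rect x p.1 p.2)) + s (ofDom (rect (x * Equiv.swap p.1 p.2) q.1 q.2)))

variable {A}

/-- The rectangles of the pair do not have the same corners. -/
def Generic (p q : Fin n × Fin n) : Prop := q ≠ p ∧ q ≠ p.swap

instance (p q : Fin n × Fin n) : Decidable (Generic p q) := inferInstanceAs (Decidable (_ ∧ _))

/-- Two rectangles with the same corners add up to full columns or to full rows. -/
lemma generic_of_zeros {x : Equiv.Perm (Fin n)} {p q : Fin n × Fin n} (hp : p.1 ≠ p.2)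
    (hcol : ∀ c, ∃ r, pairCoeff x p.1 p.2 q.1 q.2 c r = 0)
    (hrow : ∀ r, ∃ c, pairCoeff x p.1 p.2 q.1 q.2 c r = 0) : Generic p q := by
  constructor
  · rintro rfl
    obtain ⟨r, hr⟩ := hcol q.1
    rw [pairCoeff_vertical hp, if_pos (inCyc_left hp)] at hr
    exact one_ne_zero hr
  · rintro rfl
    obtain ⟨c, hc⟩ := hrow (x p.1)
    rw [Prod.fst_swap, Prod.snd_swap, pairCoeff_horizontal hp,
      if_pos (inCyc_left (x.injective.ne hp))] at hc
    exact one_ne_zero hc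

/-- A second decomposition of the domain of a pair. -/
structure Partner (x : Equiv.Perm (Fin n)) (p q p' q' : Fin n × Fin n) : Prop where
  valid : ValidPair x p' q'
  generic : Generic p' q'
  dom : pairDom x p' q' = pairDom x p q
  front_ne : p ≠ p'
  back_ne : q ≠ q'
  front : FrontSpec x p.1 p.2 q.1 q.2 p'.1 p'.2
  back : BackSpec x p.1 p.2 q.1 q.2 q'.1 q'.2
  col : ∀ c, ∃ r, pairCoeff x p.1 p.2 q.1 q.2 c r = 0
  row : ∀ r, ∃ c, pairCoeff x p.1 p.2 q.1 q.2 c r = 0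

lemma exists_partner {x : Equiv.Perm (Fin n)} {p q : Fin n × Fin n} (hv : ValidPair x p q)
    (hg : Generic p q) : ∃ p' q', Partner x p q p' q' := by
  obtain ⟨⟨i, j, k, l, ⟨hv', ht, hc⟩, h1, h2, hF, hB⟩, hcol, hrow⟩ :=
    twoDecomp x p.1 p.2 q.1 q.2 hv.1 hv.2 (fun h => hg.1 (Prod.ext h.1 h.2))
      (fun h => hg.2 (Prod.ext h.1 h.2))
  refine ⟨(i, j), (k, l), hv', generic_of_zeros (x := x) hv'.1.1 (fun c => ?_) (fun r => ?_),
    PosDomain.ext rfl (Equiv.ext fun c => ht c) (funext fun c => funext fun r => hc c r),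
    fun h => h1 ⟨(congrArg Prod.fst h).symm, (congrArg Prod.snd h).symm⟩,
    fun h => h2 ⟨(congrArg Prod.fst h).symm, (congrArg Prod.snd h).symm⟩, hF, hB, hcol, hrow⟩
  · obtain ⟨r, hr⟩ := hcol c
    exact ⟨r, (hc c r).trans hr⟩
  · obtain ⟨c, hr⟩ := hrow r
    exact ⟨c, (hc c r).trans hr⟩

/-- Only two rectangles can be split off at each end. The partner of a partner differs from the
partner, so it is the original pair and the pairing is an involution. -/
lemma Partner.eq {x : Equiv.Perm (Fin n)} {p q p₁ q₁ p₂ q₂ : Fin n × Fin n}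
    (h1 : Partner x p q p₁ q₁) (h2 : Partner x p₁ q₁ p₂ q₂) : p₂ = p ∧ q₂ = q := by
  have hD := h2.dom.trans h1.dom
  have hC := isComp_pairDom x p₂ q₂
  rw [hD] at hC
  have ht : (pairDom x p q).tgt * Equiv.swap q₂.1 q₂.2 = x * Equiv.swap p₂.1 p₂.2 := by
    rw [← hD]
    exact Equiv.mul_swap_mul_self _ _ _
  constructor
  · rcases h1.front p₂.1 p₂.2 h2.valid.1 hC.le_left with h | h
    · exact Prod.ext h.1 h.2
    · exact absurd (Prod.ext h.1 h.2 : p₂ = p₁).symm h2.front_ne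
  · have hb := h1.back q₂.1 q₂.2
    change IsEmptyRect ((pairDom x p q).tgt * _) _ _ →
      (∀ c r, rectCoeff ((pairDom x p q).tgt * _) _ _ c r ≤ _) → _ at hb
    rw [ht] at hb
    rcases hb h2.valid.2 hC.le_right with h | h
    · exact Prod.ext h.1 h.2
    · exact absurd (Prod.ext h.1 h.2 : q₂ = q₁).symm h2.back_ne

variable {G : GridDiagram n} {s : CDPGen n → ZMod 2}

lemma Partner.sign (hs : IsSignAssignment G s) {x : Equiv.Perm (Fin n)} {p q p' q' : Fin n × Fin n}
    (hv : ValidPair x p q) (h : Partner x p q p' q') :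
    pairSign A s x p q + pairSign A s x p' q' = 0 := by
  have := signs_of_twoDecomp hs hv h.valid h.dom h.front_ne h.back_ne h.front h.back h.col h.row
  rw [pairSign, pairSign]
  generalize s _ + s _ = a at *
  generalize s _ + s _ = b at *
  have hb : b = a + 1 := by
    rw [← this, ← add_assoc, CharTwo.add_self_eq_zero, zero_add]
  rw [hb, sgn_add_one, add_neg_cancel]

/-- The contributions of the pairs with different corners cancel. -/
lemma sum_generic (hs : IsSignAssignment G s) (x : Equiv.Perm (Fin n)) {M : Type} [AddCommGroup M]
    [Module A M] (f : PosDomain n → M) :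
    ∑ t : (Fin n × Fin n) × (Fin n × Fin n),
      (if ValidPair x t.1 t.2 ∧ Generic t.1 t.2 then
        pairSign A s x t.1 t.2 • f (pairDom x t.1 t.2) else 0) = 0 := by
  classical
  rw [← Finset.sum_filter]
  have hex : ∀ t ∈ Finset.univ.filter fun t : (Fin n × Fin n) × (Fin n × Fin n) =>
      ValidPair x t.1 t.2 ∧ Generic t.1 t.2, ∃ t' : (Fin n × Fin n) × (Fin n × Fin n),
      Partner x t.1 t.2 t'.1 t'.2 := by
    intro t ht
    obtain ⟨p', q', h⟩ := exists_partner (Finset.mem_filter.mp ht).2.1 (Finset.mem_filter.mp ht).2.2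
    exact ⟨(p', q'), h⟩
  choose g hg using hex
  refine Finset.sum_involution g (fun t ht => ?_) (fun t ht _ h => ?_) (fun t ht => ?_)
    (fun t ht => ?_)
  · rw [(hg t ht).dom, ← add_smul, (hg t ht).sign hs (Finset.mem_filter.mp ht).2.1, zero_smul]
  · exact (hg t ht).front_ne (congrArg Prod.fst h).symm
  · exact Finset.mem_filter.mpr ⟨Finset.mem_univ _, (hg t ht).valid, (hg t ht).generic⟩
  · have := (hg t ht).eq (hg (g t ht)
      (Finset.mem_filter.mpr ⟨Finset.mem_univ _, (hg t ht).valid, (hg t ht).generic⟩))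
    exact Prod.ext this.1 this.2

lemma pairSign_vertical (hs : IsSignAssignment G s) (hn : 2 ≤ n) (x : Equiv.Perm (Fin n)) (j : Fin n) :
    pairSign A s x (G.oCol j, G.oCol j + 1) (G.oCol j, G.oCol j + 1) = -sgn A (bubbleSign s j) := by
  have h := signs_of_vertical hs hn x j rfl
  rw [bubble_eq hs hn] at h
  rw [pairSign, ← sgn_add_one, ← h, add_left_comm, CharTwo.add_self_eq_zero, add_zero]

lemma pairSign_horizontal (hs : IsSignAssignment G s) (hn : 2 ≤ n) (x : Equiv.Perm (Fin n))
    (j : Fin n) {a b : Fin n} (hc : G.oRow j = x a) (hab : x b = x a + 1) :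
    pairSign A s x (a, b) (b, a) = sgn A (bubbleSign s j) := by
  have h := signs_of_horizontal hs hn x j hc hab
  rw [bubble_eq hs hn] at h
  have h2 := eq_neg_of_add_eq_zero_left h
  rw [CharTwo.neg_eq] at h2
  rw [pairSign, ← h2]

/-- The contributions of all the pairs of rectangles reduce to those of the annuli. -/
lemma sum_pairs (hs : IsSignAssignment G s) (hn : 2 ≤ n) (x : Equiv.Perm (Fin n)) {M : Type}
    [AddCommGroup M] [Module A M] (f : PosDomain n → M) :
    ∑ p : Fin n × Fin n, ∑ q : Fin n × Fin n,
      (if ValidPair x p q then pairSign A s x p q • f (pairDom x p q) else 0) =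
    ∑ j, -sgn A (bubbleSign s j) • f (colAnnulus x (G.oCol j)) +
      ∑ j, sgn A (bubbleSign s j) • f (rowAnnulus x (G.oRow j)) := by
  rw [← Fintype.sum_prod_type' (f := fun p q =>
    (if ValidPair x p q then pairSign A s x p q • f (pairDom x p q) else 0))]
  refine (sub_eq_self.mpr (sum_generic (A := A) hs x f)).symm.trans ?_
  rw [← Finset.sum_sub_distrib]
  -- The pairs which are not generic make up a single column or row. Each column and each row
  -- contains exactly one `O`, so these pairs are indexed by two copies of the markings.
  let e : Fin n ⊕ Fin n → (Fin n × Fin n) × (Fin n × Fin n) := Sum.elim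
    (fun j => ((G.oCol j, G.oCol j + 1), (G.oCol j, G.oCol j + 1)))
    (fun j => ((x.symm (G.oRow j), x.symm (G.oRow j + 1)),
      (x.symm (G.oRow j + 1), x.symm (G.oRow j))))
  have he : Function.Injective e := by
    rintro (j | j) (k | k) h
    · exact congrArg _ (G.oCol.injective (congrArg (fun t => t.1.1) h))
    · have h1 := congrArg (fun t => t.1.1) h
      have h2 := congrArg (fun t => t.2.1) h
      exact absurd (x.symm.injective (h1.symm.trans h2)) (add_one_ne hn _)
    · have h1 := congrArg (fun t => t.1.1) h
      have h2 := congrArg (fun t => t.2.1) h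
      exact absurd (x.symm.injective (h1.trans h2.symm)) (add_one_ne hn _)
    · exact congrArg _ (G.oRow.injective (x.symm.injective (congrArg (fun t => t.1.1) h)))
  refine Eq.trans ?_ (Fintype.sum_sum_type (Sum.elim
    (fun j => -sgn A (bubbleSign s j) • f (colAnnulus x (G.oCol j)))
    (fun j => sgn A (bubbleSign s j) • f (rowAnnulus x (G.oRow j)))))
  refine (Fintype.sum_of_injective e he _ _ (fun t ht => ?_) ?_).symm
  · by_cases hv : ValidPair x t.1 t.2
    · by_cases hg : Generic t.1 t.2
      · rw [if_pos hv, if_pos ⟨hv, hg⟩, sub_self]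
      · exfalso
        apply ht
        obtain ⟨⟨i, j⟩, ⟨k, l⟩⟩ := t
        rw [Generic, not_and_or, not_ne_iff, not_ne_iff] at hg
        simp only [Prod.swap_prod_mk, Prod.mk.injEq] at hg
        rcases hg with ⟨rfl, rfl⟩ | ⟨rfl, rfl⟩
        · have := vertical_pair hv.1 hv.2
          simp only at this
          subst this
          exact ⟨Sum.inl (G.oCol.symm k), by simp [e]⟩
        · have := horizontal_pair hv.1 hv.2
          simp only at this
          refine ⟨Sum.inr (G.oRow.symm (x l)), ?_⟩
          simp [e, ← this]
    · rw [if_neg hv, if_neg (fun h => hv h.1), sub_self]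
  · rintro (j | j)
    · have hg : ¬ Generic (e (Sum.inl j)).1 (e (Sum.inl j)).2 := fun h => h.1 rfl
      have hv : ValidPair x (e (Sum.inl j)).1 (e (Sum.inl j)).2 :=
        ⟨isEmptyRect_col hn _ _, isEmptyRect_col hn _ _⟩
      rw [if_pos hv, if_neg (fun h => hg h.2), sub_zero]
      · change -sgn A (bubbleSign s j) • f (colAnnulus x (G.oCol j)) =
          pairSign A s x (G.oCol j, G.oCol j + 1) (G.oCol j, G.oCol j + 1) •
            f (pairDom x (G.oCol j, G.oCol j + 1) (G.oCol j, G.oCol j + 1))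
        rw [pairSign_vertical hs hn, pairDom_vertical hn]
    · have hg : ¬ Generic (e (Sum.inr j)).1 (e (Sum.inr j)).2 := fun h => h.2 rfl
      have hab : x (x.symm (G.oRow j + 1)) = x (x.symm (G.oRow j)) + 1 := by simp
      have hv : ValidPair x (e (Sum.inr j)).1 (e (Sum.inr j)).2 := by
        refine ⟨isEmptyRect_row hn _ hab, isEmptyRect_row hn _ ?_⟩
        simp [e]
      rw [if_pos hv, if_neg (fun h => hg h.2), sub_zero]
      · change sgn A (bubbleSign s j) • f (rowAnnulus x (G.oRow j)) =
          pairSign A s x (x.symm (G.oRow j), x.symm (G.oRow j + 1))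
            (x.symm (G.oRow j + 1), x.symm (G.oRow j)) •
            f (pairDom x (x.symm (G.oRow j), x.symm (G.oRow j + 1))
              (x.symm (G.oRow j + 1), x.symm (G.oRow j)))
        rw [pairSign_horizontal hs hn x j (by simp) hab, pairDom_horizontal hn x hab,
          Equiv.apply_symm_apply]

variable (A) in
/-- The signed sum of the operators which split off an annulus. -/
def annuliOp (G : GridDiagram n) (s : CDPGen n → ZMod 2) : Module.End A (PosDomain n →₀ A) :=
  ∑ j, -sgn A (bubbleSign s j) • periodicOp A (fun x => colAnnulus x (G.oCol j)) +
    ∑ j, sgn A (bubbleSign s j) • periodicOp A (fun x => rowAnnulus x (G.oRow j))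

lemma annuliOp_single (D : PosDomain n) : annuliOp A G s (Finsupp.single D 1) =
    ∑ j, -sgn A (bubbleSign s j) • remB A D (colAnnulus D.tgt (G.oCol j)) +
      ∑ j, sgn A (bubbleSign s j) • remB A D (rowAnnulus D.tgt (G.oRow j)) := by
  simp only [annuliOp, LinearMap.add_apply, LinearMap.sum_apply, LinearMap.smul_apply, periodicOp,
    lift_single_one]

lemma frontOp_sq (hs : IsSignAssignment G s) (hn : 2 ≤ n) :
    frontOp A (fun R => s (ofDom R)) * frontOp A (fun R => s (ofDom R)) = annuliOp A G s := by
  refine end_ext fun D => ?_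
  have h := sum_pairs (A := A) hs hn D.src (remF A D)
  simp only [(isPeriodic_col _).remF_eq_remB D, (isPeriodic_row _).remF_eq_remB D] at h
  rw [annuliOp_single, ← h, Module.End.mul_apply]
  nth_rw 2 [frontOp]
  rw [lift_single_one, map_sum]
  refine Finset.sum_congr rfl fun p _ => ?_
  by_cases hp : IsEmptyRect D.src p.1 p.2
  · rw [if_pos hp, map_smul, frontOp_remF, Finset.smul_sum]
    refine Finset.sum_congr rfl fun q _ => ?_
    by_cases hq : IsEmptyRect (D.src * Equiv.swap p.1 p.2) q.1 q.2
    · rw [if_pos (show ValidPair D.src p q from ⟨hp, hq⟩), ← remF_remF (isComp_pairDom D.src p q),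
        pairSign, sgn_add, mul_smul]
      exact congrArg _ (if_pos hq)
    · rw [if_neg (show ¬ ValidPair D.src p q from fun h => hq h.2)]
      exact (congrArg _ (if_neg hq)).trans (smul_zero _)
  · rw [if_neg hp, map_zero]
    refine (Finset.sum_eq_zero fun q _ => ?_).symm
    rw [if_neg fun h => hp h.1]

/-- `sum_pairs` fixes the initial generator, but pairs split off at the back share the final one. So
it is summed over all initial generators, where `remB` annihilates every pair that does not end at
`D.tgt`. -/
lemma backOp_sq (hs : IsSignAssignment G s) (hn : 2 ≤ n) :
    backOp A (fun R => s (ofDom R)) * backOp A (fun R => s (ofDom R)) = annuliOp A G s := by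
  refine end_ext fun D => ?_
  have h := fun x => sum_pairs (A := A) hs hn x (remB A D)
  have hz : ∀ R : PosDomain n, R.tgt ≠ D.tgt → remB A D R = 0 := fun R hR =>
    remB_eq_zero fun E hE => hR hE.tgt.symm
  have h1 := Finset.sum_congr (rfl : (Finset.univ : Finset (Equiv.Perm (Fin n))) = Finset.univ)
    fun x _ => h x
  have h2 : ∑ x, (∑ j, -sgn A (bubbleSign s j) • remB A D (colAnnulus x (G.oCol j)) +
      ∑ j, sgn A (bubbleSign s j) • remB A D (rowAnnulus x (G.oRow j))) =
      annuliOp A G s (Finsupp.single D 1) := by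
    rw [annuliOp_single, Fintype.sum_eq_single D.tgt]
    intro x hx
    rw [Finset.sum_eq_zero, Finset.sum_eq_zero, add_zero]
    · intro j _
      rw [hz _ hx, smul_zero]
    · intro j _
      rw [hz _ hx, smul_zero]
  rw [← h2, ← h1, Finset.sum_comm, Finset.sum_congr rfl fun q _ => Finset.sum_comm, Finset.sum_comm,
    Module.End.mul_apply]
  nth_rw 2 [backOp]
  rw [lift_single_one, map_sum]
  refine Finset.sum_congr rfl fun p _ => ?_
  by_cases hp : IsEmptyRect (D.tgt * Equiv.swap p.1 p.2) p.1 p.2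
  · rw [if_pos hp, map_smul, backOp_remB, Finset.smul_sum]
    refine Finset.sum_congr rfl fun q _ => ?_
    have hy : D.tgt * Equiv.swap p.1 p.2 * Equiv.swap q.1 q.2 * Equiv.swap q.1 q.2 =
      D.tgt * Equiv.swap p.1 p.2 := Equiv.mul_swap_mul_self _ _ _
    rw [Fintype.sum_eq_single (D.tgt * Equiv.swap p.1 p.2 * Equiv.swap q.1 q.2)]
    · by_cases hq : IsEmptyRect (D.tgt * Equiv.swap p.1 p.2 * Equiv.swap q.1 q.2) q.1 q.2
      · have hC := isComp_pairDom (D.tgt * Equiv.swap p.1 p.2 * Equiv.swap q.1 q.2) q p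
        rw [hy] at hC
        have hv : ValidPair (D.tgt * Equiv.swap p.1 p.2 * Equiv.swap q.1 q.2) q p :=
          ⟨hq, by rw [hy]; exact hp⟩
        rw [if_pos hv, ← remB_remB hC, pairSign, hy, add_comm, sgn_add,
          mul_smul]
        exact congrArg _ (if_pos hq)
      · rw [if_neg (show ¬ ValidPair _ q p from fun h => hq h.1)]
        exact (congrArg _ (if_neg hq)).trans (smul_zero _)
    · intro x hx
      split_ifs
      · rw [hz, smul_zero]
        intro ht
        apply hx
        rw [← ht]
        change x = x * Equiv.swap q.1 q.2 * Equiv.swap p.1 p.2 * Equiv.swap p.1 p.2 *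
          Equiv.swap q.1 q.2
        rw [Equiv.mul_swap_mul_self, Equiv.mul_swap_mul_self]
      · rfl
  · rw [if_neg hp, map_zero]
    refine (Finset.sum_eq_zero fun q _ => Finset.sum_eq_zero fun x _ => ?_).symm
    split_ifs with hv
    · rw [hz, smul_zero]
      intro ht
      apply hp
      have h2 := hv.2
      rwa [← ht, show (pairDom x q p).tgt * Equiv.swap p.1 p.2 = x * Equiv.swap q.1 q.2 from
        Equiv.mul_swap_mul_self _ _ _]
    · rfl

end Square

/-! ## Operators which shift a grading -/

section Shift

variable {A : Type} [CommRing A] {C X : Type}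

/-- The operator `T` shifts the grading `d` by `k`. -/
def Shifts (d : C → ℕ) (T : Module.End A (C →₀ A)) (k : ℤ) : Prop :=
  ∀ c, T (Finsupp.single c 1) ∈ Finsupp.supported A A {c' | (d c' : ℤ) = d c + k}

lemma mem_supported_of_single {T : Module.End A (C →₀ A)} {S S' : Set C}
    (h : ∀ c ∈ S, T (Finsupp.single c 1) ∈ Finsupp.supported A A S') {v : C →₀ A}
    (hv : v ∈ Finsupp.supported A A S) : T v ∈ Finsupp.supported A A S' := by
  rw [Finsupp.supported_eq_span_single] at hv
  induction hv using Submodule.span_induction with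
  | mem v hv =>
    obtain ⟨c, hc, rfl⟩ := hv
    exact h c hc
  | zero => rw [map_zero]; exact Submodule.zero_mem _
  | add a b _ _ ha hb => rw [map_add]; exact Submodule.add_mem _ ha hb
  | smul a v _ hv => rw [map_smul]; exact Submodule.smul_mem _ _ hv

lemma single_mem_supported {S : Set C} {c : C} (h : c ∈ S) (a : A) :
    Finsupp.single c a ∈ Finsupp.supported A A S := Finsupp.single_mem_supported A a h

namespace Shifts

variable {d : C → ℕ} {S T : Module.End A (C →₀ A)} {k l : ℤ}

lemma mul (hS : Shifts d S k) (hT : Shifts d T l) : Shifts d (S * T) (k + l) := fun c =>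
  mem_supported_of_single (fun c' hc' => Finsupp.supported_mono (fun c'' hc'' => by
    simp only [Set.mem_ofPred_eq] at hc' hc'' ⊢
    omega) (hS c')) (hT c)

lemma add (hS : Shifts d S k) (hT : Shifts d T k) : Shifts d (S + T) k := fun c =>
  Submodule.add_mem _ (hS c) (hT c)

lemma smul (hS : Shifts d S k) (a : A) : Shifts d (a • S) k := fun c =>
  Submodule.smul_mem _ a (hS c)

lemma sum {ι : Type} {s : Finset ι} {f : ι → Module.End A (C →₀ A)} (h : ∀ i, Shifts d (f i) k) :
    Shifts d (∑ i ∈ s, f i) k := fun c => by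
  rw [LinearMap.sum_apply]
  exact Submodule.sum_mem _ fun i _ => h i c

lemma diag (ε : C → A) : Shifts d (diag ε) 0 := fun c => by
  rw [diag_single]
  exact single_mem_supported (by simp) _

lemma act (φ : Lens C X) {dX : X → ℕ} {T : Module.End A (X →₀ A)} (hT : Shifts dX T k)
    (h : ∀ c x, (d (φ.set c x) : ℤ) + dX (φ.get c) = d c + dX x) : Shifts d (φ.act T) k := by
  intro c
  rw [φ.act_single]
  refine Finsupp.supported_comap_lmapDomain A A (φ.set c) _ (Finsupp.supported_mono ?_ (hT (φ.get c)))
  intro x hx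
  simp only [Set.mem_ofPred_eq, Set.mem_preimage] at hx ⊢
  have := h c x
  omega

lemma act_of_const (φ : Lens C X) (T : Module.End A (X →₀ A)) (h : ∀ c x, d (φ.set c x) = d c) :
    Shifts d (φ.act T) 0 := by
  intro c
  rw [φ.act_single]
  refine Finsupp.supported_comap_lmapDomain A A (φ.set c) _
    (Finsupp.supported_mono ?_ (show _ ∈ Finsupp.supported A A Set.univ by simp))
  intro x _
  simp [h]

lemma diag_apply_of_even {ε : C → A} (hε : ∀ c, ε c = (-1) ^ d c) (hT : Shifts d T k) (hk : Even k)
    (v : C →₀ A) : _root_.diag ε (T v) = T (_root_.diag ε v) := by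
  have : _root_.diag ε * T = T * _root_.diag ε := by
    refine end_ext fun c => ?_
    rw [Module.End.mul_apply, Module.End.mul_apply, diag_single, ← mul_one (ε c), ← smul_eq_mul,
      ← Finsupp.smul_single, map_smul]
    have key : ∀ v ∈ Finsupp.supported A A {c' | (d c' : ℤ) = d c + k}, _root_.diag ε v = ε c • v := by
      intro v hv
      rw [Finsupp.supported_eq_span_single] at hv
      induction hv using Submodule.span_induction with
      | mem v hv =>
        obtain ⟨c', hc', rfl⟩ := hv
        rw [diag_single, Finsupp.smul_single, smul_eq_mul, mul_one, hε, hε, neg_one_pow_congr]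
        have h1 : (d c' : ℤ) = d c + k := hc'
        rw [← Int.even_coe_nat, ← Int.even_coe_nat, h1, Int.even_add]
        simp [hk]
      | zero => simp
      | add a b _ _ ha hb => rw [map_add, ha, hb, smul_add]
      | smul a v _ hv => rw [map_smul, hv, smul_comm]
    exact key _ (hT c)
  exact LinearMap.congr_fun this v

lemma diag_apply_of_odd {ε : C → A} (hε : ∀ c, ε c = (-1) ^ d c) (hT : Shifts d T k) (hk : Odd k)
    (v : C →₀ A) : _root_.diag ε (T v) = -T (_root_.diag ε v) := by
  have : _root_.diag ε * T = -(T * _root_.diag ε) := by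
    refine end_ext fun c => ?_
    rw [LinearMap.neg_apply, Module.End.mul_apply, Module.End.mul_apply, diag_single,
      ← mul_one (ε c), ← smul_eq_mul, ← Finsupp.smul_single, map_smul]
    have key : ∀ v ∈ Finsupp.supported A A {c' | (d c' : ℤ) = d c + k},
        _root_.diag ε v = -(ε c • v) := by
      intro v hv
      rw [Finsupp.supported_eq_span_single] at hv
      induction hv using Submodule.span_induction with
      | mem v hv =>
        obtain ⟨c', hc', rfl⟩ := hv
        have h1 : (d c' : ℤ) = d c + k := hc'
        have h2 : (-1 : A) ^ d c' = (-1) ^ (d c + 1) := by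
          refine neg_one_pow_congr ?_
          rw [← Int.even_coe_nat, ← Int.even_coe_nat, h1, Int.even_add, Nat.cast_succ, Int.even_add]
          have := Int.not_even_iff_odd.mpr hk
          simp [this]
        rw [diag_single, Finsupp.smul_single, smul_eq_mul, mul_one, hε, hε, h2, pow_succ,
          mul_neg_one, Finsupp.single_neg]
      | zero => simp
      | add a b _ _ ha hb => rw [map_add, ha, hb, smul_add, neg_add]
      | smul a v _ hv => rw [map_smul, hv, smul_neg, smul_comm]
    exact key _ (hT c)
  exact LinearMap.congr_fun this v

end Shifts

end Shift

/-! ## The shifts of the operators on domains and on partitions -/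

section

variable {A : Type} [CommRing A]

lemma PosDomain.remF_mem {D R : PosDomain n} {k : ℕ} (h : R.num = 4 * k) :
    remF A D R ∈ Finsupp.supported A A {E | (E.maslov : ℤ) = D.maslov + -k} := by
  by_cases hE : ∃ E, IsComp R E D
  · obtain ⟨E, hE⟩ := hE
    rw [remF_of hE]
    refine single_mem_supported ?_ _
    have := hE.maslov_of_num_left h
    simp only [Set.mem_ofPred_eq]
    omega
  · rw [remF_eq_zero (not_exists.mp hE)]
    exact Submodule.zero_mem _

lemma PosDomain.remB_mem {D R : PosDomain n} {k : ℕ} (h : R.num = 4 * k) :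
    remB A D R ∈ Finsupp.supported A A {E | (E.maslov : ℤ) = D.maslov + -k} := by
  by_cases hE : ∃ E, IsComp E R D
  · obtain ⟨E, hE⟩ := hE
    rw [remB_of hE]
    refine single_mem_supported ?_ _
    have := hE.maslov_of_num_right h
    simp only [Set.mem_ofPred_eq]
    omega
  · rw [remB_eq_zero (not_exists.mp hE)]
    exact Submodule.zero_mem _

lemma shifts_frontOp (sR : PosDomain n → ZMod 2) : Shifts maslov (frontOp A sR) (-1) := by
  intro D
  rw [frontOp, lift_single_one]
  refine Submodule.sum_mem _ fun p _ => ?_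
  split_ifs with hp
  · exact Submodule.smul_mem _ _ (remF_mem (k := 1) (num_rect hp))
  · exact Submodule.zero_mem _

lemma shifts_backOp (sR : PosDomain n → ZMod 2) : Shifts maslov (backOp A sR) (-1) := by
  intro D
  rw [backOp, lift_single_one]
  refine Submodule.sum_mem _ fun p _ => ?_
  split_ifs with hp
  · exact Submodule.smul_mem _ _ (remB_mem (k := 1) (num_rect hp))
  · exact Submodule.zero_mem _

lemma shifts_annOp (G : GridDiagram n) (j : Fin n) : Shifts maslov (annOp A G j) (-2) := by
  refine Shifts.add (fun D => ?_) (Shifts.smul (fun D => ?_) _)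
  · rw [periodicOp, lift_single_one]
    exact remB_mem (k := 2) (num_colAnnulus _ _)
  · rw [periodicOp, lift_single_one]
    exact remB_mem (k := 2) (num_rowAnnulus _ _)

lemma OrdPartition.length_coarsen : ∀ (l : OrdPartition) (p : ℕ), p < l.length - 1 →
    (l.coarsen p).length + 1 = l.length
  | a :: b :: l, 0, _ => rfl
  | a :: b :: l, p + 1, h => by
    have := length_coarsen (b :: l) p (by simp at h ⊢; omega)
    rw [coarsen, List.length_cons, this]
    rfl
  | [a], p, h => absurd h (by simp)
  | [], p, h => absurd h (by simp)

lemma shifts_insOp : Shifts List.length (insOp A) 1 := by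
  intro l
  rw [insOp, lift_single_one]
  refine Submodule.sum_mem _ fun p hp => single_mem_supported ?_ _
  have hp' : p ≤ l.length := Nat.lt_succ_iff.mp (Finset.mem_range.mp hp)
  simp [unitEnlarge, List.length_insertIdx_of_le_length hp']

lemma shifts_redOp (t : ZMod 2) : Shifts List.length (redOp A t) (-1) := by
  refine (Shifts.add (fun l => ?_) (fun l => ?_)).add (fun l => ?_)
  · rw [coarOp, lift_single_one]
    refine Submodule.sum_mem _ fun p hp => single_mem_supported ?_ _
    have := length_coarsen l p (Finset.mem_range.mp hp)
    simp only [Set.mem_ofPred_eq]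
    omega
  · rw [headOp, lift_single_one]
    split_ifs with h
    · refine single_mem_supported ?_ _
      have := List.length_pos_iff.mpr h
      simp only [Set.mem_ofPred_eq, List.length_tail]
      omega
    · exact Submodule.zero_mem _
  · rw [lastOp, lift_single_one]
    split_ifs with h
    · refine single_mem_supported ?_ _
      have := List.length_pos_iff.mpr h
      simp only [Set.mem_ofPred_eq, List.length_dropLast]
      omega
    · exact Submodule.zero_mem _

/-! ### Three gradings of the generators -/

lemma shifts_domAct {d : CDPGen n → ℕ} {T : Module.End A (PosDomain n →₀ A)} {k : ℤ}
    (hT : Shifts maslov T k) (h : ∀ g D, (d (g.setDom D) : ℤ) + g.dom.maslov = d g + D.maslov) :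
    Shifts d (domLens.act T) k := Shifts.act domLens hT h

/-- The length of the partitions with index less than `j`. -/
def preLength (j : Fin n) (g : CDPGen n) : ℕ :=
  ∑ i ∈ Finset.univ.filter (· < j), (g.part i).length

lemma preLength_setPart {i j : Fin n} (h : i < j) (g : CDPGen n) (l : OrdPartition) :
    preLength j (g.setPart i l) + (g.part i).length = preLength j g + l.length := by
  have hi : i ∈ Finset.univ.filter (· < j) := by simp [h]
  rw [preLength, preLength, ← Finset.add_sum_erase _ _ hi, ← Finset.add_sum_erase _ _ hi]
  have : ∑ k ∈ (Finset.univ.filter (· < j)).erase i, ((g.setPart i l).part k).length =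
      ∑ k ∈ (Finset.univ.filter (· < j)).erase i, (g.part k).length := by
    refine Finset.sum_congr rfl fun k hk => ?_
    simp [setPart, Finset.ne_of_mem_erase hk]
  rw [this]
  simp only [setPart, Function.update_self]
  omega

lemma preLength_setPart_of_le {i j : Fin n} (h : j ≤ i) (g : CDPGen n) (l : OrdPartition) :
    preLength j (g.setPart i l) = preLength j g := by
  refine Finset.sum_congr rfl fun k hk => ?_
  have : k ≠ i := fun hki => by
    have := (Finset.mem_filter.mp hk).2
    omega
  simp [setPart, this]

lemma degree_setPart (g : CDPGen n) (i : Fin n) (l : OrdPartition) :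
    (g.setPart i l).degree + (g.part i).length = g.degree + l.length := by
  rw [degree, degree, ← Finset.add_sum_erase _ _ (Finset.mem_univ i),
    ← Finset.add_sum_erase _ _ (Finset.mem_univ i)]
  have : ∑ k ∈ Finset.univ.erase i, ((g.setPart i l).part k).length =
      ∑ k ∈ Finset.univ.erase i, (g.part k).length := by
    refine Finset.sum_congr rfl fun k hk => ?_
    simp [setPart, Finset.ne_of_mem_erase hk]
  rw [this]
  simp only [setPart, Function.update_self]
  omega

lemma degree_setDom (g : CDPGen n) (D : PosDomain n) :
    (g.setDom D).degree + g.dom.maslov = g.degree + D.maslov := by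
  rw [degree, degree]
  simp only [setDom]
  omega

lemma shifts_markOp {d : CDPGen n → ℕ} {G : GridDiagram n} (sB : Fin n → ZMod 2) {j : Fin n} {a : ℤ}
    {k : ℤ}
    (h1 : Shifts d ((partLens j).act (redOp A (sB j))) k)
    (h2 : Shifts d ((partLens j).act (insOp A)) a)
    (h3 : Shifts d (domLens.act (annOp A G j)) (k - a)) : Shifts d (markOp A G sB j) k := by
  have := h2.mul h3
  rw [add_sub_cancel] at this
  exact h1.add this

lemma shifts_degree_markOp (G : GridDiagram n) (sB : Fin n → ZMod 2) (j : Fin n) :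
    Shifts degree (markOp A G sB j) (-1) := by
  refine shifts_markOp sB (Shifts.act (partLens j) (shifts_redOp _) fun g l => ?_)
    (Shifts.act (partLens j) shifts_insOp fun g l => ?_) (shifts_domAct (shifts_annOp G j) fun g D => ?_)
  · exact_mod_cast degree_setPart g j l
  · exact_mod_cast degree_setPart g j l
  · exact_mod_cast degree_setDom g D

lemma shifts_degree_bdry (G : GridDiagram n) (sR : PosDomain n → ZMod 2) (sB : Fin n → ZMod 2) :
    Shifts degree (bdry A G sR sB) (-1) := by
  have hd : ∀ (g : CDPGen n) (D : PosDomain n),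
      ((g.setDom D).degree : ℤ) + g.dom.maslov = g.degree + D.maslov := fun g D => by
    exact_mod_cast degree_setDom g D
  rw [bdry_eq]
  refine (Shifts.add (shifts_domAct (shifts_frontOp sR) hd) ?_).add (Shifts.sum fun j => ?_)
  · have := (shifts_domAct (shifts_backOp (A := A) sR) hd).mul
      (Shifts.diag (fun g : CDPGen n => (-1) ^ g.dom.maslov))
    rwa [add_zero] at this
  · have := (shifts_degree_markOp (A := A) G sB j).mul ((Shifts.diag (fun g => preSign A g j)).mul
      (Shifts.diag (fun g : CDPGen n => (-1) ^ g.dom.maslov)))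
    rwa [add_zero, add_zero] at this

/-! ### The square of the differential -/

/-- A sum over all pairs of indices vanishes if it is alternating. -/
lemma sum_sum_eq_zero_of_alternating {ι M : Type} [Fintype ι] [DecidableEq ι] [AddCommGroup M]
    {a : ι → ι → M} (h0 : ∀ i, a i i = 0) (h : ∀ i j, i ≠ j → a i j + a j i = 0) :
    ∑ i, ∑ j, a i j = 0 := by
  rw [← Fintype.sum_prod_type' (f := a)]
  refine Finset.sum_involution (fun t _ => t.swap) (fun t _ => ?_) (fun t _ ht h' => ht ?_)
    (fun t _ => Finset.mem_univ _) (fun t _ => Prod.swap_swap t)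
  · by_cases ht : t.1 = t.2
    · rw [Prod.fst_swap, Prod.snd_swap, ht, h0, add_zero]
    · exact h _ _ ht
  · rw [show t.1 = t.2 from congrArg Prod.snd h', h0]

/-- In the expansion, `F²` meets `-B²` and `F B m` meets `-B F m`, since `m` anticommutes with `B`
and `F`. For the same reason the mixed terms with `E j p j m` cancel in pairs. In the double sum
over `i` and `j`, `m` drops out, and moving `p j` past `E i` costs a sign for `i < j` only, which
makes the sum alternating. -/
lemma sq_eq_zero_of_relations {ι M : Type} [Fintype ι] [LinearOrder ι] [AddCommGroup M]
    {F B m : M →+ M} {E p : ι → M →+ M}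
    (hm : ∀ v, m (m v) = v)
    (hmF : ∀ v, m (F v) = -F (m v)) (hmB : ∀ v, m (B v) = -B (m v))
    (hFB : ∀ v, F (B v) = B (F v)) (hsq : ∀ v, F (F v) = B (B v))
    (hFE : ∀ j v, F (E j v) = E j (F v)) (hBE : ∀ j v, B (E j v) = E j (B v))
    (hpF : ∀ j v, p j (F v) = F (p j v)) (hpB : ∀ j v, p j (B v) = B (p j v))
    (hmE : ∀ j v, m (E j v) = E j (m v)) (hmp : ∀ j v, m (p j v) = p j (m v))
    (hpp : ∀ i j v, p i (p j v) = p j (p i v))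
    (hpE : ∀ i j v, i ≤ j → p i (E j v) = E j (p i v))
    (hpE' : ∀ i j v, i < j → p j (E i v) = -E i (p j v))
    (hEE : ∀ i j v, E i (E j v) = E j (E i v)) (hE : ∀ j v, E j (E j v) = 0) {T : M →+ M}
    (hT : ∀ v, T v = F v + B (m v) + ∑ j, E j (p j (m v))) (v : M) : T (T v) = 0 := by
  have h0 : ∑ i, ∑ j, E i (p i (E j (p j v))) = 0 := by
    refine sum_sum_eq_zero_of_alternating (fun i => ?_) (fun i j hij => ?_)
    · rw [hpE i i _ le_rfl, hE]
    · wlog hlt : i < j generalizing i j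
      · rw [add_comm]
        exact this j i hij.symm (lt_of_le_of_ne (not_lt.mp hlt) hij.symm)
      · rw [hpE i j _ hlt.le, hpE' i j _ hlt, map_neg, hEE, hpp, add_neg_cancel]
  rw [hT, hT]
  simp only [map_add, map_sum, hmF, hmB, map_neg, hFB, hsq, hFE, hBE, hpF, hpB, hmE, hmp, hm]
  simp only [Finset.sum_add_distrib, Finset.sum_neg_distrib, h0]
  abel

lemma maslovSign_maslovSign (v : CDPGen n →₀ A) : maslovSign A (maslovSign A v) = v :=
  LinearMap.congr_fun (diag_sq fun g => by rw [← mul_pow, neg_mul_neg, one_mul, one_pow]) v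

lemma diag_comm {C : Type} (ε δ : C → A) (v : C →₀ A) : diag ε (diag δ v) = diag δ (diag ε v) := by
  have h : diag ε * diag δ = diag δ * diag ε := by
    rw [diag_mul, diag_mul]
    simp only [mul_comm]
  exact LinearMap.congr_fun h v

lemma shifts_maslov_domAct {T : Module.End A (PosDomain n →₀ A)} {k : ℤ} (hT : Shifts maslov T k) :
    Shifts (fun g => g.dom.maslov) (domLens.act T) k :=
  shifts_domAct hT fun _ _ => add_comm _ _

lemma maslovSign_markOp (G : GridDiagram n) (sB : Fin n → ZMod 2) (j : Fin n) (v : CDPGen n →₀ A) :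
    maslovSign A (markOp A G sB j v) = markOp A G sB j (maslovSign A v) := by
  have h1 := fun T v => (Shifts.act_of_const (A := A) (d := fun g : CDPGen n => g.dom.maslov)
    (partLens j) T fun _ _ => rfl).diag_apply_of_even (fun _ => rfl) (by decide) v
  have h2 := (shifts_maslov_domAct (shifts_annOp (A := A) G j)).diag_apply_of_even
    (fun _ => rfl) (by decide)
  simp only [markOp, LinearMap.add_apply, Module.End.mul_apply, map_add, maslovSign, h1, h2]

lemma preSignOp_domAct (j : Fin n) (T : Module.End A (PosDomain n →₀ A)) (v : CDPGen n →₀ A) :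
    preSignOp A j (domLens.act T v) = domLens.act T (preSignOp A j v) :=
  (Shifts.act_of_const (d := preLength j) domLens T fun _ _ => rfl).diag_apply_of_even
    (fun _ => rfl) (by decide) v

lemma preSignOp_markOp_of_le (G : GridDiagram n) (sB : Fin n → ZMod 2) {i j : Fin n} (h : i ≤ j)
    (v : CDPGen n →₀ A) :
    preSignOp A i (markOp A G sB j v) = markOp A G sB j (preSignOp A i v) := by
  have h1 : ∀ T v, preSignOp A i ((partLens j).act T v) = (partLens j).act T (preSignOp A i v) :=
    fun T v => (Shifts.act_of_const (A := A) (d := preLength i) (partLens j) T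
      (fun g l => preLength_setPart_of_le h g l)).diag_apply_of_even (fun _ => rfl) (by decide) v
  simp only [markOp, LinearMap.add_apply, Module.End.mul_apply, map_add, h1, preSignOp_domAct]

lemma preSignOp_markOp_of_lt (G : GridDiagram n) (sB : Fin n → ZMod 2) {i j : Fin n} (h : i < j)
    (v : CDPGen n →₀ A) :
    preSignOp A j (markOp A G sB i v) = -markOp A G sB i (preSignOp A j v) := by
  have hd : ∀ (g : CDPGen n) (l : OrdPartition),
      (preLength j (g.setPart i l) : ℤ) + (g.part i).length = preLength j g + l.length :=
    fun g l => by exact_mod_cast preLength_setPart h g l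
  have h1 : ∀ v, preSignOp A j ((partLens i).act (redOp A (sB i)) v) =
      -(partLens i).act (redOp A (sB i)) (preSignOp A j v) := fun v =>
    (Shifts.act (partLens i) (shifts_redOp _) hd).diag_apply_of_odd (fun _ => rfl) (by decide) v
  have h2 : ∀ v, preSignOp A j ((partLens i).act (insOp A) v) =
      -(partLens i).act (insOp A) (preSignOp A j v) := fun v =>
    (Shifts.act (partLens i) shifts_insOp hd).diag_apply_of_odd (fun _ => rfl) (by decide) v
  simp only [markOp, LinearMap.add_apply, Module.End.mul_apply, map_add, h1, h2, preSignOp_domAct]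
  abel

lemma markOp_comm_domAct {G : GridDiagram n} {sB : Fin n → ZMod 2} {j : Fin n}
    {T : Module.End A (PosDomain n →₀ A)} (hT : T * annOp A G j = annOp A G j * T)
    (v : CDPGen n →₀ A) :
    domLens.act T (markOp A G sB j v) = markOp A G sB j (domLens.act T v) := by
  have h1 := fun S v => LinearMap.congr_fun ((domLens_indep j).comm (A := A) T S) v
  have h2 := fun v => LinearMap.congr_fun (congrArg (domLens (n := n)).act hT) v
  simp only [Lens.act_mul, Module.End.mul_apply] at h1 h2
  simp only [markOp, LinearMap.add_apply, Module.End.mul_apply, map_add, h1, h2]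

lemma annOp_comm (G : GridDiagram n) (i j : Fin n) :
    annOp A G i * annOp A G j = annOp A G j * annOp A G i := by
  have h1 := fun (c d : Fin n) v => LinearMap.congr_fun ((isPeriodic_col c).comm (A := A) (isPeriodic_col d)) v
  have h2 := fun (c d : Fin n) v => LinearMap.congr_fun ((isPeriodic_col c).comm (A := A) (isPeriodic_row d)) v
  have h3 := fun (c d : Fin n) v => LinearMap.congr_fun ((isPeriodic_row c).comm (A := A) (isPeriodic_row d)) v
  simp only [Module.End.mul_apply] at h1 h2 h3
  refine LinearMap.ext fun v => ?_
  simp only [annOp, Module.End.mul_apply, LinearMap.add_apply, LinearMap.smul_apply, map_add,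
    map_smul]
  rw [h1 (G.oCol i), h2 (G.oCol i), h3 (G.oRow i), h2 (G.oCol j), smul_add, smul_add]
  exact add_add_add_comm _ _ _ _

lemma frontOp_comm_annOp (sR : PosDomain n → ZMod 2) (G : GridDiagram n) (j : Fin n) :
    frontOp A sR * annOp A G j = annOp A G j * frontOp A sR := by
  have h1 := fun (c : Fin n) v => LinearMap.congr_fun ((isPeriodic_col c).comm_frontOp (A := A) sR) v
  have h2 := fun (c : Fin n) v => LinearMap.congr_fun ((isPeriodic_row c).comm_frontOp (A := A) sR) v
  simp only [Module.End.mul_apply] at h1 h2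
  refine LinearMap.ext fun v => ?_
  simp only [annOp, Module.End.mul_apply, LinearMap.add_apply, LinearMap.smul_apply, map_add,
    map_smul, h1, h2]

lemma backOp_comm_annOp (sR : PosDomain n → ZMod 2) (G : GridDiagram n) (j : Fin n) :
    backOp A sR * annOp A G j = annOp A G j * backOp A sR := by
  have h1 := fun (c : Fin n) v => LinearMap.congr_fun ((isPeriodic_col c).comm_backOp (A := A) sR) v
  have h2 := fun (c : Fin n) v => LinearMap.congr_fun ((isPeriodic_row c).comm_backOp (A := A) sR) v
  simp only [Module.End.mul_apply] at h1 h2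
  refine LinearMap.ext fun v => ?_
  simp only [annOp, Module.End.mul_apply, LinearMap.add_apply, LinearMap.smul_apply, map_add,
    map_smul, h1, h2]

lemma markOp_comm (G : GridDiagram n) (sB : Fin n → ZMod 2) {i j : Fin n} (hij : i ≠ j)
    (v : CDPGen n →₀ A) :
    markOp A G sB i (markOp A G sB j v) = markOp A G sB j (markOp A G sB i v) := by
  have h1 := fun S T v => LinearMap.congr_fun ((partLens_indep hij).comm (A := A) S T) v
  have h2 := fun S T v => LinearMap.congr_fun ((domLens_indep i).comm (A := A) S T) v
  have h3 := fun S T v => LinearMap.congr_fun ((domLens_indep j).comm (A := A) S T) v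
  have h4 := fun v => LinearMap.congr_fun (congrArg domLens.act (annOp_comm (A := A) G i j)) v
  simp only [Lens.act_mul, Module.End.mul_apply] at h1 h2 h3 h4
  simp only [markOp, LinearMap.add_apply, Module.End.mul_apply, map_add, h1, h2, h3, h4]
  abel

lemma markOp_markOp (G : GridDiagram n) (sB : Fin n → ZMod 2) (j : Fin n) (v : CDPGen n →₀ A) :
    markOp A G sB j (markOp A G sB j v) = 0 := by
  have h1 := fun v => LinearMap.congr_fun (congrArg (partLens j).act (redOp_mul_redOp (A := A) (sB j))) v
  have h2 := fun v => LinearMap.congr_fun (congrArg (partLens j).act (insOp_mul_insOp (A := A))) v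
  have h3 := fun v => LinearMap.congr_fun (congrArg (partLens j).act (insOp_redOp (A := A) (sB j))) v
  have h4 := fun S T v => LinearMap.congr_fun ((domLens_indep j).comm (A := A) S T) v
  simp only [Lens.act_mul, Lens.act_add, Lens.act_zero, Module.End.mul_apply, LinearMap.add_apply,
    LinearMap.zero_apply] at h1 h2 h3 h4
  simp only [markOp, LinearMap.add_apply, Module.End.mul_apply, map_add, h4, h1, h2, zero_add,
    add_zero]
  rw [h3]

theorem bdry_bdry {G : GridDiagram n} {s : CDPGen n → ZMod 2} (hs : IsSignAssignment G s)
    (hn : 2 ≤ n) (v : CDPGen n →₀ A) :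
    bdry A G (fun R => s (ofDom R)) (bubbleSign s)
      (bdry A G (fun R => s (ofDom R)) (bubbleSign s) v) = 0 := by
  have hFB := fun v => LinearMap.congr_fun (congrArg (domLens (n := n)).act
    (frontOp_backOp_comm (A := A) fun R => s (ofDom R))) v
  have hsq := fun v => LinearMap.congr_fun (congrArg (domLens (n := n)).act
    ((frontOp_sq (A := A) hs hn).trans (backOp_sq hs hn).symm)) v
  simp only [Lens.act_mul, Module.End.mul_apply] at hFB hsq
  refine sq_eq_zero_of_relations
    (F := (domLens.act (frontOp A (fun R => s (ofDom R)))).toAddMonoidHom)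
    (B := (domLens.act (backOp A (fun R => s (ofDom R)))).toAddMonoidHom)
    (m := (maslovSign A).toAddMonoidHom)
    (E := fun j => (markOp A G (bubbleSign s) j).toAddMonoidHom)
    (p := fun j => (preSignOp A j).toAddMonoidHom)
    (T := (bdry A G (fun R => s (ofDom R)) (bubbleSign s)).toAddMonoidHom)
    maslovSign_maslovSign
    (fun v => (shifts_maslov_domAct (shifts_frontOp _)).diag_apply_of_odd
      (fun _ => rfl) (by decide) v)
    (fun v => (shifts_maslov_domAct (shifts_backOp _)).diag_apply_of_odd
      (fun _ => rfl) (by decide) v)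
    hFB hsq
    (fun j v => markOp_comm_domAct (frontOp_comm_annOp _ G j) v)
    (fun j v => markOp_comm_domAct (backOp_comm_annOp _ G j) v)
    (fun j v => preSignOp_domAct j _ v) (fun j v => preSignOp_domAct j _ v)
    (fun j v => maslovSign_markOp G _ j v) (fun j v => diag_comm _ _ v)
    (fun i j v => diag_comm _ _ v) (fun i j v h => preSignOp_markOp_of_le G _ h v)
    (fun i j v h => preSignOp_markOp_of_lt G _ h v) (fun i j v => ?_)
    (fun j v => markOp_markOp G _ j v) (fun v => ?_) v
  · by_cases hij : i = j
    · rw [hij]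
    · exact markOp_comm G _ hij v
  · change bdry A G _ _ v = _
    rw [bdry_eq]
    simp only [LinearMap.add_apply, Module.End.mul_apply, LinearMap.sum_apply]
    rfl

end

/-- On the torus with one square the row and the column coincide, and `horizontal` contradicts
`vertical`. -/
lemma two_le_of_isSignAssignment {G : GridDiagram n} {s : CDPGen n → ZMod 2}
    (hs : IsSignAssignment G s) : 2 ≤ n := by
  by_contra hn
  have h1 : n = 1 := by
    have := NeZero.pos n
    omega
  subst h1
  have h : rowAnnulus (n := 1) 1 0 = colAnnulus 1 0 := by
    refine PosDomain.ext rfl rfl ?_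
    funext c r
    simp [rowAnnulus, colAnnulus, Subsingleton.elim c 0, Subsingleton.elim r 0]
  have h2 := hs.horizontal 1 0
  rw [h, hs.vertical] at h2
  exact one_ne_zero h2

theorem isCDPDifferential {G : GridDiagram n} {s : CDPGen n → ZMod 2} (hs : IsSignAssignment G s) :
    IsCDPDifferential G s where
  degree_zero x hx := by
    have := mem_supported_of_single (T := cdpD G s) (S' := ∅) (fun g hg => ?_) hx
    · simpa using this
    · refine Finsupp.supported_mono (fun h hh => ?_) (shifts_degree_bdry G _ _ g)
      have h1 : g.degree = 0 := hg
      have h2 : (h.degree : ℤ) = g.degree + -1 := hh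
      omega
  degree_succ k x hx := by
    refine mem_supported_of_single (fun g hg => ?_) hx
    refine Finsupp.supported_mono (fun h hh => ?_) (shifts_degree_bdry G _ _ g)
    have h1 : g.degree = k + 1 := hg
    have h2 : (h.degree : ℤ) = g.degree + -1 := hh
    change h.degree = k
    omega
  sq_zero := LinearMap.ext fun v => bdry_bdry hs (two_le_of_isSignAssignment hs) v

/-! ## A matching on the positive domains -/

lemma fin_sub_one_val {c : Fin n} (h : c ≠ 0) : (c - 1).val + 1 = c.val := by
  have h1 : c - 1 ≠ -1 := fun h1 => h (by rw [sub_eq_neg_self] at h1; exact h1)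
  have := fin_add_one_val h1
  rw [sub_add_cancel] at this
  exact this.symm

lemma fin_le_zero_iff {a : Fin n} : a ≤ 0 ↔ a = 0 :=
  ⟨fun h => le_antisymm h (Fin.zero_le a), fun h => h.le⟩

/-- Induction from the bottom of `Fin n`. -/
lemma fin_induction {P : Fin n → Prop} (h0 : P 0) (h : ∀ c, c ≠ 0 → P (c - 1) → P c) (c : Fin n) :
    P c := by
  obtain ⟨k, hk⟩ := c
  induction k with
  | zero => exact h0
  | succ k ih =>
    have hc : (⟨k + 1, hk⟩ : Fin n) ≠ 0 := fun h => by simpa using congrArg Fin.val h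
    refine h _ hc ?_
    have : (⟨k + 1, hk⟩ : Fin n) - 1 = ⟨k, by omega⟩ := by
      have := fin_sub_one_val hc
      exact Fin.ext (by simpa using this)
    rw [this]
    exact ih _

namespace PosDomain

/-- The difference of adjacent columns is determined by the two generators, up to the difference in
the top row. -/
lemma coeff_sub_coeff (D : PosDomain n) (c r : Fin n) :
    (D.coeff c r : ℤ) - D.coeff (c - 1) r - (D.coeff c (-1) - D.coeff (c - 1) (-1)) =
      (if D.src c ≤ r then 1 else 0) - (if D.tgt c ≤ r then 1 else 0) := by
  have key : ∀ j, (D.coeff c j : ℤ) - D.coeff (c - 1) j =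
      D.coeff c (j - 1) - D.coeff (c - 1) (j - 1) + (if D.src c = j then 1 else 0) -
        (if D.tgt c = j then 1 else 0) := by
    intro j
    have := D.boundary c j
    simp only [alphaBoundary, genChain] at this
    linarith
  have hle : ∀ (a j : Fin n), j ≠ 0 → ((if a ≤ j then (1 : ℤ) else 0) =
      (if a ≤ j - 1 then 1 else 0) + (if a = j then 1 else 0)) := by
    intro a j hj
    have := fin_sub_one_val hj
    simp only [Fin.le_def, Fin.ext_iff]
    split_ifs <;> omega
  induction r using fin_induction with
  | h0 =>
    have := key 0
    rw [zero_sub] at this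
    simp only [fin_le_zero_iff]
    linarith
  | h j hj ih =>
    rw [hle _ _ hj, hle (D.tgt c) _ hj]
    linarith [key j]

/-- The multiplicities in the top row. -/
def topRow (D : PosDomain n) (c : Fin n) : ℕ := D.coeff c (-1)

end PosDomain

open Classical in
/-- A place where the cyclic sequence `d` increases, or `0` if it is constant. -/
def base (d : Fin n → ℕ) : Fin n := if h : ∃ c, d (c - 1) < d c then h.choose else 0

lemma base_spec {d : Fin n → ℕ} (h : ∃ c, d (c - 1) < d c) : d (base d - 1) < d (base d) := by
  rw [base, dif_pos h]
  exact h.choose_spec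

lemma base_of_not {d : Fin n → ℕ} (h : ¬ ∃ c, d (c - 1) < d c) : base d = 0 := by
  rw [base, dif_neg h]

/-- A cyclic shift preserves the sum, so termwise inequalities between the sequence and its shift
are equalities. -/
lemma eq_of_not_increasing {d : Fin n → ℕ} (h : ¬ ∃ c, d (c - 1) < d c) (c : Fin n) :
    d c = d 0 := by
  have h1 : ∀ c ∈ Finset.univ, d c ≤ d (c - 1) := fun c _ => not_lt.mp fun h' => h ⟨c, h'⟩
  have h2 := (Finset.sum_eq_sum_iff_of_le h1).mp (sum_sub_one d).symm
  induction c using fin_induction with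
  | h0 => rfl
  | h c _ ih => rw [h2 c (Finset.mem_univ c), ih]

/-- Without descents `y c ≥ c` for all `c`, and the sums of both sides agree. -/
lemma eq_one_of_increasing {y : Equiv.Perm (Fin n)} (h : ¬ ∃ c, c ≠ -1 ∧ y (c + 1) < y c) :
    y = 1 := by
  have h1 : ∀ c : Fin n, c.val ≤ (y c).val := fun c => by
    induction c using fin_induction with
    | h0 => simp
    | h c hc ih =>
      have hc1 : c - 1 ≠ -1 := fun h1 => hc (by rw [sub_eq_neg_self] at h1; exact h1)
      have h2 : ¬ y (c - 1 + 1) < y (c - 1) := fun h' => h ⟨c - 1, hc1, h'⟩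
      have h3 := fin_sub_one_val hc
      have h4 : y c ≠ y (c - 1) := y.injective.ne fun h' => by
        have := congrArg Fin.val h'
        omega
      rw [sub_add_cancel] at h2
      omega
  have h2 := (Finset.sum_eq_sum_iff_of_le fun c _ => h1 c).mp (Equiv.sum_comp y fun c => (c : Fin n).val).symm
  exact Equiv.ext fun c => Fin.ext (h2 c (Finset.mem_univ c)).symm

open Classical in
/-- The column in which a domain is changed, in terms of its top row `d`, its final generator `y`,
and its column `e` on the left of the base. -/
def pivot (d : Fin n → ℕ) (y : Equiv.Perm (Fin n)) (e : Fin n → ℕ) : Option (Fin n) :=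
  if ∃ c, d (c - 1) < d c then some (base d)
  else if h : ∃ c, c ≠ -1 ∧ y (c + 1) < y c then some h.choose
  else if h : ∃ j, j ≠ -1 ∧ 0 < e j ∧ ∀ i < j, e i = 0 then some h.choose
  else none

namespace PosDomain

/-- The column on the left of the base. -/
def leftCol (D : PosDomain n) (r : Fin n) : ℕ := D.coeff (base D.topRow - 1) r

/-- The column in which `D` is changed. -/
def piv (D : PosDomain n) : Option (Fin n) := pivot D.topRow D.tgt D.leftCol

/-- It records what the failure of the earlier alternatives implies: the top row is constant and the
base is `0`, so the left column is the last one. In the third alternative the final generator is the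
identity. -/
lemma piv_cases {D : PosDomain n} {c : Fin n} (h : D.piv = some c) :
    (D.topRow (c - 1) < D.topRow c ∧ c = base D.topRow) ∨
    (base D.topRow = 0 ∧ (∀ c, D.topRow c = D.topRow 0) ∧ c ≠ -1 ∧ 
      (D.tgt (c + 1) < D.tgt c ∨ (D.tgt = 1 ∧ 0 < D.coeff (-1) c ∧ ∀ i < c, D.coeff (-1) i = 0))) := by
  rw [piv, pivot] at h
  split_ifs at h with h1 h2 h3
  · cases h
    exact Or.inl ⟨base_spec h1, rfl⟩
  · cases h
    exact Or.inr ⟨base_of_not h1, eq_of_not_increasing h1, h2.choose_spec.1,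
      Or.inl h2.choose_spec.2⟩
  · cases h
    refine Or.inr ⟨base_of_not h1, eq_of_not_increasing h1, h3.choose_spec.1, Or.inr ⟨?_, ?_⟩⟩
    · exact eq_one_of_increasing h2
    · have := h3.choose_spec.2
      simpa only [leftCol, base_of_not h1, zero_sub] using this

/-- So `c + 1` follows `c` in the linear order that starts at the base, and the rectangle at the
pivot misses the left column. -/
lemma piv_ne (hn : 2 ≤ n) {D : PosDomain n} {c : Fin n} (h : D.piv = some c) :
    c ≠ base D.topRow - 1 := by
  rcases piv_cases h with h | h
  · rw [← h.2]
    have := add_one_ne hn (c - 1)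
    rw [sub_add_cancel] at this
    exact this.symm
  · rw [h.1, zero_sub]
    exact h.2.2.1

lemma piv_eq_none {D : PosDomain n} (h : D.piv = none) :
    D.tgt = 1 ∧ (∀ c, D.topRow c = D.topRow 0) ∧ base D.topRow = 0 ∧
      ∀ j, j ≠ -1 → D.coeff (-1) j = 0 := by
  rw [piv, pivot] at h
  split_ifs at h with h1 h2 h3
  refine ⟨eq_one_of_increasing h2, eq_of_not_increasing h1, base_of_not h1, fun j => ?_⟩
  have he : ∀ j, D.leftCol j = D.coeff (-1) j := fun j => by
    rw [leftCol, base_of_not h1, zero_sub]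
  induction j using WellFoundedLT.induction with
  | ind j ih =>
    intro hj
    by_contra h0
    refine h3 ⟨j, hj, by rw [he]; exact Nat.pos_of_ne_zero h0, fun i hi => ?_⟩
    rw [he]
    refine ih i hi fun h' => ?_
    have := le_neg_one j
    omega

/-- With constant top row and final generator the identity, the multiplicities are determined by
those in the last column. -/
lemma coeff_eq_of_tgt_eq_one {D : PosDomain n} (hy : D.tgt = 1)
    (hd : ∀ c, D.topRow c = D.topRow 0) (c r : Fin n) :
    (D.coeff c r : ℤ) = D.coeff (-1) r +
      ∑ i ∈ Finset.univ.filter (· ≤ c), ((if D.src i ≤ r then 1 else 0) - (if i ≤ r then 1 else 0)) := by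
  have key : ∀ c, (D.coeff c r : ℤ) = D.coeff (c - 1) r +
      ((if D.src c ≤ r then 1 else 0) - (if c ≤ r then 1 else 0)) := fun c => by
    have h1 := D.coeff_sub_coeff c r
    have h2 : D.coeff c (-1) = D.coeff (c - 1) (-1) := (hd c).trans (hd (c - 1)).symm
    rw [hy] at h1
    simp only [Equiv.Perm.one_apply] at h1
    rw [h2] at h1
    split_ifs at h1 ⊢ <;> omega
  induction c using fin_induction with
  | h0 =>
    have h0 : Finset.univ.filter (fun i : Fin n => i ≤ 0) = {0} := by
      ext a
      simp
    rw [h0, Finset.sum_singleton, key 0, zero_sub]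
  | h c hc ih =>
    have hs : Finset.univ.filter (fun i : Fin n => i ≤ c) =
        insert c (Finset.univ.filter fun i : Fin n => i ≤ c - 1) := by
      have := fin_sub_one_val hc
      ext a
      simp only [Finset.mem_filter, Finset.mem_univ, true_and, Finset.mem_insert, Fin.le_def,
        Fin.ext_iff]
      omega
    rw [hs, Finset.sum_insert, key c, ih]
    · ring
    · have := fin_sub_one_val hc
      simp only [Finset.mem_filter, Finset.mem_univ, true_and, Fin.le_def]
      omega

/-- If the last column vanishes below the row `m`, the initial generator is the identity there. -/
lemma src_eq_of_coeff_eq_zero {D : PosDomain n} (hy : D.tgt = 1)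
    (hd : ∀ c, D.topRow c = D.topRow 0) {m : Fin n} (h0 : ∀ i < m, D.coeff (-1) i = 0) (i : Fin n)
    (hi : i < m) : D.src i = i := by
  induction i using WellFoundedLT.induction with
  | ind i ih =>
    -- At the diagonal square the multiplicity would be `-1` unless `D.src i ≤ i`, and the smaller
    -- values are already taken by induction.
    have h1 := coeff_eq_of_tgt_eq_one hy hd i i
    rw [h0 i hi] at h1
    have h2 : ∑ k ∈ Finset.univ.filter (· ≤ i),
        ((if D.src k ≤ i then 1 else 0) - (if k ≤ i then (1 : ℤ) else 0)) =
        if D.src i ≤ i then 0 else -1 := by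
      rw [Finset.sum_eq_single i]
      · split_ifs <;> simp_all
      · intro k hk hki
        have hk' : k < i := lt_of_le_of_ne (Finset.mem_filter.mp hk).2 hki
        rw [ih k hk' (hk'.trans hi)]
        simp
      · simp
    rw [h2] at h1
    split_ifs at h1 with h3
    · by_contra h4
      have h5 : D.src i < i := lt_of_le_of_ne h3 h4
      exact h5.ne (D.src.injective (ih _ h5 (h5.trans hi)))
    · omega

/-- This is what the choice of the pivot is made for. At an increase of the top row, column `c`
exceeds column `c - 1` by at least `1` in the rows of the rectangle. At a descent of the final
generator `y`, column `c` exceeds column `c - 1` in the rows below `y c`, and exceeds column `c + 1`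
in the rows of the rectangle from `y c` upwards. -/
lemma rect_le_of_piv {D : PosDomain n} {c : Fin n} (h : D.piv = some c)
    (hx : D.src c < D.src (c + 1)) (hn : 2 ≤ n) :
    (rect D.src c (c + 1)).coeff ≤ D.coeff := by
  suffices key : ∀ r, D.src c ≤ r → r < D.src (c + 1) → 1 ≤ D.coeff c r by
    intro c' r
    change (if InCyc c (c + 1) c' ∧ InCyc (D.src c) (D.src (c + 1)) r then 1 else 0) ≤ _
    split_ifs with h'
    · rw [inCyc_add_one_iff hn, inCyc_iff] at h'
      rw [h'.1]
      rcases h'.2 with h1 | h1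
      · exact key r h1.1 h1.2
      · omega
    · exact Nat.zero_le _
  intro r hr1 hr2
  have h1 := D.coeff_sub_coeff c r
  rw [if_pos hr1] at h1
  rcases piv_cases h with ⟨h2, -⟩ | ⟨-, hd, hc, h2⟩
  · simp only [topRow] at h2
    split_ifs at h1 <;> omega
  · have hd1 : D.coeff c (-1) = D.coeff (c - 1) (-1) := (hd c).trans (hd (c - 1)).symm
    rcases h2 with h2 | ⟨hy, he, h0⟩
    · have h3 := D.coeff_sub_coeff (c + 1) r
      have hd2 : D.coeff (c + 1) (-1) = D.coeff c (-1) := (hd (c + 1)).trans (hd c).symm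
      rw [add_sub_cancel_right, if_neg (by omega)] at h3
      split_ifs at h1 h3 <;> omega
    · have hid := src_eq_of_coeff_eq_zero hy hd h0
      have h3 := coeff_eq_of_tgt_eq_one hy hd c r
      have hle : c ≤ D.src c := by
        by_contra h4
        exact (not_le.mp h4).ne (D.src.injective (hid _ (not_le.mp h4)))
      rw [Finset.sum_eq_zero, add_zero] at h3
      · rcases eq_or_lt_of_le (hle.trans hr1) with h4 | h4
        · rw [← h4] at h3 ⊢
          omega
        · have h5 := D.coeff_sub_coeff (c + 1) r
          have hd2 : D.coeff (c + 1) (-1) = D.coeff c (-1) := (hd (c + 1)).trans (hd c).symm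
          have h6 := fin_add_one_val hc
          rw [add_sub_cancel_right, if_neg (by omega), hy, Equiv.Perm.one_apply,
            if_pos (by rw [Fin.le_def]; omega)] at h5
          omega
      · intro k hk
        rcases eq_or_lt_of_le (Finset.mem_filter.mp hk).2 with rfl | h4
        · rw [if_pos hr1, if_pos (hle.trans hr1), sub_self]
        · rw [hid k h4, sub_self]

end PosDomain

/-! ### The partner of a domain, and the measure that makes the matching acyclic -/

namespace PosDomain

lemma IsComp.unique_right {R E E' D : PosDomain n} (h : IsComp R E D) (h' : IsComp R E' D) :
    E = E' := by
  refine PosDomain.ext (h.mid.symm.trans h'.mid) (h.tgt.symm.trans h'.tgt) ?_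
  funext c r
  have h1 := h.coeff c r
  have h2 := h'.coeff c r
  omega

lemma IsComp.unique_comp {R E D D' : PosDomain n} (h : IsComp R E D) (h' : IsComp R E D') :
    D = D' := by
  refine PosDomain.ext (h.src.trans h'.src.symm) (h.tgt.trans h'.tgt.symm) ?_
  funext c r
  rw [h.coeff, h'.coeff]

/-- The rectangle at the column `c` is split off from `D` at the front if possible, and otherwise
added to it. -/
def toggleAt (D : PosDomain n) (c : Fin n) : PosDomain n :=
  open Classical in
  if D.src c < D.src (c + 1) then
    if h : (rect D.src c (c + 1)).coeff ≤ D.coeff then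
      D.removeFront (rect D.src c (c + 1)) rfl h
    else D
  else comp (rect (D.src * Equiv.swap c (c + 1)) c (c + 1)) D (Equiv.mul_swap_mul_self _ _ _)

/-- The partner of `D`. -/
def toggle (D : PosDomain n) : PosDomain n :=
  match D.piv with
  | none => D
  | some c => D.toggleAt c

lemma toggle_of_none {D : PosDomain n} (h : D.piv = none) : D.toggle = D := by
  rw [toggle, h]

lemma isComp_toggle_of_lt (hn : 2 ≤ n) {D : PosDomain n} {c : Fin n} (h : D.piv = some c)
    (hx : D.src c < D.src (c + 1)) : IsComp (rect D.src c (c + 1)) D.toggle D := by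
  rw [toggle, h]
  simp only [toggleAt]
  rw [if_pos hx, dif_pos (rect_le_of_piv h hx hn)]
  exact isComp_removeFront _ _ _ _

lemma isComp_toggle_of_not_lt {D : PosDomain n} {c : Fin n} (h : D.piv = some c)
    (hx : ¬ D.src c < D.src (c + 1)) :
    IsComp (rect (D.src * Equiv.swap c (c + 1)) c (c + 1)) D D.toggle := by
  rw [toggle, h]
  simp only [toggleAt]
  rw [if_neg hx]
  exact isComp_comp _ _ _

/-! ### A measure of domains -/

/-- `P` is split off from `D`, with the remainder `E`. -/
def Splits (P E D : PosDomain n) : Prop := ∀ c r, D.coeff c r = P.coeff c r + E.coeff c r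

lemma IsComp.splits {P E D : PosDomain n} (h : IsComp P E D) : Splits P E D := h.coeff

lemma IsComp.splits' {P E D : PosDomain n} (h : IsComp E P D) : Splits P E D := fun c r => by
  rw [h.coeff, Nat.add_comm]

lemma Splits.sum_topRow_lt {P E D : PosDomain n} (h : Splits P E D) {c : Fin n}
    (hc : P.coeff c (-1) ≠ 0) : ∑ c, E.topRow c < ∑ c, D.topRow c := by
  refine Finset.sum_lt_sum (fun c _ => ?_) ⟨c, Finset.mem_univ c, ?_⟩
  · simp only [topRow, h c]
    omega
  · simp only [topRow, h c]
    omega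

lemma Splits.topRow_eq {P E D : PosDomain n} (h : Splits P E D) (hc : ∀ c, P.coeff c (-1) = 0) :
    E.topRow = D.topRow := by
  funext c
  simp only [topRow, h c, hc, zero_add]

lemma Splits.sum_leftCol_lt {P E D : PosDomain n} (h : Splits P E D)
    (hc : ∀ c, P.coeff c (-1) = 0) {r : Fin n} (hr : P.coeff (base D.topRow - 1) r ≠ 0) :
    ∑ r, E.leftCol r < ∑ r, D.leftCol r := by
  refine Finset.sum_lt_sum (fun r _ => ?_) ⟨r, Finset.mem_univ r, ?_⟩
  · simp only [leftCol, h.topRow_eq hc, h _ r]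
    omega
  · simp only [leftCol, h.topRow_eq hc, h _ r]
    omega

lemma Splits.leftCol_eq {P E D : PosDomain n} (h : Splits P E D) (hc : ∀ c, P.coeff c (-1) = 0)
    (hr : ∀ r, P.coeff (base D.topRow - 1) r = 0) : E.leftCol = D.leftCol := by
  funext r
  simp only [leftCol, h.topRow_eq hc, h _ r, hr, zero_add]

end PosDomain

/-- The distance from the base. -/
def pos (b i : Fin n) : ℕ := (i - b).val

/-- The distance from the base, with the two columns at the pivot identified. -/
def weight (b : Fin n) (o : Option (Fin n)) (i : Fin n) : ℕ :=
  match o with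
  | none => pos b i
  | some c => if pos b i ≤ pos b c then pos b i else pos b i - 1

lemma pos_add_one {b c : Fin n} (hc : c ≠ b - 1) : pos b (c + 1) = pos b c + 1 := by
  rw [pos, pos, add_sub_right_comm]
  refine fin_add_one_val fun h => hc ?_
  rw [← sub_add_cancel c b, h, neg_add_eq_sub]

lemma pos_injective (b : Fin n) : Function.Injective (pos b) := fun _ _ h =>
  sub_left_injective (Fin.ext h)

/-- Identifying two neighbours in the linear order makes no other pair of columns equal or reversed.
-/
lemma weight_lt {b : Fin n} {o : Option (Fin n)} (ho : ∀ c, o = some c → c ≠ b - 1) {i j : Fin n}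
    (h : pos b i < pos b j) (hij : ¬ (o = some i ∧ j = i + 1)) : weight b o i < weight b o j := by
  rcases o with _ | c
  · exact h
  · simp only [weight]
    have hc := pos_add_one (ho c rfl)
    by_cases hic : i = c
    · subst hic
      have : pos b j ≠ pos b (i + 1) := fun h' => hij ⟨rfl, pos_injective b h'⟩
      split_ifs <;> omega
    · have : pos b i ≠ pos b c := fun h' => hic (pos_injective b h')
      split_ifs <;> omega

lemma weight_add_one {b c : Fin n} (hc : c ≠ b - 1) :
    weight b (some c) (c + 1) = weight b (some c) c := by
  simp only [weight]
  rw [if_pos le_rfl, pos_add_one hc, if_neg (by omega)]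
  omega

lemma sum_mul_swap (f : Fin n → ℤ) (g : Fin n → ℤ) {a b : Fin n} (h : a ≠ b) :
    ∑ i, f i * g (Equiv.swap a b i) = ∑ i, f i * g i - (f b - f a) * (g b - g a) := by
  have h1 : ∑ i, (f i * g (Equiv.swap a b i) - f i * g i) = (f a - f b) * (g b - g a) := by
    rw [Fintype.sum_eq_add a b h]
    · rw [Equiv.swap_apply_left, Equiv.swap_apply_right]
      ring
    · intro i hi
      rw [Equiv.swap_apply_of_ne_of_ne hi.1 hi.2, sub_self]
  rw [Finset.sum_sub_distrib] at h1
  linarith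

namespace PosDomain

/-- The size of the final generator. -/
def tgtSize (D : PosDomain n) : ℕ := ∑ i, pos (base D.topRow) i * (n - (D.tgt i).val)

/-- The size of the initial generator. -/
def srcSize (D : PosDomain n) : ℕ := ∑ i, weight (base D.topRow) D.piv i * (D.src i).val

/-- The measure which the differential lowers, except for one term. -/
def measure (D : PosDomain n) : ℕ ×ₗ ℕ ×ₗ ℕ ×ₗ ℕ :=
  toLex (∑ c, D.topRow c, toLex (∑ r, D.leftCol r, toLex (D.tgtSize, D.srcSize)))

lemma measure_lt_iff {D E : PosDomain n} : E.measure < D.measure ↔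
    ∑ c, E.topRow c < ∑ c, D.topRow c ∨ ∑ c, E.topRow c = ∑ c, D.topRow c ∧
    (∑ r, E.leftCol r < ∑ r, D.leftCol r ∨ ∑ r, E.leftCol r = ∑ r, D.leftCol r ∧
    (E.tgtSize < D.tgtSize ∨ E.tgtSize = D.tgtSize ∧ E.srcSize < D.srcSize)) := by
  simp only [measure, Prod.Lex.toLex_lt_toLex]

/-- The measure drops if something is split off which meets the top row or the left column. -/
lemma Splits.measure_lt {P E D : PosDomain n} (h : Splits P E D)
    (hP : (∃ c, P.coeff c (-1) ≠ 0) ∨ ∃ r, P.coeff (base D.topRow - 1) r ≠ 0) :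
    E.measure < D.measure := by
  rw [measure_lt_iff]
  by_cases hc : ∃ c, P.coeff c (-1) ≠ 0
  · obtain ⟨c, hc⟩ := hc
    exact Or.inl (h.sum_topRow_lt hc)
  · have hc' : ∀ c, P.coeff c (-1) = 0 := fun c => not_not.mp fun h' => hc ⟨c, h'⟩
    obtain ⟨r, hr⟩ := hP.resolve_left hc
    exact Or.inr ⟨by rw [h.topRow_eq hc'], Or.inl (h.sum_leftCol_lt hc' hr)⟩

lemma measure_lt_of_col {E D : PosDomain n} {x : Equiv.Perm (Fin n)} {c : Fin n}
    (h : Splits (colAnnulus x c) E D) : E.measure < D.measure :=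
  h.measure_lt (Or.inl ⟨c, by simp [colAnnulus]⟩)

lemma measure_lt_of_row {E D : PosDomain n} {x : Equiv.Perm (Fin n)} {r : Fin n}
    (h : Splits (rowAnnulus x r) E D) : E.measure < D.measure :=
  h.measure_lt (Or.inr ⟨r, by simp [rowAnnulus]⟩)

/-- A rectangle which avoids the top row and the left column. -/
lemma rect_avoids {x : Equiv.Perm (Fin n)} {i j b : Fin n} (hij : i ≠ j)
    (h : ¬ ((∃ c, (rect x i j).coeff c (-1) ≠ 0) ∨ ∃ r, (rect x i j).coeff (b - 1) r ≠ 0)) :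
    x i < x j ∧ pos b i < pos b j := by
  rw [not_or, not_exists, not_exists] at h
  have h1 : (rect x i j).coeff i (-1) = 0 := not_not.mp (h.1 i)
  have h2 : (rect x i j).coeff (b - 1) (x i) = 0 := not_not.mp (h.2 (x i))
  have hxij : x i ≠ x j := x.injective.ne hij
  have hpij : pos b i ≠ pos b j := (pos_injective b).ne hij
  change rectCoeff x i j i (-1) = 0 at h1
  change rectCoeff x i j (b - 1) (x i) = 0 at h2
  rw [rectCoeff_eq_zero_iff, inCyc_neg_one_iff] at h1
  rw [rectCoeff_eq_zero_iff, inCyc_pred_iff] at h2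
  have h3 : ¬ x j < x i := fun h' => h1 ⟨inCyc_left hij, h'⟩
  have h4 : ¬ (j - b).val < (i - b).val := fun h' => h2 ⟨h', inCyc_left hxij⟩
  simp only [pos] at hpij ⊢
  omega

/-- A rectangle which avoids the top row and the left column runs upwards and to the right in the
linear orders. Its removal moves the final generator to the bottom left and top right corners, which
puts the larger row at the larger distance and lowers `tgtSize`. -/
lemma measure_lt_of_back {E D : PosDomain n} {i j : Fin n} (hij : i ≠ j)
    (h : IsComp E (rectTo D.tgt (i, j)) D) : E.measure < D.measure := by
  by_cases hP : (∃ c, (rectTo D.tgt (i, j)).coeff c (-1) ≠ 0) ∨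
      ∃ r, (rectTo D.tgt (i, j)).coeff (base D.topRow - 1) r ≠ 0
  · exact h.splits'.measure_lt hP
  · obtain ⟨h1, h2⟩ := rect_avoids hij hP
    rw [not_or, not_exists, not_exists] at hP
    have hc : ∀ c, (rectTo D.tgt (i, j)).coeff c (-1) = 0 := fun c => not_not.mp (hP.1 c)
    have hr : ∀ r, (rectTo D.tgt (i, j)).coeff (base D.topRow - 1) r = 0 :=
      fun r => not_not.mp (hP.2 r)
    rw [measure_lt_iff, h.splits'.topRow_eq hc, h.splits'.leftCol_eq hc hr]
    refine Or.inr ⟨rfl, Or.inr ⟨rfl, Or.inl ?_⟩⟩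
    have ht : E.tgt = D.tgt * Equiv.swap i j := h.mid
    have h3 := sum_mul_swap (fun k => (pos (base D.topRow) k : ℤ))
      (fun k => (n : ℤ) - (D.tgt k).val) hij
    have h4 : (E.tgtSize : ℤ) = ∑ k, (pos (base D.topRow) k : ℤ) *
        ((n : ℤ) - (D.tgt (Equiv.swap i j k)).val) := by
      rw [tgtSize, h.splits'.topRow_eq hc, ht]
      push_cast
      refine Finset.sum_congr rfl fun k _ => ?_
      rw [Nat.cast_sub (by omega)]
      rfl
    have h5 : (D.tgtSize : ℤ) = ∑ k, (pos (base D.topRow) k : ℤ) * ((n : ℤ) - (D.tgt k).val) := by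
      rw [tgtSize]
      push_cast
      refine Finset.sum_congr rfl fun k _ => ?_
      rw [Nat.cast_sub (by omega)]
    rw [← h4, ← h5] at h3
    have h6 : D.tgt j < D.tgt i := by simpa using h1
    have h7 : (0 : ℤ) < ((pos (base D.topRow) j : ℤ) - pos (base D.topRow) i) *
        (((n : ℤ) - (D.tgt j).val) - (n - (D.tgt i).val)) := by
      refine mul_pos ?_ ?_ <;> omega
    omega

/-- If the rectangle avoids the top row and the left column, everything that determines the pivot is
unchanged, and the swap lowers `srcSize` unless the two columns have the same weight. That happens
only for the pivot column and its successor. -/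
lemma measure_lt_of_front (hn : 2 ≤ n) {E D : PosDomain n} {i j : Fin n} (hij : i ≠ j)
    (h : IsComp (rect D.src i j) E D)
    (hp : ¬ (D.piv = some i ∧ j = i + 1 ∧ D.src i < D.src j)) : E.measure < D.measure := by
  by_cases hP : (∃ c, (rect D.src i j).coeff c (-1) ≠ 0) ∨
      ∃ r, (rect D.src i j).coeff (base D.topRow - 1) r ≠ 0
  · exact h.splits.measure_lt hP
  · obtain ⟨h1, h2⟩ := rect_avoids hij hP
    rw [not_or, not_exists, not_exists] at hP
    have hc : ∀ c, (rect D.src i j).coeff c (-1) = 0 := fun c => not_not.mp (hP.1 c)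
    have hr : ∀ r, (rect D.src i j).coeff (base D.topRow - 1) r = 0 :=
      fun r => not_not.mp (hP.2 r)
    have hpiv : E.piv = D.piv := by
      rw [piv, piv, h.splits.topRow_eq hc, h.splits.leftCol_eq hc hr, h.tgt]
    rw [measure_lt_iff, h.splits.topRow_eq hc, h.splits.leftCol_eq hc hr]
    refine Or.inr ⟨rfl, Or.inr ⟨rfl, Or.inr ⟨?_, ?_⟩⟩⟩
    · rw [tgtSize, tgtSize, h.splits.topRow_eq hc, h.tgt]
    · have hs : E.src = D.src * Equiv.swap i j := h.mid.symm
      have h3 := sum_mul_swap (fun k => (weight (base D.topRow) D.piv k : ℤ))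
        (fun k => ((D.src k).val : ℤ)) hij
      have h4 : (E.srcSize : ℤ) = ∑ k, (weight (base D.topRow) D.piv k : ℤ) *
          ((D.src (Equiv.swap i j k)).val : ℤ) := by
        rw [srcSize, h.splits.topRow_eq hc, hs, hpiv]
        push_cast
        rfl
      have h5 : (D.srcSize : ℤ) = ∑ k, (weight (base D.topRow) D.piv k : ℤ) *
          ((D.src k).val : ℤ) := by
        rw [srcSize]
        push_cast
        rfl
      rw [← h4, ← h5] at h3
      have h6 := weight_lt (fun c hc => piv_ne hn hc) h2 fun h' => hp ⟨h'.1, h'.2, h1⟩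
      have h7 : (0 : ℤ) < ((weight (base D.topRow) D.piv j : ℤ) - weight (base D.topRow) D.piv i) *
          (((D.src j).val : ℤ) - (D.src i).val) := by
        refine mul_pos ?_ ?_ <;> omega
      omega

/-- The effect of splitting off the rectangle at the pivot. -/
lemma eq_of_isComp_pivot (hn : 2 ≤ n) {x : Equiv.Perm (Fin n)} {E D : PosDomain n} {c : Fin n}
    (h : IsComp (rect x c (c + 1)) E D) (hx : x c < x (c + 1))
    (hc : c ≠ base D.topRow - 1) :
    E.topRow = D.topRow ∧ E.leftCol = D.leftCol ∧ E.piv = D.piv := by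
  have h1 : ∀ c', (rect x c (c + 1)).coeff c' (-1) = 0 := fun c' => by
    refine rectCoeff_eq_zero_iff.mpr fun h' => ?_
    rw [inCyc_neg_one_iff] at h'
    omega
  have h2 : ∀ r, (rect x c (c + 1)).coeff (base D.topRow - 1) r = 0 := fun r => by
    refine rectCoeff_eq_zero_iff.mpr fun h' => ?_
    rw [inCyc_add_one_iff hn] at h'
    exact hc h'.1.symm
  refine ⟨h.splits.topRow_eq h1, h.splits.leftCol_eq h1 h2, ?_⟩
  rw [piv, piv, h.splits.topRow_eq h1, h.splits.leftCol_eq h1 h2, h.tgt]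

lemma measure_eq_of_isComp_pivot (hn : 2 ≤ n) {E D : PosDomain n} {c : Fin n}
    (h : IsComp (rect D.src c (c + 1)) E D) (hx : D.src c < D.src (c + 1))
    (hp : D.piv = some c) : E.measure = D.measure := by
  obtain ⟨h1, h2, h3⟩ := eq_of_isComp_pivot hn h hx (piv_ne hn hp)
  have hs : E.src = D.src * Equiv.swap c (c + 1) := h.mid.symm
  have h4 : E.srcSize = D.srcSize := by
    have h5 := sum_mul_swap (fun k => (weight (base D.topRow) D.piv k : ℤ))
      (fun k => ((D.src k).val : ℤ)) (add_one_ne hn c)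
    have h6 : (weight (base D.topRow) D.piv (c + 1) : ℤ) - weight (base D.topRow) D.piv c = 0 := by
      rw [hp, weight_add_one (piv_ne hn hp), sub_self]
    rw [h6, zero_mul, sub_zero] at h5
    rw [srcSize, srcSize, h1, h3, hs]
    exact_mod_cast h5
  rw [measure, measure, tgtSize, tgtSize, h1, h2, h4, h.tgt]

/-! ### The matching is an involution -/

/-- The pivot depends on the top row, the left column and the final generator, and the rectangle at
the pivot affects none of them. So both members of a pair see the same pivot, with opposite orders
of the two initial values there. -/
lemma toggle_spec (hn : 2 ≤ n) {D : PosDomain n} {c : Fin n} (h : D.piv = some c) :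
    D.toggle.piv = some c ∧ D.toggle.toggle = D ∧ D.toggle.measure = D.measure ∧
      (D.toggle.src c < D.toggle.src (c + 1) ↔ ¬ D.src c < D.src (c + 1)) := by
  by_cases hx : D.src c < D.src (c + 1)
  · have hC := isComp_toggle_of_lt hn h hx
    obtain ⟨h1, h2, h3⟩ := eq_of_isComp_pivot hn hC hx (piv_ne hn h)
    have hs : D.toggle.src = D.src * Equiv.swap c (c + 1) := hC.mid.symm
    have hx' : ¬ D.toggle.src c < D.toggle.src (c + 1) := by
      rw [hs]
      simp only [Equiv.Perm.mul_apply, Equiv.swap_apply_left, Equiv.swap_apply_right]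
      exact hx.le.not_gt
    have hp := h3.trans h
    have hC' := isComp_toggle_of_not_lt hp hx'
    rw [hs, Equiv.mul_swap_mul_self] at hC'
    exact ⟨hp, hC'.unique_comp hC, measure_eq_of_isComp_pivot hn hC hx h,
      iff_of_false hx' (not_not.mpr hx)⟩
  · have hC := isComp_toggle_of_not_lt h hx
    have hs : D.toggle.src = D.src * Equiv.swap c (c + 1) := hC.src
    have hx' : D.toggle.src c < D.toggle.src (c + 1) := by
      have : D.src (c + 1) ≠ D.src c := D.src.injective.ne (add_one_ne hn c).symm
      rw [hs]
      simp only [Equiv.Perm.mul_apply, Equiv.swap_apply_left, Equiv.swap_apply_right]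
      omega
    rw [← hs] at hC
    have hc : c ≠ base D.toggle.topRow - 1 := by
      have h1 : ∀ c', (rect D.toggle.src c (c + 1)).coeff c' (-1) = 0 := fun c' => by
        refine rectCoeff_eq_zero_iff.mpr fun h' => ?_
        rw [inCyc_neg_one_iff] at h'
        omega
      rw [← hC.splits.topRow_eq h1]
      exact piv_ne hn h
    obtain ⟨h1, h2, h3⟩ := eq_of_isComp_pivot hn hC hx' hc
    have hp := h3.symm.trans h
    exact ⟨hp, (isComp_toggle_of_lt hn hp hx').unique_right hC,
      (measure_eq_of_isComp_pivot hn hC hx' hp).symm, iff_of_true hx' hx⟩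

end PosDomain

/-! ## A matching on the ordered partitions -/

namespace OrdPartition

/-- The number which is partitioned. -/
def size (l : OrdPartition) : ℕ := (l.map fun a : ℕ+ => (a : ℕ)).sum

lemma size_cons (a : ℕ+) (l : OrdPartition) : size (a :: l) = a + size l := by
  simp [size]

lemma size_nil : size [] = 0 := rfl

lemma size_eq_zero {l : OrdPartition} (h : size l = 0) : l = [] := by
  rcases l with _ | ⟨a, l⟩
  · rfl
  · rw [size_cons] at h
    have := a.pos
    omega

lemma eq_nil_or_eq_one {l : OrdPartition} (h : size l < 2) : l = [] ∨ l = [1] := by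
  rcases l with _ | ⟨a, l⟩
  · exact Or.inl rfl
  · rw [size_cons] at h
    have := a.pos
    have h1 : l = [] := size_eq_zero (by omega)
    have h2 : a = 1 := PNat.eq (by rw [PNat.one_coe]; omega)
    rw [h1, h2]
    exact Or.inr rfl

/-- The partition has at least two parts, the first of which is `1`. -/
def IsSplit (l : OrdPartition) : Prop := ∃ b r, l = 1 :: b :: r

/-- Merge the first part with the second one if it is `1`, and otherwise split off a part `1`. -/
def toggle : OrdPartition → OrdPartition
  | [] => []
  | a :: l => if a = 1 then
      match l with
      | [] => [1]
      | b :: r => (1 + b) :: r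
    else 1 :: (a - 1) :: l

lemma toggle_split (b : ℕ+) (r : OrdPartition) : toggle (1 :: b :: r) = (1 + b) :: r := by
  simp [toggle]

lemma toggle_of_ne {a : ℕ+} (h : a ≠ 1) (r : OrdPartition) : toggle (a :: r) = 1 :: (a - 1) :: r := by
  simp [toggle, h]

lemma one_add_ne_one (b : ℕ+) : 1 + b ≠ 1 := by
  intro h
  have h1 := congrArg PNat.val h
  rw [PNat.add_coe, PNat.one_coe] at h1
  have := b.pos
  omega

lemma one_lt_of_ne {a : ℕ+} (h : a ≠ 1) : 1 < a := lt_of_le_of_ne one_le h.symm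

lemma exists_of_two_le {l : OrdPartition} (h : 2 ≤ size l) :
    (∃ b r, l = 1 :: b :: r) ∨ ∃ a r, a ≠ 1 ∧ l = a :: r := by
  rcases l with _ | ⟨a, l⟩
  · rw [size_nil] at h
    omega
  · by_cases ha : a = 1
    · rcases l with _ | ⟨b, r⟩
      · rw [ha, size_cons, size_nil, PNat.one_coe] at h
        omega
      · exact Or.inl ⟨b, r, by rw [ha]⟩
    · exact Or.inr ⟨a, l, ha, rfl⟩

lemma not_isSplit_cons {a : ℕ+} (h : a ≠ 1) (r : OrdPartition) : ¬ IsSplit (a :: r) := by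
  rintro ⟨b, r', h'⟩
  exact h (List.cons.inj h').1

lemma toggle_spec {l : OrdPartition} (h : 2 ≤ size l) :
    toggle (toggle l) = l ∧ size (toggle l) = size l ∧ (IsSplit (toggle l) ↔ ¬ IsSplit l) := by
  rcases exists_of_two_le h with ⟨b, r, rfl⟩ | ⟨a, r, ha, rfl⟩
  · have h1 : (1 + b) - 1 = b := by
      refine PNat.eq ?_
      rw [PNat.sub_coe, if_pos (one_lt_of_ne (one_add_ne_one b)), PNat.add_coe, PNat.one_coe]
      omega
    rw [toggle_split, toggle_of_ne (one_add_ne_one b), h1]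
    refine ⟨rfl, ?_, iff_of_false (not_isSplit_cons (one_add_ne_one b) r) (not_not.mpr ⟨b, r, rfl⟩)⟩
    rw [size_cons, size_cons, size_cons, PNat.add_coe]
    omega
  · have h1 : 1 + (a - 1) = a := PNat.add_sub_of_lt (one_lt_of_ne ha)
    rw [toggle_of_ne ha, toggle_split, h1]
    refine ⟨rfl, ?_, iff_of_true ⟨_, _, rfl⟩ (not_isSplit_cons ha r)⟩
    have h2 := congrArg PNat.val h1
    rw [PNat.add_coe] at h2
    rw [size_cons, size_cons, size_cons, ← h2]
    omega

lemma length_toggle_of_isSplit {l : OrdPartition} (h : IsSplit l) :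
    (toggle l).length + 1 = l.length := by
  obtain ⟨b, r, rfl⟩ := h
  rw [toggle_split]
  rfl

open Classical in
/-- The length of the split partition in the pair of `l`. -/
def rank (l : OrdPartition) : ℕ := l.length + if IsSplit l then 0 else 1

lemma rank_toggle {l : OrdPartition} (h : 2 ≤ size l) : rank (toggle l) = rank l := by
  obtain ⟨h1, h2, h3⟩ := toggle_spec h
  by_cases hs : IsSplit l
  · have := length_toggle_of_isSplit hs
    rw [rank, rank, if_pos hs, if_neg (fun h' => h3.mp h' hs)]
    omega
  · have := length_toggle_of_isSplit (h3.mpr hs)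
    rw [h1] at this
    rw [rank, rank, if_neg hs, if_pos (h3.mpr hs)]
    omega

lemma size_coarsen : ∀ (l : OrdPartition) (p : ℕ), size (l.coarsen p) = size l
  | a :: b :: l, 0 => by
    rw [coarsen, size_cons, size_cons, size_cons, PNat.add_coe]
    omega
  | a :: b :: l, p + 1 => by
    rw [coarsen, size_cons, size_coarsen (b :: l) p, size_cons a]
  | [a], 0 => rfl
  | [a], p + 1 => by
    rw [coarsen, size_cons, size_coarsen [] p, size_cons a]
  | [], 0 => rfl
  | [], p + 1 => rfl

/-- A split partition coarsened away from its front keeps the first part `1` and, as the size is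
preserved, a further part. It stays split and becomes shorter. For a partition which is not split,
the extra `1` in `rank` absorbs a change of type. -/
lemma rank_coarsen_lt {l : OrdPartition} {p : ℕ} (hp : p < l.length - 1) (h : IsSplit l → p ≠ 0) :
    rank (l.coarsen p) < rank l := by
  have hlen := length_coarsen l p hp
  by_cases hs : IsSplit l
  · have hs' : IsSplit (l.coarsen p) := by
      obtain ⟨b, r, rfl⟩ := hs
      obtain ⟨p, rfl⟩ := Nat.exists_eq_succ_of_ne_zero (h ⟨b, r, rfl⟩)
      rw [coarsen]
      rcases hc : coarsen (b :: r) p with _ | ⟨b', r'⟩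
      · have := size_coarsen (b :: r) p
        rw [hc, size_nil, size_cons] at this
        have := b.pos
        omega
      · exact ⟨b', r', rfl⟩
    rw [rank, rank, if_pos hs, if_pos hs']
    omega
  · rw [rank, rank, if_neg hs]
    split_ifs <;> omega

/-- The partition `l'` is of smaller size than `l`, or of the same size and shorter. -/
def Below (l' l : OrdPartition) : Prop :=
  size l' < size l ∨ size l' = size l ∧ l'.length < l.length

/-- The partition `l'` is of smaller size than `l`, or of the same size and smaller rank. -/
def StrictlyBelow (l' l : OrdPartition) : Prop :=
  size l' < size l ∨ size l' = size l ∧ rank l' < rank l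

lemma size_tail_lt {l : OrdPartition} (h : l ≠ []) : size l.tail < size l := by
  obtain ⟨a, l, rfl⟩ := List.exists_cons_of_ne_nil h
  rw [size_cons, List.tail_cons]
  have := a.pos
  omega

lemma size_dropLast_lt {l : OrdPartition} (h : l ≠ []) : size l.dropLast < size l := by
  have h1 := congrArg size (List.dropLast_append_getLast h)
  have h2 := (l.getLast h).pos
  simp only [size, List.map_append, List.sum_append, List.map_cons, List.map_nil, List.sum_cons,
    List.sum_nil] at h1 ⊢
  omega

variable {A : Type} [CommRing A]

lemma redOp_mem_of {S : Set OrdPartition} {t : ZMod 2} {l : OrdPartition}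
    (hS : ∀ l', size l' < size l → l' ∈ S)
    {v : OrdPartition →₀ A} (h : coarOp A (Finsupp.single l 1) + v ∈ Finsupp.supported A A S) :
    redOp A t (Finsupp.single l 1) + v ∈ Finsupp.supported A A S := by
  have h1 : headOp A t (Finsupp.single l 1) ∈ Finsupp.supported A A S := by
    rw [headOp, lift_single_one]
    split_ifs with hl
    · exact single_mem_supported (hS _ (size_tail_lt hl)) _
    · exact Submodule.zero_mem _
  have h2 : lastOp A t (Finsupp.single l 1) ∈ Finsupp.supported A A S := by
    rw [lastOp, lift_single_one]
    split_ifs with hl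
    · exact single_mem_supported (hS _ (size_dropLast_lt hl)) _
    · exact Submodule.zero_mem _
  have h3 : redOp A t (Finsupp.single l 1) + v = (coarOp A (Finsupp.single l 1) + v) +
      headOp A t (Finsupp.single l 1) + lastOp A t (Finsupp.single l 1) := by
    rw [redOp, LinearMap.add_apply, LinearMap.add_apply]
    abel
  rw [h3]
  exact Submodule.add_mem _ (Submodule.add_mem _ h h1) h2

lemma redOp_mem_below (t : ZMod 2) (l : OrdPartition) :
    redOp A t (Finsupp.single l 1) ∈ Finsupp.supported A A {l' | Below l' l} := by
  have := redOp_mem_of (A := A) (t := t) (l := l) (S := {l' | Below l' l}) (v := 0)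
    (fun l' h => Or.inl h) ?_
  · rwa [add_zero] at this
  · rw [add_zero, coarOp, lift_single_one]
    refine Submodule.sum_mem _ fun p hp => single_mem_supported (S := {l' | Below l' l}) (Or.inr ⟨size_coarsen l p, ?_⟩) _
    have := length_coarsen l p (Finset.mem_range.mp hp)
    omega

lemma redOp_mem_strictlyBelow (t : ZMod 2) {l : OrdPartition} (h : ¬ IsSplit l) :
    redOp A t (Finsupp.single l 1) ∈ Finsupp.supported A A {l' | StrictlyBelow l' l} := by
  have := redOp_mem_of (A := A) (t := t) (l := l) (S := {l' | StrictlyBelow l' l}) (v := 0)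
    (fun l' h => Or.inl h) ?_
  · rwa [add_zero] at this
  · rw [add_zero, coarOp, lift_single_one]
    exact Submodule.sum_mem _ fun p hp => single_mem_supported (S := {l' | StrictlyBelow l' l}) (Or.inr ⟨size_coarsen l p, rank_coarsen_lt (Finset.mem_range.mp hp) fun h' => absurd h' h⟩) _

/-- The coarsening of the first two parts has sign `-1` and cancels the added partner. The other
coarsenings lower the rank, and the initial and final reductions lower the size. -/
lemma redOp_add_toggle_mem (t : ZMod 2) {l : OrdPartition} (h : IsSplit l) :
    redOp A t (Finsupp.single l 1) + Finsupp.single (toggle l) 1 ∈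
      Finsupp.supported A A {l' | StrictlyBelow l' l} := by
  refine redOp_mem_of (fun l' h => Or.inl h) ?_
  obtain ⟨b, r, rfl⟩ := h
  have h1 : List.length (1 :: b :: r) - 1 = r.length + 1 := rfl
  rw [coarOp, lift_single_one, h1, Finset.sum_range_succ', toggle_split, add_assoc]
  have h2 : (Finsupp.single (coarsen (1 :: b :: r) 0) ((-1) ^ (0 + 1)) : OrdPartition →₀ A) +
      Finsupp.single ((1 + b) :: r) 1 = 0 := by
    rw [coarsen, ← Finsupp.single_add]
    simp
  rw [h2, add_zero]
  refine Submodule.sum_mem _ fun p hp => single_mem_supported (S := {l' | StrictlyBelow l' (1 :: b :: r)}) (Or.inr ⟨size_coarsen _ _, ?_⟩) _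
  refine rank_coarsen_lt ?_ fun _ => Nat.succ_ne_zero p
  rw [h1]
  exact Nat.succ_lt_succ (Finset.mem_range.mp hp)

/-- The two reductions of `(1)` have equal bubble signs and opposite position signs. -/
lemma redOp_of_small (t : ZMod 2) {l : OrdPartition} (h : size l < 2) :
    redOp A t (Finsupp.single l 1) = 0 := by
  rcases eq_nil_or_eq_one h with rfl | rfl
  · rw [redOp_apply, shrinkOp_nil, headOp_nil, add_zero]
  · rw [← consOp_single, redOp_apply, shrinkOp_cons, headOp_cons, addOp_nil, shrinkOp_nil, nilOp_nil]
    simp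

/-- The two insertions of `1` into `(1)` cancel. So the generators with all `N_j < 2` span a
subcomplex, on which only the domains need to be matched. -/
lemma insOp_of_small {l : OrdPartition} (h : size l < 2) :
    insOp A (Finsupp.single l 1) ∈ Finsupp.supported A A {l' | size l' < 2} := by
  rcases eq_nil_or_eq_one h with rfl | rfl
  · rw [insOp_nil]
    exact single_mem_supported (by simp [size]) _
  · rw [← consOp_single, insOp_cons, insOp_nil, consOp_single, sub_self]
    exact Submodule.zero_mem _

end OrdPartition

/-! ## Matchings from a measure -/

section Measure

variable {R : Type} [CommRing R] {C W : Type} [Preorder W] [WellFoundedLT W]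

/-- A level function for a differential which lowers a measure with values in a well-founded
order. -/
lemma exists_level (d : (C →₀ R) →ₗ[R] (C →₀ R)) (M : C → W) (mate : C → C)
    (hmm : ∀ g, mate (mate g) = g) (hM : ∀ g, M (mate g) = M g) :
    ∃ level : C → ℕ, (∀ g, level (mate g) = level g) ∧
      ∀ g h, h ∈ (d (Finsupp.single g 1)).support → M h < M g → level h < level g := by
  classical
  -- The supports of both boundaries of a pair are used, so that the level is the same for `g` and
  -- `mate g`. Their finiteness gives levels in `ℕ`, although the order on measures may be longer.
  let dep : C → Finset C := fun g =>
    ((d (Finsupp.single g 1)).support ∪ (d (Finsupp.single (mate g) 1)).support).filter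
      fun h => M h < M g
  have hwf : WellFounded fun h g : C => M h < M g := InvImage.wf M wellFounded_lt
  let level : C → ℕ := hwf.fix fun g ih =>
    (dep g).attach.sup fun h => ih h.1 (Finset.mem_filter.mp h.2).2 + 1
  have hl : ∀ g, level g = (dep g).sup fun h => level h + 1 := fun g => by
    rw [← Finset.sup_attach]
    exact hwf.fix_eq _ g
  have hdep : ∀ g, dep (mate g) = dep g := fun g => by
    simp only [dep, hmm, hM, Finset.union_comm]
  refine ⟨level, fun g => by rw [hl, hl, hdep], fun g h hh hlt => ?_⟩
  rw [hl g]
  exact Finset.le_sup (f := fun h => level h + 1)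
    (Finset.mem_filter.mpr ⟨Finset.mem_union_left _ hh, hlt⟩)

/-- A matching for which the differential lowers a measure. -/
lemma exists_morseMatching {deg : C → ℕ} {d : (C →₀ R) →ₗ[R] (C →₀ R)} (M : C → W) (mate : C → C)
    (upper lower : Set C) (sign : C → R)
    (hmm : ∀ g, mate (mate g) = g) (hM : ∀ g, M (mate g) = M g)
    (sign_sq : ∀ u, sign u * sign u = 1) (disj : ∀ g ∈ upper, g ∉ lower)
    (mate_upper : ∀ u ∈ upper, mate u ∈ lower) (mate_lower : ∀ l ∈ lower, mate l ∈ upper)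
    (deg_mate : ∀ u ∈ upper, deg (mate u) + 1 = deg u)
    (d_upper : ∀ u ∈ upper, d (Finsupp.single u 1) - Finsupp.single (mate u) (sign u) ∈
      Finsupp.supported R R {h | M h < M u})
    (d_other : ∀ g, g ∉ upper → d (Finsupp.single g 1) ∈ Finsupp.supported R R {h | M h < M g}) :
    ∃ m : MorseMatching deg d, m.upper = upper ∧ m.lower = lower := by
  classical
  obtain ⟨level, h1, h2⟩ := exists_level d M mate hmm hM
  refine ⟨⟨level, upper, lower, mate, sign, sign_sq, disj, mate_upper, mate_lower,
    fun g _ => hmm g, fun g _ => h1 g, deg_mate, fun u hu => ?_, fun g hg => ?_⟩, rfl, rfl⟩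
  · rw [Finsupp.mem_supported]
    intro h hh
    have hlt : M h < M u := (Finsupp.mem_supported _ _).mp (d_upper u hu) hh
    refine h2 u h ?_ hlt
    have hne : mate u ≠ h := fun h' => by
      rw [← h', hM] at hlt
      exact lt_irrefl _ hlt
    rw [Finset.mem_coe, Finsupp.mem_support_iff, Finsupp.sub_apply,
      Finsupp.single_eq_of_ne hne.symm, sub_zero] at hh
    exact Finsupp.mem_support_iff.mpr hh
  · rw [Finsupp.mem_supported]
    exact fun h hh => h2 g h hh ((Finsupp.mem_supported _ _).mp (d_other g hg) hh)

end Measure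

/-! ## The supports of the terms of the differential -/

namespace PosDomain

/-- The sum of all multiplicities. -/
def total (D : PosDomain n) : ℕ := ∑ c, ∑ r, D.coeff c r

lemma Splits.total_lt {P E D : PosDomain n} (h : Splits P E D) {c r : Fin n}
    (hP : P.coeff c r ≠ 0) : E.total < D.total := by
  have hle : ∀ c r, E.coeff c r ≤ D.coeff c r := fun c r => by
    rw [h c r]
    omega
  refine Finset.sum_lt_sum (fun c _ => Finset.sum_le_sum fun r _ => hle c r)
    ⟨c, Finset.mem_univ c, Finset.sum_lt_sum (fun r _ => hle c r) ⟨r, Finset.mem_univ r, ?_⟩⟩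
  rw [h c r]
  omega

lemma rect_coeff_ne_zero (x : Equiv.Perm (Fin n)) {i j : Fin n} (h : i ≠ j) :
    (rect x i j).coeff i (x i) ≠ 0 := by
  change rectCoeff x i j i (x i) ≠ 0
  rw [rectCoeff, if_pos ⟨inCyc_left h, inCyc_left (x.injective.ne h)⟩]
  exact one_ne_zero

lemma colAnnulus_coeff_ne_zero (x : Equiv.Perm (Fin n)) (c : Fin n) :
    (colAnnulus x c).coeff c 0 ≠ 0 := by simp [colAnnulus]

lemma rowAnnulus_coeff_ne_zero (x : Equiv.Perm (Fin n)) (r : Fin n) :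
    (rowAnnulus x r).coeff 0 r ≠ 0 := by simp [rowAnnulus]

variable {A : Type} [CommRing A] {S : Set (PosDomain n)} {D : PosDomain n}

lemma remF_mem_of {R : PosDomain n} (h : ∀ E, IsComp R E D → E ∈ S) :
    remF A D R ∈ Finsupp.supported A A S := by
  by_cases hE : ∃ E, IsComp R E D
  · obtain ⟨E, hE⟩ := hE
    rw [remF_of hE]
    exact single_mem_supported (h E hE) _
  · rw [remF_eq_zero (not_exists.mp hE)]
    exact Submodule.zero_mem _

lemma remB_mem_of {R : PosDomain n} (h : ∀ E, IsComp E R D → E ∈ S) :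
    remB A D R ∈ Finsupp.supported A A S := by
  by_cases hE : ∃ E, IsComp E R D
  · obtain ⟨E, hE⟩ := hE
    rw [remB_of hE]
    exact single_mem_supported (h E hE) _
  · rw [remB_eq_zero (not_exists.mp hE)]
    exact Submodule.zero_mem _

lemma frontOp_mem (sR : PosDomain n → ZMod 2)
    (h : ∀ i j E, i ≠ j → IsComp (rect D.src i j) E D → E ∈ S) :
    frontOp A sR (Finsupp.single D 1) ∈ Finsupp.supported A A S := by
  rw [frontOp, lift_single_one]
  refine Submodule.sum_mem _ fun p _ => ?_
  split_ifs with hp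
  · exact Submodule.smul_mem _ _ (remF_mem_of fun E hE => h _ _ E hp.1 hE)
  · exact Submodule.zero_mem _

lemma frontOp_sub_mem (sR : PosDomain n → ZMod 2) {a b : Fin n} {T : PosDomain n}
    (hab : IsEmptyRect D.src a b) (hT : IsComp (rect D.src a b) T D)
    (h : ∀ i j E, i ≠ j → ¬ (i = a ∧ j = b) → IsComp (rect D.src i j) E D → E ∈ S) :
    frontOp A sR (Finsupp.single D 1) - Finsupp.single T (sgn A (sR (rect D.src a b))) ∈
      Finsupp.supported A A S := by
  classical
  rw [frontOp, lift_single_one, ← Finset.add_sum_erase _ _ (Finset.mem_univ (a, b)), if_pos hab,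
    remF_of hT, Finsupp.smul_single, smul_eq_mul, mul_one, add_sub_cancel_left]
  refine Submodule.sum_mem _ fun p hp => ?_
  split_ifs with hp'
  · refine Submodule.smul_mem _ _ (remF_mem_of fun E hE => h _ _ E hp'.1 (fun h' => ?_) hE)
    exact Finset.ne_of_mem_erase hp (Prod.ext h'.1 h'.2)
  · exact Submodule.zero_mem _

lemma backOp_mem (sR : PosDomain n → ZMod 2)
    (h : ∀ i j E, i ≠ j → IsComp E (rectTo D.tgt (i, j)) D → E ∈ S) :
    backOp A sR (Finsupp.single D 1) ∈ Finsupp.supported A A S := by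
  rw [backOp, lift_single_one]
  refine Submodule.sum_mem _ fun p _ => ?_
  split_ifs with hp
  · exact Submodule.smul_mem _ _ (remB_mem_of fun E hE => h _ _ E hp.1 hE)
  · exact Submodule.zero_mem _

lemma annOp_mem (G : GridDiagram n) (k : Fin n)
    (h : ∀ E x c, Splits (colAnnulus x c) E D → E ∈ S)
    (h' : ∀ E x r, Splits (rowAnnulus x r) E D → E ∈ S) :
    annOp A G k (Finsupp.single D 1) ∈ Finsupp.supported A A S := by
  rw [annOp, LinearMap.add_apply, LinearMap.smul_apply, periodicOp, periodicOp, lift_single_one,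
    lift_single_one]
  exact Submodule.add_mem _ (remB_mem_of fun E hE => h E _ _ hE.splits')
    (Submodule.smul_mem _ _ (remB_mem_of fun E hE => h' E _ _ hE.splits'))

end PosDomain

namespace CDPGen

variable {A : Type} [CommRing A]

lemma lmapDomain_mem {X Y : Type} (f : X → Y) {S : Set Y} {v : X →₀ A}
    (h : v ∈ Finsupp.supported A A (f ⁻¹' S)) :
    Finsupp.lmapDomain A A f v ∈ Finsupp.supported A A S :=
  Finsupp.supported_comap_lmapDomain A A f S h

lemma bdry_single (G : GridDiagram n) (sR : PosDomain n → ZMod 2) (sB : Fin n → ZMod 2)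
    (g : CDPGen n) : bdry A G sR sB (Finsupp.single g 1) =
      Finsupp.lmapDomain A A g.setDom (frontOp A sR (Finsupp.single g.dom 1)) +
      (-1 : A) ^ g.dom.maslov •
        Finsupp.lmapDomain A A g.setDom (backOp A sR (Finsupp.single g.dom 1)) +
      ∑ j, ((-1) ^ g.dom.maslov * preSign A g j) • markOp A G sB j (Finsupp.single g 1) := by
  have h : ∀ u : A, Finsupp.single g u = u • Finsupp.single g 1 := fun u => by
    rw [Finsupp.smul_single, smul_eq_mul, mul_one]
  rw [bdry_eq, LinearMap.add_apply, LinearMap.add_apply, LinearMap.sum_apply, Lens.act_single,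
    Module.End.mul_apply, maslovSign, diag_single, h, map_smul, Lens.act_single]
  refine congrArg₂ (· + ·) rfl (Finset.sum_congr rfl fun j _ => ?_)
  rw [preSignOp, diag_mul, Module.End.mul_apply, diag_single, h, map_smul, mul_comm]

lemma insOp_annOp_mem (G : GridDiagram n) (k : Fin n) {g : CDPGen n} {T S : Set (CDPGen n)}
    (h : ∀ E x c, Splits (colAnnulus x c) E g.dom → g.setDom E ∈ T)
    (h' : ∀ E x r, Splits (rowAnnulus x r) E g.dom → g.setDom E ∈ T)
    (hT : ∀ g' ∈ T, insOp A (Finsupp.single (g'.part k) 1) ∈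
      Finsupp.supported A A (g'.setPart k ⁻¹' S)) :
    (partLens k).act (insOp A) (domLens.act (annOp A G k) (Finsupp.single g 1)) ∈
      Finsupp.supported A A S := by
  refine mem_supported_of_single (S := T) (fun g' hg' => ?_) ?_
  · rw [Lens.act_single]
    exact lmapDomain_mem _ (hT g' hg')
  · rw [Lens.act_single]
    exact lmapDomain_mem _ (annOp_mem G k h h')

lemma markOp_single (G : GridDiagram n) (sB : Fin n → ZMod 2) (k : Fin n) (g : CDPGen n) :
    markOp A G sB k (Finsupp.single g 1) =
      Finsupp.lmapDomain A A (g.setPart k) (redOp A (sB k) (Finsupp.single (g.part k) 1)) +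
      (partLens k).act (insOp A) (domLens.act (annOp A G k) (Finsupp.single g 1)) := by
  rw [markOp, LinearMap.add_apply, Module.End.mul_apply, Lens.act_single]
  rfl

/-! ## The matching of the generators -/

/-- The numbers which are partitioned. -/
def sizes (g : CDPGen n) (j : Fin n) : ℕ := size (g.part j)

open Classical in
/-- An index at which `N` is at least `2`. -/
def lead (N : Fin n → ℕ) : Option (Fin n) := if h : ∃ j, 2 ≤ N j then some h.choose else none

lemma two_le_of_lead {N : Fin n → ℕ} {j : Fin n} (h : lead N = some j) : 2 ≤ N j := by
  rw [lead] at h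
  split_ifs at h with h'
  cases h
  exact h'.choose_spec

lemma lead_eq_none_iff {N : Fin n → ℕ} : lead N = none ↔ ∀ j, N j < 2 := by
  rw [lead]
  split_ifs with h
  · simp only [false_iff, not_forall, not_lt]
    exact h
  · simp only [true_iff]
    exact fun j => not_le.mp fun h' => h ⟨j, h'⟩

lemma sizes_setPart (g : CDPGen n) (j : Fin n) (l : OrdPartition) :
    (g.setPart j l).sizes = Function.update g.sizes j (size l) := by
  funext i
  by_cases h : i = j
  · subst h
    simp [sizes, setPart]
  · simp [sizes, setPart, h]

lemma sizes_setPart_of_eq {g : CDPGen n} {j : Fin n} {l : OrdPartition}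
    (h : size l = size (g.part j)) : (g.setPart j l).sizes = g.sizes := by
  rw [sizes_setPart, h]
  exact Function.update_eq_self j g.sizes

lemma sum_setPart (f : Fin n → OrdPartition → ℕ) (g : CDPGen n) (j : Fin n) (l : OrdPartition) :
    ∑ i, f i ((g.setPart j l).part i) + f j (g.part j) = ∑ i, f i (g.part i) + f j l := by
  rw [← Finset.add_sum_erase _ _ (Finset.mem_univ j),
    ← Finset.add_sum_erase _ (fun i => f i (g.part i)) (Finset.mem_univ j)]
  have : ∑ i ∈ Finset.univ.erase j, f i ((g.setPart j l).part i) =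
      ∑ i ∈ Finset.univ.erase j, f i (g.part i) := by
    refine Finset.sum_congr rfl fun i hi => ?_
    simp [setPart, Finset.ne_of_mem_erase hi]
  rw [this]
  simp only [setPart, Function.update_self]
  omega

/-- The total length of the partitions, with the rank at `j`. -/
def height (j : Fin n) (g : CDPGen n) : ℕ :=
  ∑ i, if i = j then rank (g.part i) else (g.part i).length

lemma height_setPart_self (g : CDPGen n) (j : Fin n) (l : OrdPartition) :
    height j (g.setPart j l) + rank (g.part j) = height j g + rank l := by
  have := sum_setPart (fun i l => if i = j then rank l else l.length) g j l
  simpa [height] using this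

lemma height_setPart_of_ne (g : CDPGen n) {i j : Fin n} (h : i ≠ j) (l : OrdPartition) :
    height j (g.setPart i l) + (g.part i).length = height j g + l.length := by
  have := sum_setPart (fun i l => if i = j then rank l else l.length) g i l
  simpa [height, h] using this

/-- The measure which the differential lowers, except for one term. -/
def measure (g : CDPGen n) : ℕ ×ₗ ℕ ×ₗ ℕ ×ₗ ℕ ×ₗ ℕ :=
  match lead g.sizes with
  | none => toLex (0, g.dom.measure)
  | some j => toLex (1, toLex (g.dom.total, toLex (∑ i, g.sizes i, toLex (height j g, 0))))

lemma measure_of_none {g : CDPGen n} (h : lead g.sizes = none) :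
    g.measure = toLex (0, g.dom.measure) := by
  rw [measure, h]

lemma measure_of_some {g : CDPGen n} {j : Fin n} (h : lead g.sizes = some j) :
    g.measure = toLex (1, toLex (g.dom.total, toLex (∑ i, g.sizes i, toLex (height j g, 0)))) := by
  rw [measure, h]

lemma measure_lt_of_none {g g' : CDPGen n} (h : lead g.sizes = none) (h' : lead g'.sizes = none)
    (hlt : g'.dom.measure < g.dom.measure) : g'.measure < g.measure := by
  rw [measure_of_none h, measure_of_none h', Prod.Lex.toLex_lt_toLex]
  exact Or.inr ⟨rfl, hlt⟩

/-- Generators without a leading index come below all others. Otherwise the heights are compared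
only when all sizes agree, and then the leading index, which is a function of the sizes, is the
same. -/
lemma measure_lt_of_some {g g' : CDPGen n} {j : Fin n} (h : lead g.sizes = some j)
    (hlt : g'.dom.total < g.dom.total ∨ g'.dom.total = g.dom.total ∧
      (∑ i, g'.sizes i < ∑ i, g.sizes i ∨ g'.sizes = g.sizes ∧ height j g' < height j g)) :
    g'.measure < g.measure := by
  rw [measure_of_some h]
  rcases h' : lead g'.sizes with _ | j'
  · rw [measure_of_none h', Prod.Lex.toLex_lt_toLex]
    exact Or.inl Nat.zero_lt_one
  · rw [measure_of_some h']
    simp only [Prod.Lex.toLex_lt_toLex]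
    refine Or.inr ⟨trivial, ?_⟩
    rcases hlt with hlt | ⟨h1, hlt | ⟨h2, hlt⟩⟩
    · exact Or.inl hlt
    · exact Or.inr ⟨h1, Or.inl hlt⟩
    · have hj : j' = j := Option.some_injective _ (by rw [← h, ← h', h2])
      rw [hj, h2]
      exact Or.inr ⟨h1, Or.inr ⟨rfl, Or.inl hlt⟩⟩

lemma measure_setPart_lt {g : CDPGen n} {j k : Fin n} (h : lead g.sizes = some j)
    {l : OrdPartition} (hl : size l < size (g.part k) ∨ size l = size (g.part k) ∧
      height j (g.setPart k l) < height j g) : (g.setPart k l).measure < g.measure := by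
  refine measure_lt_of_some h (Or.inr ⟨rfl, ?_⟩)
  rcases hl with hl | ⟨h1, h2⟩
  · have := sum_setPart (fun _ => size) g k l
    refine Or.inl ?_
    simp only [sizes]
    omega
  · exact Or.inr ⟨sizes_setPart_of_eq h1, h2⟩

/-- The partner of a generator. -/
def mate (g : CDPGen n) : CDPGen n :=
  match lead g.sizes with
  | none => g.setDom g.dom.toggle
  | some j => g.setPart j (OrdPartition.toggle (g.part j))

lemma mate_of_none {g : CDPGen n} (h : lead g.sizes = none) : g.mate = g.setDom g.dom.toggle := by
  rw [mate, h]

lemma mate_of_some {g : CDPGen n} {j : Fin n} (h : lead g.sizes = some j) :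
    g.mate = g.setPart j (OrdPartition.toggle (g.part j)) := by
  rw [mate, h]

lemma sizes_mate (g : CDPGen n) : g.mate.sizes = g.sizes := by
  rcases h : lead g.sizes with _ | j
  · rw [mate_of_none h]
    rfl
  · rw [mate_of_some h]
    exact sizes_setPart_of_eq (toggle_spec (two_le_of_lead h)).2.1

lemma mate_mate (hn : 2 ≤ n) (g : CDPGen n) : g.mate.mate = g := by
  have hs := sizes_mate g
  rcases h : lead g.sizes with _ | j
  · rw [mate_of_none (hs ▸ h), mate_of_none h]
    change (⟨g.dom.toggle.toggle, g.part⟩ : CDPGen n) = g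
    rcases hp : g.dom.piv with _ | c
    · rw [toggle_of_none hp, toggle_of_none hp]
    · rw [(PosDomain.toggle_spec hn hp).2.1]
  · rw [mate_of_some (hs ▸ h), mate_of_some h]
    have h1 := (OrdPartition.toggle_spec (two_le_of_lead h)).1
    simp [setPart, h1]

lemma measure_mate (hn : 2 ≤ n) (g : CDPGen n) : g.mate.measure = g.measure := by
  have hs := sizes_mate g
  rcases h : lead g.sizes with _ | j
  · rw [measure_of_none (hs ▸ h), measure_of_none h, mate_of_none h]
    change toLex (0, g.dom.toggle.measure) = _
    rcases hp : g.dom.piv with _ | c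
    · rw [toggle_of_none hp]
    · rw [(PosDomain.toggle_spec hn hp).2.2.1]
  · rw [measure_of_some (hs ▸ h), measure_of_some h, hs, mate_of_some h]
    have h1 := height_setPart_self g j (OrdPartition.toggle (g.part j))
    rw [rank_toggle (two_le_of_lead h), Nat.add_right_cancel_iff] at h1
    rw [h1]
    rfl

/-- The upper generators of the matching. -/
def upper : Set (CDPGen n) := {g | (∃ j, lead g.sizes = some j ∧ IsSplit (g.part j)) ∨
  lead g.sizes = none ∧ ∃ c, g.dom.piv = some c ∧ g.dom.src c < g.dom.src (c + 1)}

/-- The lower generators of the matching. -/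
def lower : Set (CDPGen n) := {g | (∃ j, lead g.sizes = some j ∧ ¬ IsSplit (g.part j)) ∨
  lead g.sizes = none ∧ ∃ c, g.dom.piv = some c ∧ ¬ g.dom.src c < g.dom.src (c + 1)}

lemma not_mem_lower_of_mem_upper {g : CDPGen n} (h : g ∈ upper) : g ∉ lower := by
  rintro h'
  rcases h with ⟨j, h1, h2⟩ | ⟨h1, c, h2, h3⟩ <;> rcases h' with ⟨j', h1', h2'⟩ | ⟨h1', c', h2', h3'⟩
  · rw [h1] at h1'
    cases h1'
    exact h2' h2
  · rw [h1] at h1'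
    cases h1'
  · rw [h1] at h1'
    cases h1'
  · rw [h2] at h2'
    cases h2'
    exact h3' h3

lemma isSplit_mate {g : CDPGen n} {j : Fin n} (h : lead g.sizes = some j) :
    IsSplit (g.mate.part j) ↔ ¬ IsSplit (g.part j) := by
  rw [mate_of_some h, ← (OrdPartition.toggle_spec (two_le_of_lead h)).2.2]
  simp [setPart]

lemma mate_mem_lower (hn : 2 ≤ n) {g : CDPGen n} (h : g ∈ upper) : g.mate ∈ lower := by
  rcases h with ⟨j, h1, h2⟩ | ⟨h1, c, h2, h3⟩
  · exact Or.inl ⟨j, by rw [sizes_mate, h1], fun h' => (isSplit_mate h1).mp h' h2⟩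
  · obtain ⟨h4, -, -, h5⟩ := PosDomain.toggle_spec hn h2
    refine Or.inr ⟨by rw [sizes_mate, h1], c, ?_⟩
    rw [mate_of_none h1]
    exact ⟨h4, fun h' => h5.mp h' h3⟩

lemma mate_mem_upper (hn : 2 ≤ n) {g : CDPGen n} (h : g ∈ lower) : g.mate ∈ upper := by
  rcases h with ⟨j, h1, h2⟩ | ⟨h1, c, h2, h3⟩
  · exact Or.inl ⟨j, by rw [sizes_mate, h1], (isSplit_mate h1).mpr h2⟩
  · obtain ⟨h4, -, -, h5⟩ := PosDomain.toggle_spec hn h2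
    refine Or.inr ⟨by rw [sizes_mate, h1], c, ?_⟩
    rw [mate_of_none h1]
    exact ⟨h4, h5.mpr h3⟩

lemma isEmptyRect_add_one (hn : 2 ≤ n) (x : Equiv.Perm (Fin n)) (c : Fin n) :
    IsEmptyRect x c (c + 1) :=
  ⟨add_one_ne hn c, fun _ hk h => hk ((inCyc_add_one_iff hn).mp h.1)⟩

lemma degree_mate (hn : 2 ≤ n) {g : CDPGen n} (h : g ∈ upper) : g.mate.degree + 1 = g.degree := by
  rcases h with ⟨j, h1, h2⟩ | ⟨h1, c, h2, h3⟩
  · rw [mate_of_some h1]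
    have h3 := degree_setPart g j (OrdPartition.toggle (g.part j))
    have h4 := length_toggle_of_isSplit h2
    omega
  · rw [mate_of_none h1]
    have h4 := degree_setDom g g.dom.toggle
    have h5 := (isComp_toggle_of_lt hn h2 h3).maslov_of_num_left (k := 1)
      (num_rect (isEmptyRect_add_one hn _ c))
    omega

/-- The coefficient with which an upper generator hits its mate. -/
def mateSign (A : Type) [CommRing A] (sR : PosDomain n → ZMod 2) (g : CDPGen n) : A :=
  match lead g.sizes with
  | some j => -((-1) ^ g.dom.maslov * preSign A g j)
  | none => match g.dom.piv with
    | some c => sgn A (sR (rect g.dom.src c (c + 1)))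
    | none => 1

lemma mateSign_mul_self (sR : PosDomain n → ZMod 2) (g : CDPGen n) :
    mateSign A sR g * mateSign A sR g = 1 := by
  have h : ∀ k : ℕ, (-1 : A) ^ k * (-1) ^ k = 1 := fun k => by
    rw [← mul_pow, neg_mul_neg, one_mul, one_pow]
  rw [mateSign]
  rcases lead g.sizes with _ | j
  · rcases g.dom.piv with _ | c
    · exact mul_one 1
    · exact sgn_mul_self _
  · simp only [neg_mul_neg, preSign]
    rw [mul_mul_mul_comm, h, h, one_mul]

/-! ### The differential lowers the measure -/

section

variable (G : GridDiagram n) (sR : PosDomain n → ZMod 2) (sB : Fin n → ZMod 2) {g : CDPGen n}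

/-- The reductions cancel, and the insertions keep every `N_j < 2`. The accompanying annulus meets
the top row or the left column, which lowers the measure of the domain. -/
lemma markOp_mem_of_none (h : lead g.sizes = none) (k : Fin n) :
    markOp A G sB k (Finsupp.single g 1) ∈
      Finsupp.supported A A {g' | g'.measure < g.measure} := by
  have hs := lead_eq_none_iff.mp h
  rw [markOp_single, redOp_of_small _ (hs k), map_zero, zero_add]
  refine insOp_annOp_mem G k (T := {g' | g'.sizes = g.sizes ∧ g'.dom.measure < g.dom.measure})
    (fun E x c hE => ⟨rfl, measure_lt_of_col hE⟩) (fun E x r hE => ⟨rfl, measure_lt_of_row hE⟩)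
    fun g' hg' => ?_
  have hk : size (g'.part k) < 2 := by
    have := hs k
    rwa [← hg'.1] at this
  refine Finsupp.supported_mono (fun l hl => ?_) (insOp_of_small hk)
  refine measure_lt_of_none (g' := g'.setPart k l) h ?_ hg'.2
  rw [sizes_setPart, hg'.1, lead_eq_none_iff]
  intro j
  by_cases hj : j = k
  · rw [hj, Function.update_self]
    exact hl
  · rw [Function.update_of_ne hj]
    exact hs j

lemma backOp_mem_of_none (h : lead g.sizes = none) :
    Finsupp.lmapDomain A A g.setDom (backOp A sR (Finsupp.single g.dom 1)) ∈
      Finsupp.supported A A {g' | g'.measure < g.measure} :=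
  lmapDomain_mem _ (backOp_mem sR fun _ _ _ hij hE =>
    measure_lt_of_none h h (measure_lt_of_back hij hE))

lemma frontOp_mem_of_none (hn : 2 ≤ n) (h : lead g.sizes = none)
    (hp : ∀ c, g.dom.piv = some c → ¬ g.dom.src c < g.dom.src (c + 1)) :
    Finsupp.lmapDomain A A g.setDom (frontOp A sR (Finsupp.single g.dom 1)) ∈
      Finsupp.supported A A {g' | g'.measure < g.measure} := by
  refine lmapDomain_mem _ (frontOp_mem sR fun i j E hij hE =>
    measure_lt_of_none h h (measure_lt_of_front hn hij hE ?_))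
  rintro ⟨h1, rfl, h2⟩
  exact hp i h1 h2

lemma frontOp_sub_mem_of_none (hn : 2 ≤ n) (h : lead g.sizes = none) {c : Fin n}
    (hp : g.dom.piv = some c) (hc : g.dom.src c < g.dom.src (c + 1)) :
    Finsupp.lmapDomain A A g.setDom (frontOp A sR (Finsupp.single g.dom 1)) -
      Finsupp.single g.mate (mateSign A sR g) ∈
      Finsupp.supported A A {g' | g'.measure < g.measure} := by
  have h1 : mateSign A sR g = sgn A (sR (rect g.dom.src c (c + 1))) := by
    rw [mateSign, h, hp]
  have h2 : Finsupp.single g.mate (mateSign A sR g) = Finsupp.lmapDomain A A g.setDom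
      (Finsupp.single g.dom.toggle (sgn A (sR (rect g.dom.src c (c + 1))))) := by
    rw [Finsupp.lmapDomain_apply, Finsupp.mapDomain_single, h1, mate_of_none h]
  rw [h2, ← map_sub]
  refine lmapDomain_mem _ (frontOp_sub_mem sR (isEmptyRect_add_one hn _ c)
    (isComp_toggle_of_lt hn hp hc) fun i j E hij hne hE =>
    measure_lt_of_none h h (measure_lt_of_front hn hij hE ?_))
  rintro ⟨h3, rfl, -⟩
  rw [hp] at h3
  cases h3
  exact hne ⟨rfl, rfl⟩

variable {j : Fin n}

/-- The insertion raises `N_k`, but the annulus lowers the total multiplicity, which is compared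
first. -/
lemma insOp_annOp_mem_of_some (h : lead g.sizes = some j) (k : Fin n) :
    (partLens k).act (insOp A) (domLens.act (annOp A G k) (Finsupp.single g 1)) ∈
      Finsupp.supported A A {g' | g'.measure < g.measure} := by
  refine insOp_annOp_mem G k (T := {g' | g'.dom.total < g.dom.total})
    (fun E x c hE => hE.total_lt (colAnnulus_coeff_ne_zero x c))
    (fun E x r hE => hE.total_lt (rowAnnulus_coeff_ne_zero x r)) fun g' hg' => ?_
  refine (Finsupp.mem_supported _ _).mpr fun l _ => ?_
  exact measure_lt_of_some (g' := g'.setPart k l) h (Or.inl hg')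

lemma markOp_mem_of_some (h : lead g.sizes = some j) {k : Fin n}
    (hk : k = j → ¬ IsSplit (g.part k)) : markOp A G sB k (Finsupp.single g 1) ∈
      Finsupp.supported A A {g' | g'.measure < g.measure} := by
  rw [markOp_single]
  refine Submodule.add_mem _ (lmapDomain_mem _ ?_) (insOp_annOp_mem_of_some G h k)
  by_cases hkj : k = j
  · subst hkj
    refine Finsupp.supported_mono (fun l hl => ?_) (redOp_mem_strictlyBelow _ (hk rfl))
    refine measure_setPart_lt h (hl.imp_right fun h' => ⟨h'.1, ?_⟩)
    have h1 := height_setPart_self g k l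
    have h2 := h'.2
    omega
  · refine Finsupp.supported_mono (fun l hl => ?_) (redOp_mem_below _ _)
    refine measure_setPart_lt h (hl.imp_right fun h' => ⟨h'.1, ?_⟩)
    have h1 := height_setPart_of_ne g hkj l
    have h2 := h'.2
    omega

lemma markOp_add_mem_of_some (h : lead g.sizes = some j) (hj : IsSplit (g.part j)) :
    markOp A G sB j (Finsupp.single g 1) + Finsupp.single g.mate 1 ∈
      Finsupp.supported A A {g' | g'.measure < g.measure} := by
  have h2 : Finsupp.single g.mate (1 : A) = Finsupp.lmapDomain A A (g.setPart j)
      (Finsupp.single (OrdPartition.toggle (g.part j)) 1) := by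
    rw [lmapDomain_single_one, mate_of_some h]
  rw [markOp_single, h2, add_right_comm, ← map_add]
  refine Submodule.add_mem _ (lmapDomain_mem _ ?_) (insOp_annOp_mem_of_some G h j)
  refine Finsupp.supported_mono (fun l hl => ?_) (redOp_add_toggle_mem _ hj)
  refine measure_setPart_lt h (hl.imp_right fun h' => ⟨h'.1, ?_⟩)
  have h1 := height_setPart_self g j l
  have h2 := h'.2
  omega

lemma frontOp_mem_of_some (h : lead g.sizes = some j) :
    Finsupp.lmapDomain A A g.setDom (frontOp A sR (Finsupp.single g.dom 1)) ∈
      Finsupp.supported A A {g' | g'.measure < g.measure} :=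
  lmapDomain_mem _ (frontOp_mem sR fun _ _ _ hij hE => measure_lt_of_some h
    (Or.inl (hE.splits.total_lt (rect_coeff_ne_zero _ hij))))

lemma backOp_mem_of_some (h : lead g.sizes = some j) :
    Finsupp.lmapDomain A A g.setDom (backOp A sR (Finsupp.single g.dom 1)) ∈
      Finsupp.supported A A {g' | g'.measure < g.measure} :=
  lmapDomain_mem _ (backOp_mem sR fun _ _ _ hij hE => measure_lt_of_some h
    (Or.inl (hE.splits'.total_lt (rect_coeff_ne_zero _ hij))))

lemma bdry_mem_of_not_upper (hn : 2 ≤ n) (hg : g ∉ upper) :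
    bdry A G sR sB (Finsupp.single g 1) ∈
      Finsupp.supported A A {g' | g'.measure < g.measure} := by
  rw [bdry_single]
  rcases h : lead g.sizes with _ | j
  · exact Submodule.add_mem _ (Submodule.add_mem _
      (frontOp_mem_of_none sR hn h fun c hp hc => hg (Or.inr ⟨h, c, hp, hc⟩))
      (Submodule.smul_mem _ _ (backOp_mem_of_none sR h)))
      (Submodule.sum_mem _ fun k _ => Submodule.smul_mem _ _ (markOp_mem_of_none G sB h k))
  · refine Submodule.add_mem _ (Submodule.add_mem _ (frontOp_mem_of_some sR h)
      (Submodule.smul_mem _ _ (backOp_mem_of_some sR h)))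
      (Submodule.sum_mem _ fun k _ => Submodule.smul_mem _ _ (markOp_mem_of_some G sB h ?_))
    rintro rfl hk
    exact hg (Or.inl ⟨k, h, hk⟩)

lemma bdry_sub_mem_of_upper (hn : 2 ≤ n) (hg : g ∈ upper) :
    bdry A G sR sB (Finsupp.single g 1) - Finsupp.single g.mate (mateSign A sR g) ∈
      Finsupp.supported A A {g' | g'.measure < g.measure} := by
  rw [bdry_single]
  rcases hg with ⟨j, h, hj⟩ | ⟨h, c, hp, hc⟩
  · classical
    have h1 : mateSign A sR g = -((-1) ^ g.dom.maslov * preSign A g j) := by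
      rw [mateSign, h]
    rw [h1, Finsupp.single_neg, sub_neg_eq_add, ← Finset.add_sum_erase _ _ (Finset.mem_univ j)]
    have h2 : Finsupp.single g.mate ((-1) ^ g.dom.maslov * preSign A g j) =
        ((-1) ^ g.dom.maslov * preSign A g j) • Finsupp.single g.mate (1 : A) := by
      rw [Finsupp.smul_single, smul_eq_mul, mul_one]
    rw [h2, add_assoc, add_right_comm (_ • markOp A G sB j _), ← smul_add]
    refine Submodule.add_mem _ (Submodule.add_mem _ (frontOp_mem_of_some sR h)
      (Submodule.smul_mem _ _ (backOp_mem_of_some sR h))) (Submodule.add_mem _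
      (Submodule.smul_mem _ _ (markOp_add_mem_of_some G sB h hj)) (Submodule.sum_mem _ fun k hk =>
      Submodule.smul_mem _ _ (markOp_mem_of_some G sB h fun h' => ?_)))
    exact absurd h' (Finset.ne_of_mem_erase hk)
  · rw [add_assoc, add_sub_right_comm]
    exact Submodule.add_mem _ (frontOp_sub_mem_of_none sR hn h hp hc) (Submodule.add_mem _
      (Submodule.smul_mem _ _ (backOp_mem_of_none sR h))
      (Submodule.sum_mem _ fun k _ => Submodule.smul_mem _ _ (markOp_mem_of_none G sB h k)))

/-- The matching of the generators. -/
theorem exists_matching (hn : 2 ≤ n) :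
    ∃ m : MorseMatching degree (bdry A G sR sB), m.upper = upper ∧ m.lower = lower :=
  exists_morseMatching measure mate upper lower (mateSign A sR) (mate_mate hn) (measure_mate hn)
    (mateSign_mul_self sR) (fun _ => not_mem_lower_of_mem_upper) (fun _ => mate_mem_lower hn)
    (fun _ => mate_mem_upper hn) (fun _ => degree_mate hn)
    (fun _ => bdry_sub_mem_of_upper G sR sB hn) (fun _ => bdry_mem_of_not_upper G sR sB hn)

end

end CDPGen

/-! ## The critical generators -/

namespace PosDomain

/-- The multiple of the annulus in the last row, as a domain from the identity to itself. -/
def lastRow (n : ℕ) [NeZero n] (m : ℕ) : PosDomain n where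
  src := 1
  tgt := 1
  coeff := fun _ r => if r = -1 then m else 0
  boundary := by simp [alphaBoundary]

lemma maslov_lastRow (m : ℕ) : (lastRow n m).maslov = 2 * m := by
  induction m with
  | zero => simp [maslov, lastRow, cornerSum]
  | succ m ih =>
    have h : IsComp (rowAnnulus 1 (-1)) (lastRow n m) (lastRow n (m + 1)) := by
      refine ⟨rfl, rfl, rfl, fun c r => ?_⟩
      simp only [lastRow, rowAnnulus]
      split_ifs
      · exact Nat.add_comm _ _
      · rfl
    have h1 := h.maslov_of_num_left (k := 2) (num_rowAnnulus _ _)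
    omega

lemma lastRow_injective : Function.Injective (lastRow n) := fun m m' h => by
  have := congrFun (congrFun (congrArg PosDomain.coeff h) 0) (-1)
  simpa [lastRow] using this

/-- Without a pivot the last column vanishes below the top row, which makes the initial generator
fix every index other than `-1`, hence all. With both generators the identity and a constant top
row, all columns agree with the last one. -/
lemma piv_eq_none_iff {D : PosDomain n} : D.piv = none ↔ ∃ m, D = lastRow n m := by
  constructor
  · intro h
    obtain ⟨h1, h2, -, h3⟩ := piv_eq_none h
    have h4 : ∀ i : Fin n, i ≠ -1 → D.src i = i := fun i hi =>
      src_eq_of_coeff_eq_zero h1 h2 (m := -1) (fun j hj => h3 j hj.ne) i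
        (lt_of_le_of_ne (le_neg_one i) hi)
    have h5 : D.src = 1 := by
      refine Equiv.ext fun i => ?_
      by_cases hi : D.src i = -1
      · by_contra hne
        have h6 : i ≠ -1 := fun h' => hne (by rw [hi, h']; rfl)
        exact hne (h4 i h6)
      · exact D.src.injective (h4 _ hi)
    refine ⟨D.coeff (-1) (-1), PosDomain.ext h5 h1 ?_⟩
    funext c r
    have h6 := coeff_eq_of_tgt_eq_one h1 h2 c r
    rw [h5, Finset.sum_eq_zero fun i _ => sub_self _, add_zero, Nat.cast_inj] at h6
    change D.coeff c r = if r = -1 then D.coeff (-1) (-1) else 0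
    rw [h6]
    split_ifs with hr
    · rw [hr]
    · exact h3 r hr
  · rintro ⟨m, rfl⟩
    have h1 : ¬ ∃ c, (lastRow n m).topRow (c - 1) < (lastRow n m).topRow c := by
      simp [topRow, lastRow]
    have h2 : ¬ ∃ c, c ≠ -1 ∧ (lastRow n m).tgt (c + 1) < (lastRow n m).tgt c := by
      rintro ⟨c, hc, h⟩
      have h3 := fin_add_one_val hc
      change c + 1 < c at h
      omega
    have h3 : ¬ ∃ j, j ≠ -1 ∧ 0 < (lastRow n m).leftCol j ∧ ∀ i < j, (lastRow n m).leftCol i = 0 := by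
      rintro ⟨j, hj, h, -⟩
      simp [leftCol, lastRow, hj] at h
    rw [piv, pivot, if_neg h1, dif_neg h2, dif_neg h3]

end PosDomain

namespace CDPGen

/-- The critical generators. -/
def critical (p : (_ : ℕ) × Finset (Fin n)) : CDPGen n :=
  ⟨lastRow n p.1, fun j => if j ∈ p.2 then [1] else []⟩

lemma critical_injective : Function.Injective (critical (n := n)) := by
  rintro ⟨m, T⟩ ⟨m', T'⟩ h
  have h1 : m = m' := lastRow_injective (congrArg CDPGen.dom h)
  have h2 : T = T' := by
    ext j
    have := congrFun (congrArg CDPGen.part h) j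
    simp only [critical] at this
    split_ifs at this with h3 h4 h4 <;> simp_all
  rw [h1, h2]

lemma degree_critical (p : (_ : ℕ) × Finset (Fin n)) :
    (critical p).degree = 2 * p.1 + p.2.card := by
  have h : ∀ j, ((critical p).part j).length = if j ∈ p.2 then 1 else 0 := fun j => by
    simp only [critical]
    split_ifs <;> rfl
  rw [degree]
  simp only [h]
  rw [Finset.sum_boole, Finset.filter_mem_eq_inter, Finset.univ_inter, Nat.cast_id]
  exact congrArg (· + _) (maslov_lastRow p.1)

lemma not_mem_upper_lower_iff {g : CDPGen n} :
    (g ∉ upper ∧ g ∉ lower) ↔ g ∈ Set.range critical := by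
  constructor
  · rintro ⟨h1, h2⟩
    have h3 : lead g.sizes = none := by
      rcases h : lead g.sizes with _ | j
      · rfl
      · by_cases hj : IsSplit (g.part j)
        · exact absurd (Or.inl ⟨j, h, hj⟩) h1
        · exact absurd (Or.inl ⟨j, h, hj⟩) h2
    have h4 : g.dom.piv = none := by
      rcases h : g.dom.piv with _ | c
      · rfl
      · by_cases hc : g.dom.src c < g.dom.src (c + 1)
        · exact absurd (Or.inr ⟨h3, c, h, hc⟩) h1
        · exact absurd (Or.inr ⟨h3, c, h, hc⟩) h2
    obtain ⟨m, hm⟩ := piv_eq_none_iff.mp h4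
    refine ⟨⟨m, Finset.univ.filter fun j => g.part j = [1]⟩, CDPGen.ext hm.symm ?_⟩
    funext j
    rcases eq_nil_or_eq_one (lead_eq_none_iff.mp h3 j) with h | h
    · simp [critical, h]
    · simp [critical, h]
  · rintro ⟨p, rfl⟩
    have h3 : lead (critical p).sizes = none := by
      refine lead_eq_none_iff.mpr fun j => ?_
      simp only [sizes, critical]
      split_ifs <;> simp [size]
    have h4 : (critical p).dom.piv = none := piv_eq_none_iff.mpr ⟨p.1, rfl⟩
    refine ⟨?_, ?_⟩
    all_goals
      rintro (⟨j, h, -⟩ | ⟨-, c, h, -⟩)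
      · rw [h3] at h
        cases h
      · rw [h4] at h
        cases h

/-- The indices of the critical generators of degree `k`. -/
def criticalIndices (n k : ℕ) : Finset ((_ : ℕ) × Finset (Fin n)) :=
  (Finset.range (k / 2 + 1)).sigma fun l => Finset.powersetCard (k - 2 * l) Finset.univ

lemma mem_criticalIndices {k : ℕ} {p : (_ : ℕ) × Finset (Fin n)} :
    p ∈ criticalIndices n k ↔ (critical p).degree = k := by
  rw [criticalIndices, Finset.mem_sigma, Finset.mem_range, Finset.mem_powersetCard_univ,
    degree_critical]
  omega

lemma card_criticalIndices (n k : ℕ) : (criticalIndices n k).card =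
    ∑ l ∈ Finset.range (k / 2 + 1), n.choose (k - 2 * l) := by
  rw [criticalIndices, Finset.card_sigma]
  simp

/-- The critical generators of degree `k` and their indices. -/
def criticalEquiv (k : ℕ) : criticalIndices n k ≃
    {g : CDPGen n // (g ∉ upper ∧ g ∉ lower) ∧ g.degree = k} :=
  Equiv.ofBijective (fun p => ⟨critical p.1, not_mem_upper_lower_iff.mpr ⟨p.1, rfl⟩,
    mem_criticalIndices.mp p.2⟩) (by
    refine ⟨fun p q h => Subtype.ext (critical_injective (congrArg Subtype.val h)), ?_⟩
    rintro ⟨g, hg, hk⟩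
    obtain ⟨p, rfl⟩ := not_mem_upper_lower_iff.mp hg
    exact ⟨⟨p, mem_criticalIndices.mpr hk⟩, rfl⟩)

end CDPGen

/-! ## The rank of the tensor product -/

lemma finrank_cubeTensorPoly (n k : ℕ) : Module.finrank ℤ (CubeTensorPoly n k) =
    ∑ l ∈ Finset.range (k / 2 + 1), n.choose (k - 2 * l) := by
  rw [Module.finrank_directSum]
  simp only [Module.finrank_tensorProduct, Module.finrank_fin_fun]
  rw [Finset.sum_coe_sort (Finset.HasAntidiagonal.antidiagonal k)
    fun p => n.choose p.1 * if Even p.2 then 1 else 0]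
  simp only [mul_ite, mul_one, mul_zero]
  rw [← Finset.sum_filter]
  refine Finset.sum_nbij' (fun p => p.2 / 2) (fun l => (k - 2 * l, 2 * l)) ?_ ?_ ?_ ?_ ?_
  · rintro ⟨a, b⟩ hp
    simp only [Finset.mem_filter, Finset.HasAntidiagonal.mem_antidiagonal, Finset.mem_range] at hp ⊢
    omega
  · intro l hl
    simp only [Finset.mem_filter, Finset.HasAntidiagonal.mem_antidiagonal, Finset.mem_range] at hl ⊢
    exact ⟨by omega, even_two_mul l⟩
  · rintro ⟨a, b⟩ hp
    simp only [Finset.mem_filter, Finset.HasAntidiagonal.mem_antidiagonal, Prod.mk.injEq] at hp ⊢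
    obtain ⟨h, c, rfl⟩ := hp
    omega
  · intro l _
    simp
  · rintro ⟨a, b⟩ hp
    simp only [Finset.mem_filter, Finset.HasAntidiagonal.mem_antidiagonal] at hp ⊢
    obtain ⟨h, c, rfl⟩ := hp
    congr 1
    omega

/-! ## The main theorem -/

/-- The generators form a basis of the complex. -/
def cdpBasedComplex (G : GridDiagram n) (s : CDPGen n → ZMod 2) (h : IsCDPDifferential G s) :
    BasedComplex (cdpComplex G s h) CDPGen.degree (cdpD G s) where
  ι k := (cdpChains n k).subtype
  inj k := (cdpChains n k).injective_subtype
  range_eq k := Submodule.range_subtype _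
  d_eq k x := by
    have := ChainComplex.of_d (fun k => ModuleCat.of ℤ (cdpChains n k))
      (fun k => ModuleCat.ofHom ((cdpD G s).restrict (h.degree_succ k))) k
    exact congrArg (fun f => (cdpChains n k).subtype (ModuleCat.Hom.hom f x)) this
  d_zero := h.degree_zero

theorem mainTheorem8 (n : ℕ) [NeZero n] (G : GridDiagram n) (s : CDPGen n → ZMod 2)
    (hs : IsSignAssignment G s) :
    ∃ h : IsCDPDifferential G s,
      (∃ F : ChainFiltration (cdpComplex G s h),
        ∀ k, Nonempty (F.assocGraded.homology k ≃ₗ[ℤ] CubeTensorPoly n k)) ∧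
      ∀ k, Module.rank ℤ ((cdpComplex G s h).homology k) ≤
        ((∑ l ∈ Finset.range (k / 2 + 1), n.choose (k - 2 * l) : ℕ) : Cardinal) := by
  have h := isCDPDifferential hs
  obtain ⟨m, hu, hl⟩ : ∃ m : MorseMatching CDPGen.degree (cdpD G s), m.upper = upper ∧
      m.lower = lower := CDPGen.exists_matching G _ _ (two_le_of_isSignAssignment hs)
  have e : ∀ k, criticalIndices n k ≃ {c // c ∈ m.crit ∧ c.degree = k} := fun k => by
    rw [MorseMatching.crit, hu, hl]
    exact criticalEquiv k
  refine ⟨h, ⟨(cdpBasedComplex G s h).filtration m, fun k => ?_⟩, fun k => ?_⟩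
  · obtain ⟨e1⟩ := (cdpBasedComplex G s h).homology_assocGraded m k
    -- Both sides are free of finite rank, so it is enough to compare the number of critical
    -- generators with the rank of the tensor product.
    refine ⟨e1.trans ((Finsupp.domLCongr (e k).symm).trans (LinearEquiv.ofFinrankEq _ _ ?_))⟩
    rw [finrank_cubeTensorPoly, Module.finrank_finsupp_self, Fintype.card_coe, card_criticalIndices]
  · refine ((cdpBasedComplex G s h).rank_homology m k).trans ?_
    rw [← Cardinal.mk_congr (e k), Cardinal.mk_coe_finset, card_criticalIndices]
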